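/- An oriented four-valent ribbon graph is a connected ribbon graph given by a finite set of half-edges, a permutation $s_0$ all of whose cycles have length $4$ (the vertices), a fixed-point free involution $s_1$ (its orbits are the edges), and a sign on the half-edges that is constant on the cycles of $s_2=s_1s_0^{-1}$ (the boundaries) and opposite on the two halves of each edge; so every boundary is positive or negative. Its genus $g$ is that of the closed surface obtained by gluing a disc along each boundary. For finite sets of labels of the positive and negative boundaries, of cardinalities $n^+$ and $n^-$, and for $L=(L^+|L^-)$, let $Z_{g,n^+,n^-}(L^+|L^-)$ be the volume of the moduli space of metrics on such graphs of genus $g$ with boundary lengths $L$, that is $$Z_{g,n^+,n^-}(L^+|L^-)=\sum_{[R]}\frac{\mathrm{Vol}\{m\in\mathbb{R}_{>0}^{E(R)} : \ell_\beta(m)=L_\beta \text{ for every boundary } \beta\}}{\#\mathrm{Aut}(R)} ,$$ where the sum is over the isomorphism classes of such graphs $R$ of genus $g$ with $n^+$ positive and $n^-$ negative labelled boundaries, $E(R)$ is the set of edges, $\ell_\beta(m)$ is the sum of the lengths of the half-edges in $\beta$, automorphisms fix each boundary, and the volume is the Lebesgue measure of the affine space $\{\ell_\beta=L_\beta\}$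 normalised by the lattice of integral points of $\{u\in\mathbb{R}^{E(R)}:\ell_\beta(u)=0 \text{ for every } \beta\}$. (In particular $Z_{g,n^+,n^-}=0$ if there are no such graphs, and $Z_{g,n^+,n^-}(L^+|L^-)=0$ unless all $L_\beta$ are positive.) For a family $L$ and a set $I$ of indices, $L_I=(L_k)_{k\in I}$, and $[x]_+=\max(x,0)$. Theorem. Let $g\ge 0$, $n^+,n^-\ge 1$ with $2g-2+n^++n^-\ge 1$, and let $L^+\in\mathbb{R}_{>0}^{n^+}$, $L^-\in\mathbb{R}_{>0}^{n^-}$ with $\sum_iL_i^+=\sum_jL_j^-$. Then $Z_{g,n^+,n^-}(L^+|L^-)$ is finite. If moreover $2g-2+n^++n^-\ge 2$, then the integrands below are integrable and \begin{align*} (2g-2+n^++n^-)\,Z_{g,n^+,n^-}(L^+|L^-)={}& \sum_{i}\sum_{j} [L_i^+-L_j^-]_+\,Z_{g,n^+,n^--1}([L_i^+-L_j^-]_+,L^+_{\{i\}^c}|L^-_{\{j\}^c})\\ &+\frac12\sum_{i\neq j} (L_i^++L_j^+)\,Z_{g,n^+-1,n^-}(L_i^++L_j^+,L^+_{\{i,j\}^c}|L^-)\\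 &+\frac12\sum_{i} \int_0^{L_i^+} Z_{g-1,n^++1,n^-}(x,L_i^+-x,L^+_{\{i\}^c}|L^-)\,x(L_i^+-x)\, dx\\ &+\frac12\sum_{i}\ \sum_{\substack{g_1+g_2=g\\ I_1^{\pm} \sqcup I_2^{\pm}=I^{\pm}}} x_1 x_2\, Z_{g_1,n^+_1+1,n^-_1}(x_1,L^+_{I_1^+}|L^-_{I_1^-})\, Z_{g_2,n^+_2+1,n^-_2}(x_2,L^+_{I_2^+}|L^-_{I_2^-}), \end{align*} where the third term is absent if $g=0$. In the last term $I^+=\{1,\dots,n^+\}\setminus\{i\}$, $I^-=\{1,\dots,n^-\}$, the sum is over ordered decompositions, $n_l^\pm=\#I_l^\pm$, and $x_l=\sum_{k\in I^-_l}L_k^--\sum_{k\in I^+_l}L_k^+$. -/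

import Mathlib

open MeasureTheory
open scoped ENNReal

/-- An oriented four-valent ribbon graph on the finite set `X` of half-edges, whose positive
boundaries are labelled by `P` and whose negative boundaries are labelled by `M`.

`s1` exchanges the two halves of an edge, `s0` is the cyclic order at the vertices, and
`s2 = s1 ∘ s0⁻¹` is the boundary permutation; vertices, edges and boundaries (faces) are the
cycles of `s0`, `s1`, `s2` (fixed points included). The graph is connected and non-empty. -/
structure OrientedRibbonGraph (X P M : Type) where
  /-- the cyclic order of the half-edges around the vertices -/
  s0 : Equiv.Perm X
  /-- the involution whose orbits are the edges -/
  s1 : Equiv.Perm X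
  s1_invol : ∀ x, s1 (s1 x) = x
  s1_ne : ∀ x, s1 x ≠ x
  nonempty : Nonempty X
  connected : ∀ x y, ∃ w ∈ Subgroup.closure {s0, s1}, w x = y
  /-- every vertex has degree four -/
  fourValent : ∀ x, Nat.card {y // s0.SameCycle x y} = 4
  /-- the orientation: a sign on the half-edges, constant along the boundaries and
  opposite on the two halves of an edge -/
  sign : X → ℤˣ
  sign_s1 : ∀ x, sign (s1 x) = - sign x
  sign_s2 : ∀ x, sign ((s1 * s0⁻¹) x) = sign x
  /-- the labelling of the boundaries -/
  label : Quotient (Equiv.Perm.SameCycle.setoid (s1 * s0⁻¹)) ≃ P ⊕ M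
  label_sign : ∀ x, sign x = 1 ↔ (label (Quotient.mk _ x)).isLeft

namespace OrientedRibbonGraph

variable {X P M : Type}

/-- The boundary permutation. -/
abbrev s2 (R : OrientedRibbonGraph X P M) : Equiv.Perm X := R.s1 * R.s0⁻¹

/-- The vertices. -/
abbrev Vertex (R : OrientedRibbonGraph X P M) : Type :=
  Quotient (Equiv.Perm.SameCycle.setoid R.s0)

/-- The (unoriented) edges. -/
abbrev Edge (R : OrientedRibbonGraph X P M) : Type :=
  Quotient (Equiv.Perm.SameCycle.setoid R.s1)

/-- The boundaries. -/
abbrev Face (R : OrientedRibbonGraph X P M) : Type :=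
  Quotient (Equiv.Perm.SameCycle.setoid R.s2)

/-- The edge to which a half-edge belongs. -/
def edge (R : OrientedRibbonGraph X P M) (x : X) : R.Edge := Quotient.mk _ x

/-- The label of the boundary to which a half-edge belongs. -/
def face (R : OrientedRibbonGraph X P M) (x : X) : P ⊕ M := R.label (Quotient.mk _ x)

/-- The surface carrying `R` has genus `g`: the Euler characteristic of the closed surface
obtained by gluing a disc along each boundary is `2 - 2g`. -/
def HasGenus (R : OrientedRibbonGraph X P M) (g : ℕ) : Prop :=
  (Nat.card R.Vertex : ℤ) - Nat.card R.Edge + Nat.card R.Face = 2 - 2 * g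

/-- `φ` is an isomorphism of oriented ribbon graphs that respects the labels of the
boundaries. -/
structure IsIso (R R' : OrientedRibbonGraph X P M) (φ : Equiv.Perm X) : Prop where
  map_s0 : ∀ x, φ (R.s0 x) = R'.s0 (φ x)
  map_s1 : ∀ x, φ (R.s1 x) = R'.s1 (φ x)
  map_sign : ∀ x, R'.sign (φ x) = R.sign x
  map_face : ∀ x, R'.face (φ x) = R.face x

/-- The automorphisms of `R` (they fix each boundary). -/
def Aut (R : OrientedRibbonGraph X P M) : Type := {φ : Equiv.Perm X // IsIso R R φ}

open scoped Classical in
/-- The map sending a weight on the edges to the lengths of the boundaries: the length of a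
boundary is the sum of the weights of the half-edges belonging to it. -/
noncomputable def boundaryLength [Fintype X] (A : Type) [CommRing A]
    (R : OrientedRibbonGraph X P M) : (R.Edge → A) →ₗ[A] (P ⊕ M → A) where
  toFun m β := ∑ x with R.face x = β, m (R.edge x)
  map_add' m m' := by
    funext β
    simp [Finset.sum_add_distrib]
  map_smul' a m := by
    funext β
    simp [Finset.mul_sum]

/-- The lattice of integral weights on the edges for which all boundary lengths vanish. -/
noncomputable def integralKernel [Fintype X] (R : OrientedRibbonGraph X P M) :
    Submodule ℤ (R.Edge → ℤ) :=
  LinearMap.ker (R.boundaryLength ℤ)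

/-- A basis over `ℤ` of the lattice of integral weights with vanishing boundary lengths. -/
noncomputable def kernelBasis [Fintype X] (R : OrientedRibbonGraph X P M) :
    Module.Basis (Module.Free.ChooseBasisIndex ℤ R.integralKernel) ℤ R.integralKernel :=
  Module.Free.chooseBasis ℤ R.integralKernel

open scoped Classical in
/-- The affine measure on the affine space of real weights with boundary lengths `L`,
normalised by the lattice of integral weights with vanishing boundary lengths: it is the image
of the Lebesgue measure under the affine coordinates given by an origin and a basis of the
lattice (and does not depend on them). -/
noncomputable def levelMeasure [Fintype X] (R : OrientedRibbonGraph X P M)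
    (L : P ⊕ M → ℝ) : Measure (R.Edge → ℝ) :=
  if h : ∃ m, R.boundaryLength ℝ m = L then
    Measure.map
      (fun (t : Module.Free.ChooseBasisIndex ℤ R.integralKernel → ℝ) (e : R.Edge) =>
        h.choose e + ∑ k, t k * ((R.kernelBasis k : R.Edge → ℤ) e : ℝ))
      volume
  else 0

/-- The metrics on `R` with boundary lengths `L`. -/
def metrics [Fintype X] (R : OrientedRibbonGraph X P M) (L : P ⊕ M → ℝ) :
    Set (R.Edge → ℝ) :=
  {m | (∀ e, 0 < m e) ∧ R.boundaryLength ℝ m = L}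

end OrientedRibbonGraph

/-- The oriented four-valent ribbon graphs of genus `g` with boundaries labelled by `P` and
`M`. If `n = #P + #M`, such a graph has `2g - 2 + n` vertices and hence `4 (2g - 2 + n)`
half-edges, and we number these. -/
def GenericRibbonGraph (g : ℕ) (P M : Type) : Type :=
  {R : OrientedRibbonGraph (Fin (4 * (2 * g + Nat.card P + Nat.card M - 2))) P M //
    R.HasGenus g}

/-- Isomorphism of labelled oriented ribbon graphs. -/
def GenericRibbonGraph.setoid (g : ℕ) (P M : Type) : Setoid (GenericRibbonGraph g P M) where
  r R R' := ∃ φ, R.1.IsIso R'.1 φ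
  iseqv :=
    { refl := fun R => ⟨1, ⟨fun _ => rfl, fun _ => rfl, fun _ => rfl, fun _ => rfl⟩⟩
      symm := by
        rintro R R' ⟨φ, h⟩
        refine ⟨φ⁻¹, ⟨fun x => ?_, fun x => ?_, fun x => ?_, fun x => ?_⟩⟩
        · apply φ.injective
          rw [h.map_s0]
          simp
        · apply φ.injective
          rw [h.map_s1]
          simp
        · rw [← h.map_sign]
          simp
        · rw [← h.map_face]
          simp
      trans := by
        rintro R R' R'' ⟨φ, h⟩ ⟨ψ, k⟩
        exact ⟨ψ * φ,
          ⟨fun x => by simp [h.map_s0, k.map_s0], fun x => by simp [h.map_s1, k.map_s1],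
            fun x => by simp [h.map_sign, k.map_sign],
            fun x => by simp [h.map_face, k.map_face]⟩⟩ }

/-- The volume, as an extended non-negative number, of the moduli space of oriented four-valent
metric ribbon graphs of genus `g` whose positive boundaries, labelled by `P`, have the lengths
`Lp`, and whose negative boundaries, labelled by `M`, have the lengths `Lm`. The moduli space is
the disjoint union, over the isomorphism classes of graphs `R`, of the quotients of the sets of
metrics on `R` by the finite groups `Aut R`. -/
noncomputable def moduliVolume (g : ℕ) {P M : Type} (Lp : P → ℝ) (Lm : M → ℝ) : ℝ≥0∞ :=
  ∑' c : Quotient (GenericRibbonGraph.setoid g P M),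
    c.out.1.levelMeasure (Sum.elim Lp Lm) (c.out.1.metrics (Sum.elim Lp Lm)) /
      (Nat.card c.out.1.Aut : ℝ≥0∞)

/-- The volume function `Z_{g,n⁺,n⁻}(L⁺|L⁻)`, where `n⁺ = #P` and `n⁻ = #M`. -/
noncomputable def volumeZ (g : ℕ) {P M : Type} (Lp : P → ℝ) (Lm : M → ℝ) : ℝ :=
  (moduliVolume g Lp Lm).toReal

/-- The family `L_I = (L_k)_{k ∈ I}`. -/
def restrictTo {ι : Type} (L : ι → ℝ) (I : Finset ι) : I → ℝ := fun k => L k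

/-- The family `(x, L)`, obtained by adding one more variable to `L`. -/
def adjoinVar {ι : Type} (x : ℝ) (L : ι → ℝ) : Option ι → ℝ := fun o => o.elim x L

/-! Each edge has one positive and one negative side, so a metric with given boundary lengths is a
positive weight on the edges of a bipartite graph whose vertices are the boundaries, with prescribed
sums at each of them. Everything is encoded by permutations of the edges. `ι` exchanges the two
edges whose positive half-edges meet at a four-valent vertex, `τ` turns around the negative
boundaries, and then `τ⁻¹ * ι` must turn around the positive ones. A 2-cycle of `ι` is a four-valent
vertex, a fixed point is a bivalent vertex, that is, a marked point on an edge.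

The recursion comes from removing one vertex. Replacing a 2-cycle of `ι` by two fixed points leaves
`τ`, hence all negative boundaries, unchanged, and multiplies `τ⁻¹ * ι` by a transposition. The two
positive corners of the vertex become two marked points on positive boundaries, and there are three
cases.

If the corners lie on distinct boundaries `i ≠ j`, these merge into one boundary of length `L i + L
j` carrying two points at distance `L i`. The first point is free, which gives the factor `L i + L
j`; the second is then determined, up to a null set of metrics where it falls on a vertex
(`sum_levelVol_join`, `sum_join`).

If both corners lie on `i` and the graph stays connected, `i` splits into boundaries of lengths `x`
and `L i - x` with one marked point on each. Slicing the affine space along `x` gives the integral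
with the factors `x` and `L i - x` (`levelVol_slice`, `sum_cut_connected`).

If the graph falls apart, `x` is forced by the balance of lengths in each part, and the volume is a
product (`levelVol_glue`, `sum_cut_disconnected`). A part without vertices is a circle along a
single negative boundary `j`. It contributes 1, and these parts produce the terms in `[L i - L j]₊`,
once for each of the two sides (`sum_finset_pointedVolSum`).

No Jacobian appears because each change of variables is unimodular: the lattices are compared as
direct sums, or as graphs of integral forms.

Automorphisms are eliminated by numbering the `k` vertices and ordering the two edges of each. A
graph `R` arises from `2 ^ k * k! / #Aut R` maps (`card_isFraming`), so the moduli volume is a plain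
sum over maps divided by `2 ^ k * k!` (`moduliVolume_eq_mapVol`). Passing from `k + 1` to `k`
vertices changes this denominator by `2 * (k + 1)`, which explains the left side of the recursion
and the factors 1/2 (`mapVol_succ`). The recursion is proved with the number of vertices as index,
in extended non-negative reals, so that integrability follows from finiteness of the left side. The
genus is recovered at the end from `exists_genus`. -/

/-! ### Integration over affine spaces normalised by a lattice -/

section LatticeIntegral

variable {E E' ι : Type} [Fintype E] [Fintype E'] [Fintype ι]

/-- The integral of `F` over the real affine space through `m₀` directed by the lattice `K`,
normalised by `K`. -/
noncomputable def latInt (K : Submodule ℤ (E → ℤ)) (m₀ : E → ℝ) (F : (E → ℝ) → ℝ≥0∞) : ℝ≥0∞ :=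
  ∫⁻ t : Module.Free.ChooseBasisIndex ℤ K → ℝ,
    F (fun e => m₀ e + ∑ k, t k * ((Module.Free.chooseBasis ℤ K k : E → ℤ) e : ℝ))

/-- Two bases of the lattice differ by an integral matrix of determinant ±1, which preserves
Lebesgue measure. This lets each later decomposition use a basis adapted to it. -/
theorem latInt_eq_of_basis {K : Submodule ℤ (E → ℤ)} (b : Module.Basis ι ℤ K) (m₀ : E → ℝ)
    {F : (E → ℝ) → ℝ≥0∞} (hF : Measurable F) :
    latInt K m₀ F = ∫⁻ t : ι → ℝ, F (fun e => m₀ e + ∑ k, t k * ((b k : E → ℤ) e : ℝ)) := by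
  classical
  set c := Module.Free.chooseBasis ℤ K with hc
  let σ := b.indexEquiv c
  let c' := c.reindex σ.symm
  let A : Matrix ι ι ℤ := c'.toMatrix b
  have hA : IsUnit A.det := by
    have := c'.invertibleToMatrix b
    exact Matrix.isUnit_det_of_invertible A
  let B : Matrix ι ι ℝ := A.map (Int.castRingHom ℝ)
  have hdet : B.det = (A.det : ℝ) := by
    have := (RingHom.map_det (Int.castRingHom ℝ) A).symm
    simpa [B] using this
  have habs : |B.det| = 1 := by
    rw [hdet]
    rcases Int.isUnit_iff.1 hA with h | h <;> simp [h]
  have hne : B.det ≠ 0 := by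
    intro h; rw [h] at habs; simp at habs
  have hmp : Measure.map (Matrix.toLin' B) (volume : Measure (ι → ℝ)) = volume := by
    rw [Real.map_matrix_volume_pi_eq_smul_volume_pi hne, abs_inv, habs]; simp
  have hcomb : ∀ (t : ι → ℝ) (e : E), ∑ k, t k * ((b k : E → ℤ) e : ℝ) =
      ∑ k, (Matrix.toLin' B t) k * ((c' k : E → ℤ) e : ℝ) := by
    intro t e
    have h1 : ∀ k, ((b k : E → ℤ) e : ℝ) = ∑ l, B l k * ((c' l : E → ℤ) e : ℝ) := by
      intro k
      have := c'.sum_toMatrix_smul_self b k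
      have h2 := congrArg (fun z : K => ((z : E → ℤ) e : ℝ)) this
      simp only [AddSubmonoidClass.coe_finsetSum, Finset.sum_apply, Submodule.coe_smul,
        Pi.smul_apply, smul_eq_mul, Int.cast_sum, Int.cast_mul] at h2
      rw [← h2]
      simp [B, A]
    simp only [h1, Matrix.toLin'_apply, Matrix.mulVec, dotProduct, Finset.mul_sum, Finset.sum_mul]
    rw [Finset.sum_comm]
    refine Finset.sum_congr rfl fun l _ => Finset.sum_congr rfl fun k _ => by ring
  have hmeas : Measurable fun t : ι → ℝ =>
      F (fun e => m₀ e + ∑ k, t k * ((c' k : E → ℤ) e : ℝ)) := by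
    apply hF.comp; fun_prop
  have step1 : ∫⁻ t : ι → ℝ, F (fun e => m₀ e + ∑ k, t k * ((b k : E → ℤ) e : ℝ)) =
      ∫⁻ t : ι → ℝ, F (fun e => m₀ e + ∑ k, t k * ((c' k : E → ℤ) e : ℝ)) := by
    conv_rhs => rw [← hmp]
    rw [lintegral_map hmeas (LinearMap.continuous_of_finiteDimensional _).measurable]
    simp_rw [hcomb]
  rw [step1, latInt]
  have hp := volume_measurePreserving_piCongrLeft (fun _ : Module.Free.ChooseBasisIndex ℤ K => ℝ) σ
  rw [← hp.lintegral_comp_emb (MeasurableEquiv.measurableEmbedding _)]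
  refine lintegral_congr fun t => ?_
  congr 1
  funext e
  congr 1
  rw [← σ.sum_comp]
  refine Finset.sum_congr rfl fun k _ => ?_
  have : (MeasurableEquiv.piCongrLeft (fun _ : Module.Free.ChooseBasisIndex ℤ K => ℝ) σ) t (σ k)
      = t k := by
    simp [MeasurableEquiv.coe_piCongrLeft]
  rw [this]
  simp [c', ← hc]

theorem latInt_add {K : Submodule ℤ (E → ℤ)} (b : Module.Basis ι ℤ K) (m₀ : E → ℝ) (s : ι → ℝ)
    {F : (E → ℝ) → ℝ≥0∞} (hF : Measurable F) :
    latInt K (fun e => m₀ e + ∑ k, s k * ((b k : E → ℤ) e : ℝ)) F = latInt K m₀ F := by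
  rw [latInt_eq_of_basis b _ hF, latInt_eq_of_basis b _ hF,
    ← lintegral_add_left_eq_self
      (fun t : ι → ℝ => F (fun e => m₀ e + ∑ k, t k * ((b k : E → ℤ) e : ℝ))) s]
  refine lintegral_congr fun t => ?_
  congr 1
  funext e
  simp only [Pi.add_apply, add_mul, Finset.sum_add_distrib]
  ring

theorem latInt_congr_of_eq {K : Submodule ℤ (E → ℤ)} {m₀ : E → ℝ} {F G : (E → ℝ) → ℝ≥0∞}
    (h : ∀ t : Module.Free.ChooseBasisIndex ℤ K → ℝ,
      F (fun e => m₀ e + ∑ k, t k * ((Module.Free.chooseBasis ℤ K k : E → ℤ) e : ℝ)) =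
      G (fun e => m₀ e + ∑ k, t k * ((Module.Free.chooseBasis ℤ K k : E → ℤ) e : ℝ))) :
    latInt K m₀ F = latInt K m₀ G :=
  lintegral_congr h

/-- The image under `j` of a basis of `K` is a basis of the image lattice, and `J` is the real
extension of `j`, so the coordinates are literally the same. -/
theorem latInt_map {K : Submodule ℤ (E → ℤ)} (j : (E → ℤ) →ₗ[ℤ] (E' → ℤ))
    (hj : Function.Injective j) (J : (E → ℝ) →ₗ[ℝ] (E' → ℝ))
    (hJ : ∀ z : E → ℤ, J (fun e => (z e : ℝ)) = fun e => (j z e : ℝ)) (m₀ : E → ℝ)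
    {F : (E' → ℝ) → ℝ≥0∞} (hF : Measurable F) :
    latInt (K.map j) (J m₀) F = latInt K m₀ (fun m => F (J m)) := by
  let b := (Module.Free.chooseBasis ℤ K).map (Submodule.equivMapOfInjective j hj K)
  rw [latInt_eq_of_basis b _ hF, latInt]
  refine lintegral_congr fun t => ?_
  congr 1
  have : (fun e => m₀ e + ∑ k, t k * ((Module.Free.chooseBasis ℤ K k : E → ℤ) e : ℝ)) =
      m₀ + ∑ k, t k • (fun e => ((Module.Free.chooseBasis ℤ K k : E → ℤ) e : ℝ)) := by
    funext e; simp
  rw [this, map_add, map_sum]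
  simp only [map_smul, hJ]
  funext e
  simp [b]

/-- Tonelli's theorem for the decomposition of a lattice by an integral form with value `1` at
`u`. -/
theorem latInt_slice {K : Submodule ℤ (E → ℤ)} (φ : (E → ℤ) →ₗ[ℤ] ℤ) {u : E → ℤ} (hu : u ∈ K)
    (hφ : φ u = 1) (m₀ : E → ℝ) {F : (E → ℝ) → ℝ≥0∞} (hF : Measurable F) :
    latInt K m₀ F = ∫⁻ x : ℝ, latInt (K ⊓ LinearMap.ker φ) (fun e => m₀ e + x * u e) F ∧
    Measurable fun x : ℝ => latInt (K ⊓ LinearMap.ker φ) (fun e => m₀ e + x * u e) F := by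
  let K₁ : Submodule ℤ (E → ℤ) := K ⊓ LinearMap.ker φ
  let c := Module.Free.chooseBasis ℤ K₁
  have hφs : ∀ n : ℤ, φ (n • u) = n := fun n => by rw [map_smul, hφ, smul_eq_mul, mul_one]
  -- Since `φ u = 1`, the lattice is the direct sum of the kernel of `φ` and `ℤ u`.
  let eqv : (K₁ × ℤ) ≃ₗ[ℤ] K :=
    { toFun := fun p => ⟨(p.1 : E → ℤ) + p.2 • u, K.add_mem p.1.2.1 (K.smul_mem _ hu)⟩
      invFun := fun k => (⟨(k : E → ℤ) - φ k • u,
        K.sub_mem k.2 (K.smul_mem _ hu), LinearMap.mem_ker.2 (by rw [map_sub, hφs, sub_self])⟩, φ k)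
      map_add' := fun p q => by
        ext e; simp; ring
      map_smul' := fun a p => by
        ext e; simp; ring
      left_inv := fun p => by
        have h : φ (p.1 : E → ℤ) = 0 := p.1.2.2
        have h' : φ ((p.1 : E → ℤ) + p.2 • u) = p.2 := by rw [map_add, h, hφs, zero_add]
        refine Prod.ext (Subtype.ext ?_) h'
        change (p.1 : E → ℤ) + p.2 • u - φ ((p.1 : E → ℤ) + p.2 • u) • u = p.1
        rw [h', add_sub_cancel_right]
      right_inv := fun k => by
        ext e; simp }
  let b : Module.Basis (Module.Free.ChooseBasisIndex ℤ K₁ ⊕ Unit) ℤ K :=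
    (c.prod (Module.Basis.singleton Unit ℤ)).map eqv
  have hval : ∀ (t : Module.Free.ChooseBasisIndex ℤ K₁ ⊕ Unit → ℝ) (e : E),
      m₀ e + ∑ k, t k * ((b k : E → ℤ) e : ℝ) =
      (m₀ e + t (Sum.inr ()) * u e) + ∑ k, t (Sum.inl k) * ((c k : E → ℤ) e : ℝ) := by
    intro t e
    rw [Fintype.sum_sum_type]
    simp [b, eqv]
    ring
  have hmeas2 : Measurable fun p : (Module.Free.ChooseBasisIndex ℤ K₁ → ℝ) × (Unit → ℝ) =>
      F (fun e => (m₀ e + p.2 () * u e) + ∑ k, p.1 k * ((c k : E → ℤ) e : ℝ)) := by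
    apply hF.comp; fun_prop
  have hmeas3 : Measurable fun p : ℝ × (Module.Free.ChooseBasisIndex ℤ K₁ → ℝ) =>
      F (fun e => (m₀ e + p.1 * u e) + ∑ k, p.2 k * ((c k : E → ℤ) e : ℝ)) := by
    apply hF.comp; fun_prop
  constructor
  · rw [latInt_eq_of_basis b _ hF]
    have hp := volume_measurePreserving_sumPiEquivProdPi
      (fun _ : Module.Free.ChooseBasisIndex ℤ K₁ ⊕ Unit => ℝ)
    have hq := volume_preserving_funUnique Unit ℝ
    have h1 := hp.lintegral_comp hmeas2
    simp only [hval]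
    refine Eq.trans ?_ (h1.trans ?_)
    · rfl
    · rw [show (volume : Measure ((Module.Free.ChooseBasisIndex ℤ K₁ → ℝ) × (Unit → ℝ))) =
        (volume : Measure (Module.Free.ChooseBasisIndex ℤ K₁ → ℝ)).prod volume from rfl]
      refine (lintegral_prod_symm' _ hmeas2).trans ?_
      have h2 := hq.lintegral_comp (hmeas3.lintegral_prod_right' (ν := volume))
      exact h2
  · exact (hmeas3.lintegral_prod_right' (ν := volume))

/-- A nonconstant integral form has null level sets. -/
theorem latInt_level_eq_zero {K : Submodule ℤ (E → ℤ)} (a : E → ℤ) {u : E → ℤ}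
    (hu : u ∈ K) (hφ : ∑ e, a e * u e = 1) (m₀ : E → ℝ) (x₀ : ℝ) {F : (E → ℝ) → ℝ≥0∞}
    (hF : Measurable F) (h0 : ∀ m, ∑ e, (a e : ℝ) * m e ≠ x₀ → F m = 0) : latInt K m₀ F = 0 := by
  let φ : (E → ℤ) →ₗ[ℤ] ℤ := ∑ e, a e • LinearMap.proj e
  have hφv : ∀ z, φ z = ∑ e, a e * z e := fun z => by simp [φ]
  rw [(latInt_slice φ hu (by rw [hφv, hφ]) m₀ hF).1]
  rw [lintegral_eq_zero_iff (latInt_slice φ hu (by rw [hφv, hφ]) m₀ hF).2]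
  -- On the slice of parameter `x` the form is constant, equal to its value at `m₀` plus `x`; so a
  -- single slice can meet the level `x₀`.
  have : ∀ᵐ x : ℝ, x ≠ x₀ - ∑ e, (a e : ℝ) * m₀ e := by
    simp [ae_iff]
  filter_upwards [this] with x hx
  have hz : ∀ t : Module.Free.ChooseBasisIndex ℤ ↥(K ⊓ LinearMap.ker φ) → ℝ,
      F (fun e => (m₀ e + x * u e) + ∑ k, t k *
        ((Module.Free.chooseBasis ℤ ↥(K ⊓ LinearMap.ker φ) k : E → ℤ) e : ℝ)) = 0 := by
    intro t
    apply h0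
    intro h
    apply hx
    simp only [mul_add, Finset.sum_add_distrib, Finset.mul_sum] at h
    rw [Finset.sum_comm] at h
    have h2 : ∀ k, ∑ e, (a e : ℝ) * (t k *
        ((Module.Free.chooseBasis ℤ ↥(K ⊓ LinearMap.ker φ) k : E → ℤ) e : ℝ)) = 0 := by
      intro k
      have h3 : φ (Module.Free.chooseBasis ℤ ↥(K ⊓ LinearMap.ker φ) k : E → ℤ) = 0 :=
        (Module.Free.chooseBasis ℤ ↥(K ⊓ LinearMap.ker φ) k).2.2
      rw [hφv] at h3
      have h4 : ∑ e, (a e : ℝ) *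
        ((Module.Free.chooseBasis ℤ ↥(K ⊓ LinearMap.ker φ) k : E → ℤ) e : ℝ) = 0 := by
        exact_mod_cast h3
      rw [← mul_zero (t k), ← h4, Finset.mul_sum]
      exact Finset.sum_congr rfl fun e _ => by ring
    simp only [h2, Finset.sum_const_zero, add_zero] at h
    have h5 : ∑ e, (a e : ℝ) * (x * u e) = x := by
      have : ∑ e, (a e : ℝ) * u e = 1 := by exact_mod_cast hφ
      calc ∑ e, (a e : ℝ) * (x * u e) = x * ∑ e, (a e : ℝ) * u e := by
            rw [Finset.mul_sum]; exact Finset.sum_congr rfl fun e _ => by ring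
        _ = x := by rw [this, mul_one]
    rw [h5] at h
    linarith
  simp only [latInt, Pi.zero_apply]
  simp [hz]

/-- A basis of a direct sum is the union of bases, so Lebesgue measure is a product measure in these
coordinates. -/
theorem latInt_prod (K₁ : Submodule ℤ (E → ℤ)) (K₂ : Submodule ℤ (E' → ℤ))
    (K : Submodule ℤ (E ⊕ E' → ℤ))
    (hK : ∀ z, z ∈ K ↔ (fun e => z (Sum.inl e)) ∈ K₁ ∧ (fun e => z (Sum.inr e)) ∈ K₂)
    (m₁ : E → ℝ) (m₂ : E' → ℝ) {F : (E ⊕ E' → ℝ) → ℝ≥0∞} {F₁ : (E → ℝ) → ℝ≥0∞}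
    {F₂ : (E' → ℝ) → ℝ≥0∞} (hF : Measurable F) (hF₁ : Measurable F₁) (hF₂ : Measurable F₂)
    (h : ∀ m, F m = F₁ (fun e => m (Sum.inl e)) * F₂ (fun e => m (Sum.inr e))) :
    latInt K (Sum.elim m₁ m₂) F = latInt K₁ m₁ F₁ * latInt K₂ m₂ F₂ := by
  let c₁ := Module.Free.chooseBasis ℤ K₁
  let c₂ := Module.Free.chooseBasis ℤ K₂
  let eqv : (K₁ × K₂) ≃ₗ[ℤ] K :=
    { toFun := fun p => ⟨Sum.elim (p.1 : E → ℤ) (p.2 : E' → ℤ), by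
        rw [hK]; exact ⟨p.1.2, p.2.2⟩⟩
      invFun := fun k => (⟨_, ((hK k).1 k.2).1⟩, ⟨_, ((hK k).1 k.2).2⟩)
      map_add' := fun p q => by
        ext e; cases e <;> simp
      map_smul' := fun a p => by
        ext e; cases e <;> simp
      left_inv := fun p => by
        ext e <;> simp
      right_inv := fun k => by
        ext e; cases e <;> simp }
  let b : Module.Basis (Module.Free.ChooseBasisIndex ℤ K₁ ⊕ Module.Free.ChooseBasisIndex ℤ K₂) ℤ K :=
    (c₁.prod c₂).map eqv
  rw [latInt_eq_of_basis b _ hF]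
  have hp := volume_measurePreserving_sumPiEquivProdPi
      (fun _ : Module.Free.ChooseBasisIndex ℤ K₁ ⊕ Module.Free.ChooseBasisIndex ℤ K₂ => ℝ)
  have g1 : Measurable fun t : Module.Free.ChooseBasisIndex ℤ K₁ → ℝ =>
      F₁ (fun e => m₁ e + ∑ k, t k * ((c₁ k : E → ℤ) e : ℝ)) := by
    apply hF₁.comp; fun_prop
  have g2 : Measurable fun t : Module.Free.ChooseBasisIndex ℤ K₂ → ℝ =>
      F₂ (fun e => m₂ e + ∑ k, t k * ((c₂ k : E' → ℤ) e : ℝ)) := by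
    apply hF₂.comp; fun_prop
  have hval : ∀ (t : Module.Free.ChooseBasisIndex ℤ K₁ ⊕ Module.Free.ChooseBasisIndex ℤ K₂ → ℝ),
      F (fun e => Sum.elim m₁ m₂ e + ∑ k, t k * ((b k : E ⊕ E' → ℤ) e : ℝ)) =
      F₁ (fun e => m₁ e + ∑ k, t (Sum.inl k) * ((c₁ k : E → ℤ) e : ℝ)) *
      F₂ (fun e => m₂ e + ∑ k, t (Sum.inr k) * ((c₂ k : E' → ℤ) e : ℝ)) := by
    intro t
    rw [h]
    simp [Fintype.sum_sum_type, b, eqv]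
  simp only [hval]
  have h1 := hp.lintegral_comp (f := fun p => F₁ (fun e => m₁ e + ∑ k, p.1 k * ((c₁ k : E → ℤ) e : ℝ)) *
      F₂ (fun e => m₂ e + ∑ k, p.2 k * ((c₂ k : E' → ℤ) e : ℝ)))
      ((g1.comp measurable_fst).mul (g2.comp measurable_snd))
  refine Eq.trans ?_ (h1.trans ?_)
  · rfl
  · exact lintegral_prod_mul g1.aemeasurable g2.aemeasurable

end LatticeIntegral


/-! ### Volumes of spaces of metrics with given boundary lengths -/

section LevelIntegral

open scoped Classical

variable {E E' P M P' M' : Type} [Fintype E] [Fintype E']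

/-- The sum of the weights `m` over the fibre of `f` above `q`. -/
noncomputable def fibreSum {Q A : Type} [AddCommMonoid A] (f : E → Q) (m : E → A) (q : Q) : A :=
  ∑ e, if f e = q then m e else 0

theorem fibreSum_add {Q A : Type} [AddCommMonoid A] (f : E → Q) (m m' : E → A) (q : Q) :
    fibreSum f (fun e => m e + m' e) q = fibreSum f m q + fibreSum f m' q := by
  rw [fibreSum, fibreSum, fibreSum, ← Finset.sum_add_distrib]
  refine Finset.sum_congr rfl fun e _ => ?_
  split_ifs <;> simp

theorem fibreSum_sub {Q A : Type} [AddCommGroup A] (f : E → Q) (m m' : E → A) (q : Q) :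
    fibreSum f (fun e => m e - m' e) q = fibreSum f m q - fibreSum f m' q := by
  rw [fibreSum, fibreSum, fibreSum, ← Finset.sum_sub_distrib]
  refine Finset.sum_congr rfl fun e _ => ?_
  split_ifs <;> simp

theorem fibreSum_mul {Q A : Type} [Ring A] (f : E → Q) (a : A) (m : E → A) (q : Q) :
    fibreSum f (fun e => a * m e) q = a * fibreSum f m q := by
  rw [fibreSum, fibreSum, Finset.mul_sum]
  refine Finset.sum_congr rfl fun e _ => ?_
  split_ifs <;> simp

theorem fibreSum_zero {Q A : Type} [AddCommMonoid A] (f : E → Q) (q : Q) :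
    fibreSum f (fun _ => (0 : A)) q = 0 := by
  simp [fibreSum]

theorem fibreSum_cast {Q : Type} (f : E → Q) (z : E → ℤ) (q : Q) :
    fibreSum f (fun e => (z e : ℝ)) q = (fibreSum f z q : ℤ) := by
  simp [fibreSum]

theorem fibreSum_sum {Q A κ : Type} [AddCommMonoid A] (s : Finset κ) (f : E → Q) (m : κ → E → A)
    (q : Q) : fibreSum f (fun e => ∑ k ∈ s, m k e) q = ∑ k ∈ s, fibreSum f (m k) q := by
  simp only [fibreSum]
  rw [Finset.sum_comm]
  refine Finset.sum_congr rfl fun e _ => ?_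
  split_ifs <;> simp

theorem fibreSum_comp_equiv {Q A : Type} [AddCommMonoid A] (e : E' ≃ E) (f : E → Q) (m : E → A)
    (q : Q) : fibreSum (fun x => f (e x)) (fun x => m (e x)) q = fibreSum f m q :=
  e.sum_comp fun x => if f x = q then m x else 0

theorem sum_fibreSum {Q A : Type} [Fintype Q] [AddCommMonoid A] (f : E → Q) (m : E → A) :
    ∑ q, fibreSum f m q = ∑ e, m e := by
  simp only [fibreSum]
  rw [Finset.sum_comm]
  simp

theorem fibreSum_single {Q A : Type} [AddCommMonoid A] (f : E → Q) (e : E) (a : A) (q : Q) :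
    fibreSum f (Pi.single e a) q = if f e = q then a else 0 := by
  rw [fibreSum, Finset.sum_eq_single e]
  · simp
  · intro b _ hb
    simp [Pi.single_eq_of_ne hb]
  · simp

/-- The weights whose fibre sums along `fp` and `fm` are `Lp` and `Lm`. -/
def IsLevel {A : Type} [AddCommMonoid A] (fp : E → P) (fm : E → M) (Lp : P → A) (Lm : M → A)
    (m : E → A) : Prop :=
  (∀ i, fibreSum fp m i = Lp i) ∧ ∀ j, fibreSum fm m j = Lm j

/-- The integral weights with vanishing fibre sums. -/
noncomputable def kerLat (fp : E → P) (fm : E → M) : Submodule ℤ (E → ℤ) where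
  carrier := {m | IsLevel fp fm 0 0 m}
  add_mem' := fun {a b} ha hb =>
    ⟨fun i => (fibreSum_add fp a b i).trans (by rw [ha.1, hb.1]; simp),
      fun j => (fibreSum_add fm a b j).trans (by rw [ha.2, hb.2]; simp)⟩
  zero_mem' := ⟨fun i => fibreSum_zero fp i, fun j => fibreSum_zero fm j⟩
  smul_mem' := fun c a ha =>
    ⟨fun i => (fibreSum_mul fp c a i).trans (by rw [ha.1]; simp),
      fun j => (fibreSum_mul fm c a j).trans (by rw [ha.2]; simp)⟩

theorem mem_kerLat {fp : E → P} {fm : E → M} {z : E → ℤ} :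
    z ∈ kerLat fp fm ↔ IsLevel fp fm 0 0 z := Iff.rfl

theorem IsLevel.comb {fp : E → P} {fm : E → M} {Lp : P → ℝ} {Lm : M → ℝ} {m : E → ℝ}
    (h : IsLevel fp fm Lp Lm m) {κ : Type} [Fintype κ] (b : κ → kerLat fp fm) (t : κ → ℝ) :
    IsLevel fp fm Lp Lm (fun e => m e + ∑ k, t k * ((b k : E → ℤ) e : ℝ)) := by
  constructor
  · intro i
    rw [fibreSum_add, h.1, fibreSum_sum]
    simp only [fibreSum_mul, fibreSum_cast, (b _).2.1]
    simp
  · intro i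
    rw [fibreSum_add, h.2, fibreSum_sum]
    simp only [fibreSum_mul, fibreSum_cast, (b _).2.2]
    simp

theorem exists_int_multiple {κ : Type} [Fintype κ] (c : κ → ℚ) :
    ∃ N : ℕ, 0 < N ∧ ∃ z : κ → ℤ, ∀ k, (z k : ℚ) = N * c k := by
  refine ⟨∏ k, (c k).den, Finset.prod_pos fun k _ => (c k).den_pos,
    fun k => (∏ l ∈ Finset.univ.erase k, (c l).den : ℕ) * (c k).num, fun k => ?_⟩
  rw [← Finset.mul_prod_erase Finset.univ (fun k => (c k).den) (Finset.mem_univ k)]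
  push_cast
  rw [mul_comm ((c k).den : ℚ), mul_assoc, Rat.den_mul_eq_num]

/-- The real weights with vanishing fibre sums are spanned by the integral ones. -/
theorem exists_real_coords {κ : Type} [Fintype κ] {fp : E → P} {fm : E → M}
    (b : Module.Basis κ ℤ (kerLat fp fm)) {d : E → ℝ} (hd : IsLevel fp fm 0 0 d) :
    ∃ s : κ → ℝ, d = fun e => ∑ k, s k * ((b k : E → ℤ) e : ℝ) := by
  let v : κ → E → ℝ := fun k e => ((b k : E → ℤ) e : ℝ)
  let W : Submodule ℝ (E → ℝ) := Submodule.span ℝ (Set.range v)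
  have hK : ∀ z ∈ kerLat fp fm, (fun e => (z e : ℝ)) ∈ W := by
    intro z hz
    have h := b.sum_repr ⟨z, hz⟩
    have h2 : (fun e => (z e : ℝ)) = ∑ k, (b.repr ⟨z, hz⟩ k : ℝ) • v k := by
      funext e
      have h3 := congrArg (fun y : kerLat fp fm => ((y : E → ℤ) e : ℝ)) h
      simp only [AddSubmonoidClass.coe_finsetSum, Finset.sum_apply, Submodule.coe_smul,
        Pi.smul_apply, smul_eq_mul, Int.cast_sum, Int.cast_mul] at h3
      rw [← h3]
      simp [v]
    rw [h2]
    exact Submodule.sum_mem _ fun k _ => Submodule.smul_mem _ _ (Submodule.subset_span ⟨k, rfl⟩)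
  suffices hdW : d ∈ W by
    obtain ⟨s, hs⟩ := (Submodule.mem_span_range_iff_exists_fun ℝ).1 hdW
    refine ⟨s, ?_⟩
    rw [← hs]
    funext e
    simp [v]
  -- The equations have rational coefficients, so each coordinate of `d` in a basis of `ℝ` over `ℚ`
  -- is a rational solution, hence proportional to an integral one. Only the finite set `T` of
  -- coordinates is involved.
  let H := Module.Basis.ofVectorSpace ℚ ℝ
  let T : Finset _ := Finset.univ.biUnion fun e => (H.repr (d e)).support
  have hrepr : ∀ {Q : Type} (f : E → Q) (q : Q) i, fibreSum f d q = 0 →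
      fibreSum f (fun e => H.repr (d e) i) q = 0 := by
    intro Q f q i h
    have := congrArg (fun x => H.repr x i) h
    simp only [fibreSum, map_sum, Finsupp.finsetSum_apply, map_zero, Finsupp.coe_zero,
      Pi.zero_apply] at this
    rw [fibreSum]
    refine Eq.trans (Finset.sum_congr rfl fun e _ => ?_) this
    split_ifs <;> simp
  have hq : ∀ i, (fun e => ((H.repr (d e) i : ℚ) : ℝ)) ∈ W := by
    intro i
    obtain ⟨N, hN, z, hz⟩ := exists_int_multiple fun e => H.repr (d e) i
    have hzf : ∀ {Q : Type} (f : E → Q) (q : Q), fibreSum f d q = 0 → fibreSum f z q = 0 := by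
      intro Q f q h
      have h1 := hrepr f q i h
      have h2 : ((fibreSum f z q : ℤ) : ℚ) = N * fibreSum f (fun e => H.repr (d e) i) q := by
        rw [← fibreSum_mul]
        simp only [← hz]
        simp [fibreSum]
      rw [h1, mul_zero] at h2
      exact_mod_cast h2
    have hzK : z ∈ kerLat fp fm := ⟨fun q => hzf fp q (hd.1 q), fun q => hzf fm q (hd.2 q)⟩
    have h3 : (fun e => ((H.repr (d e) i : ℚ) : ℝ)) = ((N : ℝ)⁻¹) • fun e => (z e : ℝ) := by
      funext e
      have h4 : (z e : ℝ) = N * ((H.repr (d e) i : ℚ) : ℝ) := by exact_mod_cast hz e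
      have h5 : (N : ℝ) ≠ 0 := by positivity
      simp only [Pi.smul_apply, smul_eq_mul, h4]
      field_simp
    rw [h3]
    exact Submodule.smul_mem _ _ (hK z hzK)
  have hsum : d = ∑ i ∈ T, (H i) • fun e => ((H.repr (d e) i : ℚ) : ℝ) := by
    funext e
    conv_lhs => rw [← H.linearCombination_repr (d e), Finsupp.linearCombination_apply, Finsupp.sum]
    rw [Finset.sum_apply]
    rw [Finset.sum_subset (s₂ := T)]
    · refine Finset.sum_congr rfl fun i _ => ?_
      simp only [Pi.smul_apply, smul_eq_mul, Rat.smul_def]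
      ring
    · intro i hi
      exact Finset.mem_biUnion.2 ⟨e, Finset.mem_univ _, hi⟩
    · intro i _ hi
      rw [Finsupp.notMem_support_iff.1 hi, zero_smul]
  rw [hsum]
  exact Submodule.sum_mem _ fun i _ => Submodule.smul_mem _ _ (hq i)

/-- The integral of `F` over the real weights with fibre sums `Lp` and `Lm`, normalised by the
integral weights with vanishing fibre sums. -/
noncomputable def levelInt (fp : E → P) (fm : E → M) (Lp : P → ℝ) (Lm : M → ℝ)
    (F : (E → ℝ) → ℝ≥0∞) : ℝ≥0∞ :=
  if h : ∃ m₀, IsLevel fp fm Lp Lm m₀ then latInt (kerLat fp fm) h.choose F else 0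

/-- Two origins differ by a real solution of the homogeneous equations, which is a real combination
of lattice vectors; translation invariance concludes. -/
theorem levelInt_eq {fp : E → P} {fm : E → M} {Lp : P → ℝ} {Lm : M → ℝ} {m₀ : E → ℝ}
    (h : IsLevel fp fm Lp Lm m₀) {F : (E → ℝ) → ℝ≥0∞} (hF : Measurable F) :
    levelInt fp fm Lp Lm F = latInt (kerLat fp fm) m₀ F := by
  have h' : ∃ m₀, IsLevel fp fm Lp Lm m₀ := ⟨m₀, h⟩
  rw [levelInt, dif_pos h']
  have hc := h'.choose_spec
  set m₁ := h'.choose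
  have hd : IsLevel fp fm 0 0 (fun e => m₁ e - m₀ e) := by
    constructor
    · intro i; rw [fibreSum_sub, hc.1, h.1]; simp
    · intro i; rw [fibreSum_sub, hc.2, h.2]; simp
  obtain ⟨s, hs⟩ := exists_real_coords (Module.Free.chooseBasis ℤ (kerLat fp fm)) hd
  rw [← latInt_add (Module.Free.chooseBasis ℤ (kerLat fp fm)) m₀ s hF]
  congr 1
  funext e
  rw [← congrFun hs e]
  ring

theorem levelInt_eq_zero {fp : E → P} {fm : E → M} {Lp : P → ℝ} {Lm : M → ℝ}
    (h : ¬∃ m₀, IsLevel fp fm Lp Lm m₀) (F : (E → ℝ) → ℝ≥0∞) : levelInt fp fm Lp Lm F = 0 := by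
  rw [levelInt, dif_neg h]

theorem levelInt_congr {fp : E → P} {fm : E → M} {Lp : P → ℝ} {Lm : M → ℝ}
    {F G : (E → ℝ) → ℝ≥0∞} (h : ∀ m, IsLevel fp fm Lp Lm m → F m = G m) :
    levelInt fp fm Lp Lm F = levelInt fp fm Lp Lm G := by
  rw [levelInt, levelInt]
  split_ifs with h'
  · exact latInt_congr_of_eq fun t => h _ (h'.choose_spec.comb _ _)
  · rfl

/-- The real equations determine the affine space and the integral ones its normalisation, so both
equivalences are needed. -/
theorem levelInt_congr_level {fp : E → P} {fm : E → M} {Lp : P → ℝ} {Lm : M → ℝ}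
    {fp' : E → P'} {fm' : E → M'} {Lp' : P' → ℝ} {Lm' : M' → ℝ}
    (hK : ∀ z : E → ℤ, IsLevel fp fm 0 0 z ↔ IsLevel fp' fm' 0 0 z)
    (hL : ∀ m, IsLevel fp fm Lp Lm m ↔ IsLevel fp' fm' Lp' Lm' m)
    {F : (E → ℝ) → ℝ≥0∞} (hF : Measurable F) :
    levelInt fp fm Lp Lm F = levelInt fp' fm' Lp' Lm' F := by
  have hK' : kerLat fp fm = kerLat fp' fm' := Submodule.ext hK
  by_cases h : ∃ m₀, IsLevel fp fm Lp Lm m₀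
  · obtain ⟨m₀, hm⟩ := h
    rw [levelInt_eq hm hF, levelInt_eq ((hL m₀).1 hm) hF, hK']
  · rw [levelInt_eq_zero h, levelInt_eq_zero]
    rintro ⟨m₀, hm⟩
    exact h ⟨m₀, (hL m₀).2 hm⟩

theorem levelInt_comp_equiv (e : E' ≃ E) (fp : E → P) (fm : E → M) (Lp : P → ℝ) (Lm : M → ℝ)
    {F : (E' → ℝ) → ℝ≥0∞} (hF : Measurable F) :
    levelInt (fun x => fp (e x)) (fun x => fm (e x)) Lp Lm F =
      levelInt fp fm Lp Lm (fun m => F (fun x => m (e x))) := by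
  have hlev : ∀ {A : Type} [AddCommMonoid A] (Lp : P → A) (Lm : M → A) (m : E → A),
      IsLevel (fun x => fp (e x)) (fun x => fm (e x)) Lp Lm (fun x => m (e x)) ↔
      IsLevel fp fm Lp Lm m := by
    intro A _ Lp Lm m
    simp only [IsLevel, fibreSum_comp_equiv]
  have hsymm : ∀ {A : Type} (m : E' → A), m = fun x => (fun y => m (e.symm y)) (e x) := by
    intro A m; funext x; simp
  have hker : kerLat (fun x => fp (e x)) (fun x => fm (e x)) =
      (kerLat fp fm).map (LinearMap.funLeft ℤ ℤ e) := by
    ext z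
    rw [Submodule.mem_map]
    constructor
    · intro hz
      refine ⟨fun y => z (e.symm y), ?_, (hsymm z).symm⟩
      rw [mem_kerLat, ← hlev, ← hsymm]
      exact hz
    · rintro ⟨y, hy, rfl⟩
      exact (hlev 0 0 y).2 hy
  by_cases h : ∃ m₀, IsLevel fp fm Lp Lm m₀
  · obtain ⟨m₀, hm⟩ := h
    have hF' : Measurable fun m : E → ℝ => F (fun x => m (e x)) := by
      apply hF.comp; fun_prop
    rw [levelInt_eq hm hF', levelInt_eq ((hlev Lp Lm m₀).2 hm) hF, hker]
    exact latInt_map (LinearMap.funLeft ℤ ℤ e)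
      (LinearMap.funLeft_injective_of_surjective _ _ _ e.surjective) (LinearMap.funLeft ℝ ℝ e)
      (fun z => rfl) m₀ hF
  · rw [levelInt_eq_zero h, levelInt_eq_zero]
    rintro ⟨m₀, hm⟩
    rw [hsymm m₀] at hm
    exact h ⟨fun y => m₀ (e.symm y), (hlev _ _ _).1 hm⟩

/-- The indicator function of the positive weights. -/
noncomputable def posInd (m : E → ℝ) : ℝ≥0∞ := if ∀ e, 0 < m e then 1 else 0

theorem measurable_posInd : Measurable (posInd : (E → ℝ) → ℝ≥0∞) := by
  refine Measurable.ite ?_ measurable_const measurable_const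
  rw [Set.ofPred_forall]
  exact MeasurableSet.iInter fun e => measurableSet_lt measurable_const (measurable_pi_apply e)

/-- The volume of the set of positive weights with fibre sums `Lp` and `Lm`. -/
noncomputable def levelVol (fp : E → P) (fm : E → M) (Lp : P → ℝ) (Lm : M → ℝ) : ℝ≥0∞ :=
  levelInt fp fm Lp Lm posInd

theorem posInd_comp_equiv (e : E' ≃ E) (m : E → ℝ) : posInd (fun x => m (e x)) = posInd m := by
  rw [posInd, posInd]
  congr 1
  exact propext ⟨fun h x => by simpa using h (e.symm x), fun h x => h _⟩

theorem levelVol_comp_equiv (e : E' ≃ E) (fp : E → P) (fm : E → M) (Lp : P → ℝ) (Lm : M → ℝ) :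
    levelVol (fun x => fp (e x)) (fun x => fm (e x)) Lp Lm = levelVol fp fm Lp Lm := by
  rw [levelVol, levelInt_comp_equiv e fp fm Lp Lm measurable_posInd]
  simp only [posInd_comp_equiv]
  rfl

theorem levelVol_eq_zero {fp : E → P} {fm : E → M} {Lp : P → ℝ} {Lm : M → ℝ}
    (h : ∀ m, IsLevel fp fm Lp Lm m → ¬∀ e, 0 < m e) : levelVol fp fm Lp Lm = 0 := by
  rw [levelVol, levelInt_congr (G := fun _ => 0)]
  · rw [levelInt]
    split_ifs <;> simp [latInt]
  · intro m hm
    rw [posInd, if_neg (h m hm)]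

theorem fibreSum_pos {Q : Type} {f : E → Q} {m : E → ℝ} (hm : ∀ e, 0 < m e) (e : E) :
    m e ≤ fibreSum f m (f e) := by
  rw [fibreSum]
  have := Finset.single_le_sum (f := fun x => if f x = f e then m x else 0)
    (fun x _ => by split_ifs; exacts [(hm x).le, le_rfl]) (Finset.mem_univ e)
  simpa using this

theorem levelVol_eq_zero_of_nonpos_left {fp : E → P} {fm : E → M} {Lp : P → ℝ} {Lm : M → ℝ}
    (hp : Function.Surjective fp) {i : P} (hi : Lp i ≤ 0) : levelVol fp fm Lp Lm = 0 := by
  refine levelVol_eq_zero fun m hm hpos => ?_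
  obtain ⟨e, rfl⟩ := hp i
  have := fibreSum_pos (f := fp) hpos e
  rw [hm.1] at this
  linarith [hpos e]

theorem levelVol_eq_zero_of_nonpos_right {fp : E → P} {fm : E → M} {Lp : P → ℝ} {Lm : M → ℝ}
    (hp : Function.Surjective fm) {i : M} (hi : Lm i ≤ 0) : levelVol fp fm Lp Lm = 0 := by
  refine levelVol_eq_zero fun m hm hpos => ?_
  obtain ⟨e, rfl⟩ := hp i
  have := fibreSum_pos (f := fm) hpos e
  rw [hm.2] at this
  linarith [hpos e]

/-- Independence over `ℤ` persists over `ℝ`: the coordinates of a real relation in a basis of `ℝ`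
over `ℚ` are rational relations, and denominators can be cleared. -/
theorem linearIndependent_real {S κ : Type} [Fintype κ] {K : Submodule ℤ (S → ℤ)}
    (b : Module.Basis κ ℤ K) {t : κ → ℝ} (h : ∀ e, ∑ k, t k * ((b k : S → ℤ) e : ℝ) = 0) : t = 0 := by
  let H := Module.Basis.ofVectorSpace ℚ ℝ
  have key : ∀ k i, H.repr (t k) i = 0 := by
    intro k i
    obtain ⟨N, hN, z, hz⟩ := exists_int_multiple fun k => H.repr (t k) i
    have h1 : ∀ e, ∑ k, H.repr (t k) i * ((b k : S → ℤ) e : ℚ) = 0 := by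
      intro e
      have h2 := congrArg (fun x => H.repr x i) (h e)
      simp only [map_sum, Finsupp.finsetSum_apply, map_zero, Finsupp.coe_zero,
        Pi.zero_apply] at h2
      rw [← h2]
      refine Finset.sum_congr rfl fun k _ => ?_
      have : t k * ((b k : S → ℤ) e : ℝ) = ((b k : S → ℤ) e : ℚ) • t k := by
        rw [Rat.smul_def, mul_comm]; push_cast; rfl
      rw [this, map_smul, Finsupp.smul_apply, smul_eq_mul, mul_comm]
    have h3 : ∑ k, z k • b k = 0 := by
      ext e
      have h4 : ((∑ k, z k * (b k : S → ℤ) e : ℤ) : ℚ) = 0 := by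
        push_cast
        simp only [hz]
        rw [← mul_zero (N : ℚ), ← h1 e, Finset.mul_sum]
        exact Finset.sum_congr rfl fun k _ => by ring
      simpa using (by exact_mod_cast h4 : ∑ k, z k * (b k : S → ℤ) e = 0)
    have h5 : z k = 0 := Fintype.linearIndependent_iff.1 b.linearIndependent z h3 k
    have h6 := hz k
    rw [h5] at h6
    have : (N : ℚ) ≠ 0 := by positivity
    simpa [this] using h6.symm
  funext k
  have : H.repr (t k) = 0 := by ext i; simp [key k i]
  simpa using this

/-- A positive weight is bounded by the length of the boundary containing the edge. The
parametrisation is linear and injective in finite dimension, hence antilipschitz, so the parameters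
are bounded as well. -/
theorem levelVol_ne_top (fp : E → P) (fm : E → M) (Lp : P → ℝ) (Lm : M → ℝ) :
    levelVol fp fm Lp Lm ≠ ∞ := by
  by_cases h : ∃ m₀, IsLevel fp fm Lp Lm m₀
  swap
  · rw [levelVol, levelInt_eq_zero h]; simp
  obtain ⟨m₀, hm⟩ := h
  rw [levelVol, levelInt_eq hm measurable_posInd, latInt]
  set b := Module.Free.chooseBasis ℤ (kerLat fp fm)
  let A : (Module.Free.ChooseBasisIndex ℤ (kerLat fp fm) → ℝ) →ₗ[ℝ] (E → ℝ) :=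
    { toFun := fun t e => ∑ k, t k * ((b k : E → ℤ) e : ℝ)
      map_add' := fun s t => by funext e; simp [add_mul, Finset.sum_add_distrib]
      map_smul' := fun c t => by funext e; simp [Finset.mul_sum, mul_assoc] }
  have hA : LinearMap.ker A = ⊥ := by
    rw [LinearMap.ker_eq_bot']
    intro t ht
    exact linearIndependent_real b fun e => congrFun ht e
  obtain ⟨K, hK, hanti⟩ := A.exists_antilipschitzWith hA
  let S : Set (E → ℝ) := Set.pi Set.univ fun e => Set.Icc (-m₀ e) (Lp (fp e) - m₀ e)
  have hS : Bornology.IsBounded S := Bornology.IsBounded.pi fun e => Metric.isBounded_Icc _ _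
  have hpre : Bornology.IsBounded (A ⁻¹' S) := hanti.isBounded_preimage hS
  have hle : ∀ t, posInd (fun e => m₀ e + ∑ k, t k * ((b k : E → ℤ) e : ℝ)) ≤
      (closure (A ⁻¹' S)).indicator 1 t := by
    intro t
    rw [posInd]
    split_ifs with hp
    · rw [Set.indicator_of_mem]
      · exact le_rfl
      apply subset_closure
      intro e _
      have h1 := fibreSum_pos (f := fp) hp e
      rw [(hm.comb b t).1] at h1
      constructor
      · have := hp e; change _ ≤ ∑ k, t k * ((b k : E → ℤ) e : ℝ); linarith
      · change ∑ k, t k * ((b k : E → ℤ) e : ℝ) ≤ _; linarith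
    · exact zero_le
  refine ne_top_of_le_ne_top ?_ (lintegral_mono hle)
  rw [lintegral_indicator_one isClosed_closure.measurableSet]
  exact hpre.closure.measure_lt_top.ne

end LevelIntegral


/-! ### Maps as pairs of permutations; bivalent vertices; transpositions -/

section Combinatorics

open scoped Classical
open Equiv

variable {E E' P M Q Q' : Type}

/-- `f` labels the cycles of `π` by `Q`. -/
def IsLabel (π : Perm E) (f : E → Q) : Prop :=
  Function.Surjective f ∧ ∀ x y, f x = f y ↔ π.SameCycle x y

/-- The bipartite graph with vertices `P` and `M` and edges `E` is connected. -/
def IsLinked (fp : E → P) (fm : E → M) : Prop :=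
  Nonempty E ∧ ∀ x y, Relation.ReflTransGen (fun a b => fp a = fp b ∨ fm a = fm b) x y

/-- An equivalence relation that contains one step of `π` contains its cycles; this replaces
computations with powers in most arguments on boundaries. -/
theorem sameCycle_induct {π : Perm E} {r : E → E → Prop} (hr : Equivalence r)
    (h : ∀ x, r x (π x)) {x y : E} (hxy : π.SameCycle x y) : r x y := by
  obtain ⟨n, rfl⟩ := hxy
  have hnat : ∀ (n : ℕ) (x : E), r x ((π ^ n) x) := by
    intro n
    induction n with
    | zero => intro x; exact hr.refl x
    | succ n ih =>
      intro x
      rw [pow_succ', Perm.mul_apply]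
      exact hr.trans (ih x) (h _)
  cases n with
  | ofNat n => simpa using hnat n x
  | negSucc n =>
    have := hnat (n + 1) ((π ^ Int.negSucc n) x)
    simp only [zpow_negSucc, Perm.coe_inv, apply_symm_apply] at this
    rw [zpow_negSucc]
    exact hr.symm this

theorem sameCycle_equivalence (π : Perm E) : Equivalence π.SameCycle :=
  ⟨fun x => Perm.SameCycle.refl π x, fun h => h.symm, fun h h' => h.trans h'⟩

theorem sameCycle_apply (π : Perm E) (x : E) : π.SameCycle x (π x) := ⟨1, by simp⟩

theorem isLabel_inv {π : Perm E} {f : E → Q} : IsLabel π⁻¹ f ↔ IsLabel π f := by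
  simp [IsLabel, Perm.sameCycle_inv]

theorem IsLabel.apply {π : Perm E} {f : E → Q} (h : IsLabel π f) (x : E) : f (π x) = f x :=
  ((h.2 _ _).2 (sameCycle_apply π x)).symm

theorem IsLabel.eq_of_fixed {π : Perm E} {f : E → Q} (h : IsLabel π f) {x y : E} (hx : π x = x)
    (hxy : f x = f y) : y = x := by
  obtain ⟨n, hn⟩ := (h.2 _ _).1 hxy
  rw [← hn]
  exact Perm.zpow_apply_eq_self_of_apply_eq_self hx n

/-! ### Insertion of a point in a cycle -/

/-- The extension of a permutation by a fixed point. -/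
def extPerm (τ : Perm E) : Perm (Option E) := optionCongr τ

/-- The insertion of a point after `x` in a permutation. -/
noncomputable def insPerm (τ : Perm E) (x : E) : Perm (Option E) :=
  extPerm τ * swap none (some x)

@[simp] theorem extPerm_none (τ : Perm E) : extPerm τ none = none := rfl

@[simp] theorem extPerm_some (τ : Perm E) (x : E) : extPerm τ (some x) = some (τ x) := rfl

theorem extPerm_inv (τ : Perm E) : (extPerm τ)⁻¹ = extPerm τ⁻¹ := by
  ext x; cases x <;> rfl

theorem extPerm_mul (τ σ : Perm E) : extPerm τ * extPerm σ = extPerm (τ * σ) := by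
  ext x; cases x <;> rfl

theorem insPerm_none (τ : Perm E) (x : E) : insPerm τ x none = some (τ x) := by simp [insPerm]

theorem insPerm_self (τ : Perm E) (x : E) : insPerm τ x (some x) = none := by simp [insPerm]

theorem insPerm_of_ne (τ : Perm E) {x y : E} (h : y ≠ x) :
    insPerm τ x (some y) = some (τ y) := by
  rw [insPerm, Perm.mul_apply, swap_apply_of_ne_of_ne (by simp) (by simpa using h)]
  simp

/-- The new point joins the cycle of `x`, so `getD x` is a retraction that identifies the old and
new cycles. -/
theorem insert_sameCycle (τ : Perm E) (x : E) (u v : Option E) :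
    (insPerm τ x).SameCycle u v ↔ τ.SameCycle (u.getD x) (v.getD x) := by
  set T := insPerm τ x with hT
  have hnone : T.SameCycle (some x) none := by
    have := sameCycle_apply T (some x)
    rwa [hT, insPerm_self] at this
  constructor
  · intro h
    refine sameCycle_induct (r := fun u v => τ.SameCycle (u.getD x) (v.getD x))
      ((sameCycle_equivalence τ).comap fun u : Option E => u.getD x) ?_ h
    intro u
    cases u with
    | none =>
      rw [hT, insPerm_none]
      exact sameCycle_apply τ x
    | some y =>
      by_cases hy : y = x
      · subst hy
        rw [hT, insPerm_self]
        exact Perm.SameCycle.refl _ _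
      · rw [hT, insPerm_of_ne τ hy]
        exact sameCycle_apply τ y
  · intro h
    have key : ∀ y z, τ.SameCycle y z → T.SameCycle (some y) (some z) := by
      intro y z hyz
      refine sameCycle_induct (r := fun y z => T.SameCycle (some y) (some z))
        ⟨fun u => Perm.SameCycle.refl _ _, fun h => h.symm, fun h h' => h.trans h'⟩ ?_ hyz
      intro y
      by_cases hy : y = x
      · subst hy
        refine hnone.trans ?_
        have := sameCycle_apply T none
        rwa [hT, insPerm_none] at this
      · have := sameCycle_apply T (some y)
        rwa [hT, insPerm_of_ne τ hy] at this
    have hd : ∀ u : Option E, T.SameCycle u (some (u.getD x)) := by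
      intro u
      cases u with
      | none => exact hnone.symm
      | some y => exact Perm.SameCycle.refl _ _
    exact (hd u).trans ((key _ _ h).trans (hd v).symm)

theorem isLabel_insert {τ : Perm E} {x : E} {F : Option E → Q} :
    IsLabel (insPerm τ x) F ↔
      F none = F (some x) ∧ IsLabel τ fun y => F (some y) := by
  constructor
  · intro h
    have h0 : F none = F (some x) := by
      rw [h.2, insert_sameCycle]
      exact Perm.SameCycle.refl _ _
    refine ⟨h0, fun q => ?_, fun y z => ?_⟩
    · obtain ⟨u, rfl⟩ := h.1 q
      cases u with
      | none => exact ⟨x, h0.symm⟩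
      | some y => exact ⟨y, rfl⟩
    · rw [h.2, insert_sameCycle]
      rfl
  · rintro ⟨h0, hs, h⟩
    have hd : ∀ u : Option E, F u = F (some (u.getD x)) := by
      intro u
      cases u with
      | none => exact h0
      | some y => rfl
    refine ⟨fun q => ?_, fun u v => ?_⟩
    · obtain ⟨y, rfl⟩ := hs q
      exact ⟨some y, rfl⟩
    · rw [hd u, hd v, insert_sameCycle, h]

/-- Inserting a point next to `x` in the negative boundary permutation, with `ι` fixing it, also
inserts it next to `x` in the positive one. This is the subdivision of the edge `x`. -/
theorem insert_inv_mul (τ ι : Perm E) (x : E) :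
    (insPerm τ x)⁻¹ * extPerm ι =
      (insPerm (τ⁻¹ * ι)⁻¹ x)⁻¹ := by
  rw [insPerm, insPerm, mul_inv_rev, mul_inv_rev, extPerm_inv, extPerm_inv, inv_inv, mul_assoc,
    extPerm_mul]

theorem isLabel_insert_left {τ ι : Perm E} {x : E} {F : Option E → Q} :
    IsLabel ((insPerm τ x)⁻¹ * extPerm ι) F ↔
      F none = F (some x) ∧ IsLabel (τ⁻¹ * ι) fun y => F (some y) := by
  rw [insert_inv_mul, isLabel_inv, isLabel_insert, isLabel_inv]

/-- The extension of a labelling to a point inserted next to `x`. -/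
def insLabel (f : E → Q) (x : E) (u : Option E) : Q := f (u.getD x)

theorem isLinked_insLabel {fp : E → P} {fm : E → M} {x : E} :
    IsLinked (insLabel fp x) (insLabel fm x) ↔ IsLinked fp fm := by
  constructor
  · rintro ⟨-, h⟩
    refine ⟨⟨x⟩, fun y z => ?_⟩
    exact Relation.ReflTransGen.lift (fun u : Option E => u.getD x) (fun a b hab => hab)
      (some y) (some z) (h (some y) (some z))
  · rintro ⟨-, h⟩
    refine ⟨⟨none⟩, fun u v => ?_⟩
    have hd : ∀ w : Option E, insLabel fp x w = insLabel fp x (some (w.getD x)) := fun w => rfl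
    refine Relation.ReflTransGen.trans (.single (Or.inl (hd u))) ?_
    refine Relation.ReflTransGen.trans ?_ (.single (Or.inl (hd v).symm))
    exact Relation.ReflTransGen.lift some (fun a b hab => hab) _ _ (h (u.getD x) (v.getD x))

/-- The pair of `τ` and `τ⁻¹ * ι`, with labelled cycles, is a connected map: `τ⁻¹ * ι` turns around
the positive boundaries, `τ` turns around the negative boundaries. -/
def IsMap (ι τ : Perm E) (fp : E → P) (fm : E → M) : Prop :=
  IsLabel (τ⁻¹ * ι) fp ∧ IsLabel τ fm ∧ IsLinked fp fm

/-- The connected maps on the edge set `E` whose vertices are the cycles of `ι`. -/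
structure CMap (ι : Perm E) (P M : Type) where
  τ : Perm E
  fp : E → P
  fm : E → M
  isMap : IsMap ι τ fp fm

theorem CMap.ext' {ι : Perm E} {s t : CMap ι P M} (h₁ : s.τ = t.τ) (h₂ : s.fp = t.fp)
    (h₃ : s.fm = t.fm) : s = t := by
  cases s; cases t; simp_all

noncomputable instance [Finite E] [Finite P] [Finite M] (ι : Perm E) : Fintype (CMap ι P M) :=
  have : Finite (CMap ι P M) := Finite.of_injective
    (fun s : CMap ι P M => (s.τ, s.fp, s.fm)) fun s t h => by
      simp only [Prod.mk.injEq] at h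
      exact CMap.ext' h.1 h.2.1 h.2.2
  Fintype.ofFinite _

/-- A point fixed by `ι` and `τ` is alone on both of its boundaries, so it is a whole connected
component. -/
theorem IsMap.fixed_isolated {ι τ : Perm E} {fp : E → P} {fm : E → M} (h : IsMap ι τ fp fm) {x : E}
    (hι : ι x = x) (hτ : τ x = x) (y : E) : y = x := by
  have hσ : (τ⁻¹ * ι) x = x := by
    rw [Perm.mul_apply, hι, Perm.inv_eq_iff_eq, hτ]
  have := h.2.2.2 x y
  induction this with
  | refl => rfl
  | tail _ hbc ih =>
    subst ih
    rcases hbc with hbc | hbc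
    · exact h.1.eq_of_fixed hσ hbc
    · exact h.2.1.eq_of_fixed hτ hbc

theorem isMap_insert {ι τ : Perm E} {fp : E → P} {fm : E → M} {x : E} :
    IsMap (extPerm ι) (insPerm τ x) (insLabel fp x) (insLabel fm x) ↔
      IsMap ι τ fp fm := by
  rw [IsMap, IsMap, isLabel_insert, isLabel_insert_left, isLinked_insLabel]
  simp [insLabel]

/-- The insertion of a bivalent vertex at the edge `x`. -/
noncomputable def CMap.insert {ι : Perm E} (s : CMap ι P M) (x : E) :
    CMap (extPerm ι) P M where
  τ := insPerm s.τ x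
  fp := insLabel s.fp x
  fm := insLabel s.fm x
  isMap := isMap_insert.2 s.isMap

theorem exists_eq_insert (T : Perm (Option E)) (hT : T none ≠ none) :
    ∃ (τ : Perm E) (x : E), T = insPerm τ x := by
  have h1 : T⁻¹ none ≠ none := fun h => hT (by rw [Perm.inv_eq_iff_eq] at h; exact h.symm)
  obtain ⟨x, hx⟩ := Option.ne_none_iff_exists'.1 h1
  refine ⟨removeNone (T * swap none (some x)), x, ?_⟩
  have h2 : (T * swap none (some x)) none = none := by
    rw [Perm.mul_apply, swap_apply_left, ← hx]; simp
  have h3 : extPerm (removeNone (T * swap none (some x))) = T * swap none (some x) := by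
    rw [extPerm, map_equiv_removeNone, h2, swap_self]
    rfl
  rw [insPerm, h3, mul_assoc, swap_mul_self, mul_one]

/-- Every bivalent vertex can be erased by merging its two edges, in a unique way. The only
exception is the circle consisting of one edge, which is excluded when `E` is nonempty. -/
theorem CMap.insert_bijective [Nonempty E] (ι : Perm E) :
    Function.Bijective fun p : CMap ι P M × E => p.1.insert p.2 := by
  constructor
  · rintro ⟨s, x⟩ ⟨t, y⟩ h
    have h1 : insPerm s.τ x = insPerm t.τ y :=
      congrArg CMap.τ h
    have h2 : insLabel s.fp x = insLabel t.fp y := congrArg CMap.fp h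
    have h3 : insLabel s.fm x = insLabel t.fm y := congrArg CMap.fm h
    have hxy : x = y := by
      by_contra hne
      have := insPerm_self s.τ x
      rw [h1, insPerm_of_ne _ hne] at this
      exact absurd this (by simp)
    subst hxy
    have h4 : s.τ = t.τ := optionCongr_injective (mul_right_cancel h1)
    have h5 : s = t := CMap.ext' h4 (funext fun e => congrFun h2 (some e))
      (funext fun e => congrFun h3 (some e))
    rw [h5]
  · intro t
    -- `none` is fixed by `extPerm ι`; if `τ` fixed it too, it would be the only edge.
    have hT : t.τ none ≠ none := by
      intro h
      obtain ⟨e⟩ := ‹Nonempty E›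
      have := t.isMap.fixed_isolated (x := none) (by simp) h (some e)
      exact absurd this (by simp)
    obtain ⟨τ, x, hτ⟩ := exists_eq_insert t.τ hT
    have h := t.isMap
    have hp : t.fp = insLabel (fun e => t.fp (some e)) x := by
      have h1 := h.1
      rw [hτ, isLabel_insert_left] at h1
      funext u
      cases u with
      | none => exact h1.1
      | some y => rfl
    have hm : t.fm = insLabel (fun e => t.fm (some e)) x := by
      have h1 := h.2.1
      rw [hτ, isLabel_insert] at h1
      funext u
      cases u with
      | none => exact h1.1
      | some y => rfl
    rw [hτ, hp, hm, isMap_insert] at h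
    exact ⟨(⟨τ, _, _, h⟩, x), CMap.ext' hτ.symm hp.symm hm.symm⟩

/-! ### Multiplication by a transposition -/

/-- After the transposition, `a` is sent to `π b`, and the orbit then follows that of `b` under `π`
as long as it avoids `a` and `b`. -/
theorem arc_pow [DecidableEq E] {π : Perm E} {a b : E} {n : ℕ}
    (h : ∀ s, 0 < s → s < n → (π ^ s) b ≠ a ∧ (π ^ s) b ≠ b) {s : ℕ} (hs : 0 < s) (hsn : s ≤ n) :
    ((π * swap a b) ^ s) a = (π ^ s) b := by
  induction s, hs using Nat.le_induction with
  | base => simp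
  | succ s hs ih =>
    rw [pow_succ', Perm.mul_apply, ih (by omega), Perm.mul_apply,
      swap_apply_of_ne_of_ne (h s hs (by omega)).1 (h s hs (by omega)).2, pow_succ',
      Perm.mul_apply]

theorem sameCycle_iff_of_pow {g : Perm E} {a : E} {n : ℕ} (hn : 0 < n) (h : (g ^ n) a = a) (y : E) :
    g.SameCycle a y ↔ ∃ s, 0 < s ∧ s ≤ n ∧ (g ^ s) a = y := by
  constructor
  · intro hy
    refine (sameCycle_induct (r := fun x y => (∃ s, 0 < s ∧ s ≤ n ∧ (g ^ s) a = x) ↔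
      ∃ s, 0 < s ∧ s ≤ n ∧ (g ^ s) a = y) ⟨fun _ => Iff.rfl, fun h => h.symm,
        fun h h' => h.trans h'⟩ ?_ hy).1 ⟨n, hn, le_rfl, h⟩
    intro x
    constructor
    · rintro ⟨s, hs, hsn, rfl⟩
      rcases hsn.lt_or_eq with hlt | rfl
      · exact ⟨s + 1, by omega, hlt, by rw [pow_succ', Perm.mul_apply]⟩
      · exact ⟨1, one_pos, hn, by rw [h, pow_one]⟩
    · rintro ⟨s, hs, hsn, hx⟩
      obtain ⟨s, rfl⟩ : ∃ r, s = r + 1 := ⟨s - 1, by omega⟩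
      rw [pow_succ', Perm.mul_apply] at hx
      have hx := g.injective hx
      rcases Nat.eq_zero_or_pos s with rfl | hs'
      · refine ⟨n, hn, le_rfl, ?_⟩
        rw [h, ← hx, pow_zero, Perm.one_apply]
      · exact ⟨s, hs', by omega, hx⟩
  · rintro ⟨s, -, -, rfl⟩
    exact ⟨s, by simp⟩

theorem arc_sameCycle [DecidableEq E] {π : Perm E} {a b : E} {n : ℕ} (hn : 0 < n) (hna : (π ^ n) b = a)
    (h : ∀ s, 0 < s → s < n → (π ^ s) b ≠ a ∧ (π ^ s) b ≠ b) (y : E) :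
    (π * swap a b).SameCycle a y ↔ ∃ s, 0 < s ∧ s ≤ n ∧ (π ^ s) b = y := by
  rw [sameCycle_iff_of_pow hn ((arc_pow h hn le_rfl).trans hna)]
  refine exists_congr fun s => and_congr_right fun hs => and_congr_right fun hsn => ?_
  rw [arc_pow h hs hsn]

/-- A transposition of points of different cycles joins them: the orbit of `a` follows the cycle of
`b` completely and arrives at `b`. -/
theorem sameCycle_of_not_mul_swap [DecidableEq E] [Finite E] {π : Perm E} {a b : E}
    (h : ¬π.SameCycle a b) : (π * swap a b).SameCycle a b := by
  have hex : ∃ n, 0 < n ∧ (π ^ n) b = b :=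
    ⟨orderOf π, orderOf_pos π, by rw [pow_orderOf_eq_one, Perm.one_apply]⟩
  have hn := Nat.find_spec hex
  have hmin := fun m (hm : m < Nat.find hex) => Nat.find_min hex hm
  set n := Nat.find hex
  have := arc_pow (a := a) (fun s hs hsn => ⟨fun h' => h (Perm.SameCycle.symm ⟨s, by simpa using h'⟩),
    fun h' => hmin s hsn ⟨hs, h'⟩⟩) hn.1 le_rfl
  rw [hn.2] at this
  exact ⟨n, by simpa using this⟩

theorem exists_min_arc [Finite E] {π : Perm E} {a b : E} (h : π.SameCycle a b) :
    ∃ n, 0 < n ∧ (π ^ n) b = a ∧ ∀ s, 0 < s → s < n → (π ^ s) b ≠ a ∧ (π ^ s) b ≠ b := by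
  have hex : ∃ n, 0 < n ∧ (π ^ n) b = a := by
    obtain ⟨n, hn, -, h⟩ := h.symm.exists_pow_eq'' 
    exact ⟨n, hn, h⟩
  have hn := Nat.find_spec hex
  have hmin := fun m (hm : m < Nat.find hex) => Nat.find_min hex hm
  set n := Nat.find hex
  refine ⟨n, hn.1, hn.2, fun s hs hsn => ⟨fun h' => hmin s hsn ⟨hs, h'⟩, fun h' => ?_⟩⟩
  refine hmin (n - s) (by omega) ⟨by omega, ?_⟩
  have := hn.2
  rw [show n = (n - s) + s by omega, pow_add, Perm.mul_apply, h'] at this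
  exact this

/-- A transposition of two points of one cycle cuts it: the new cycle of `a` is the arc of the old
one that starts after `b` and ends at `a`. -/
theorem not_sameCycle_mul_swap [DecidableEq E] [Finite E] {π : Perm E} {a b : E} (hab : a ≠ b)
    (h : π.SameCycle a b) : ¬(π * swap a b).SameCycle a b := by
  obtain ⟨n, hn, hna, hmin⟩ := exists_min_arc h
  rw [arc_sameCycle hn hna hmin]
  rintro ⟨s, hs, hsn, h'⟩
  rcases hsn.lt_or_eq with hlt | rfl
  · exact (hmin s hs hlt).2 h'
  · exact hab (hna.symm.trans h')

/-- `q` identifies `c₁` and `c₂`, and nothing else. -/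
def Glues (q : Q' → Q) (c₁ c₂ : Q') : Prop :=
  Function.Surjective q ∧ c₁ ≠ c₂ ∧
    ∀ u v, q u = q v ↔ u = v ∨ ((u = c₁ ∨ u = c₂) ∧ (v = c₁ ∨ v = c₂))

theorem Glues.eq {q : Q' → Q} {c₁ c₂ : Q'} (h : Glues q c₁ c₂) : q c₁ = q c₂ :=
  (h.2.2 _ _).2 (Or.inr ⟨Or.inl rfl, Or.inr rfl⟩)

theorem Glues.eq_iff {q : Q' → Q} {c₁ c₂ : Q'} (h : Glues q c₁ c₂) (u : Q') :
    q u = q c₁ ↔ u = c₁ ∨ u = c₂ := by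
  rw [h.2.2]
  constructor
  · rintro (h | h)
    exacts [Or.inl h, h.1]
  · exact fun h => Or.inr ⟨h, Or.inl rfl⟩

/-- If `a` and `b` carry different labels before the transposition is undone, undoing it joins
exactly their two cycles, as `q` joins their labels. -/
theorem IsLabel.glue [DecidableEq E] [Finite E] {π : Perm E} {a b : E} {f : E → Q'} {q : Q' → Q} {c₁ c₂ : Q'}
    (hq : Glues q c₁ c₂) (h : IsLabel (π * swap a b) f) (ha : f a = c₁) (hb : f b = c₂) :
    IsLabel π fun x => q (f x) := by
  have hab : a ≠ b := by
    rintro rfl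
    exact hq.2.1 (ha.symm.trans hb)
  have hswap : ∀ x, q (f (swap a b x)) = q (f x) := by
    intro x
    rcases eq_or_ne x a with rfl | hxa
    · rw [swap_apply_left, ha, hb, hq.eq]
    rcases eq_or_ne x b with rfl | hxb
    · rw [swap_apply_right, ha, hb, hq.eq]
    rw [swap_apply_of_ne_of_ne hxa hxb]
  have hcyc : π.SameCycle a b := by
    have h1 : ¬(π * swap a b).SameCycle a b := by
      rw [← h.2, ha, hb]; exact hq.2.1
    have h2 := sameCycle_of_not_mul_swap h1
    rwa [mul_assoc, swap_mul_self, mul_one] at h2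
  refine ⟨hq.1.comp h.1, fun x y => ⟨fun hxy => ?_, fun hxy => ?_⟩⟩
  · have key : ∀ x y, f x = f y → π.SameCycle x y := by
      intro x y hxy
      refine sameCycle_induct (sameCycle_equivalence π) ?_ ((h.2 x y).1 hxy)
      intro x
      refine Perm.SameCycle.trans ?_ (sameCycle_apply π (swap a b x))
      rcases eq_or_ne x a with rfl | hxa
      · rwa [swap_apply_left]
      rcases eq_or_ne x b with rfl | hxb
      · rw [swap_apply_right]; exact hcyc.symm
      rw [swap_apply_of_ne_of_ne hxa hxb]
    rcases (hq.2.2 _ _).1 hxy with h1 | ⟨h1, h2⟩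
    · exact key _ _ h1
    · have h3 : ∀ z, (f z = c₁ ∨ f z = c₂) → π.SameCycle z a := by
        rintro z (hz | hz)
        · exact key _ _ (hz.trans ha.symm)
        · exact (key _ _ (hz.trans hb.symm)).trans hcyc.symm
      exact (h3 x h1).trans (h3 y h2).symm
  · refine sameCycle_induct (r := fun x y => q (f x) = q (f y))
      ⟨fun _ => rfl, fun h => h.symm, fun h h' => h.trans h'⟩ ?_ hxy
    intro x
    have := h.apply (swap a b x)
    rw [Perm.mul_apply, swap_apply_self] at this
    rw [this, hswap]

/-- The cycle containing `a` and `b` is cut in two; the piece of `a` receives `c₁` and that of `b`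
receives `c₂`, while the other cycles keep the label that `q` determines. -/
theorem IsLabel.exists_split [DecidableEq E] [Finite E] {π : Perm E} {a b : E} {f : E → Q} {q : Q' → Q}
    {c₁ c₂ : Q'} (hq : Glues q c₁ c₂) (hab : a ≠ b) (h : IsLabel π f) (ha : f a = q c₁)
    (hb : f b = q c₁) :
    ∃ f' : E → Q', IsLabel (π * swap a b) f' ∧ f' a = c₁ ∧ f' b = c₂ ∧ ∀ x, q (f' x) = f x := by
  set π' := π * swap a b with hπ'
  have hcyc : ¬π'.SameCycle a b :=
    not_sameCycle_mul_swap hab ((h.2 a b).1 (ha.trans hb.symm))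
  choose g hg using hq.1
  let f' : E → Q' := fun x => if f x = q c₁ then (if π'.SameCycle a x then c₁ else c₂) else g (f x)
  have hf'a : f' a = c₁ := by
    simp only [f', if_pos ha, if_pos (Perm.SameCycle.refl π' a)]
  have hf'b : f' b = c₂ := by
    simp only [f', if_pos hb, if_neg hcyc]
  have hqf : ∀ x, q (f' x) = f x := by
    intro x
    simp only [f']
    split_ifs with h1 h2
    · exact h1.symm
    · rw [← hq.eq, h1]
    · exact hg _
  have hswapc : ∀ x, f (swap a b x) = f x := by
    intro x
    rcases eq_or_ne x a with rfl | hxa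
    · rw [swap_apply_left, ha, hb]
    rcases eq_or_ne x b with rfl | hxb
    · rw [swap_apply_right, ha, hb]
    rw [swap_apply_of_ne_of_ne hxa hxb]
  have hfπ' : ∀ x y, π'.SameCycle x y → f x = f y := by
    intro x y hxy
    refine sameCycle_induct (r := fun x y => f x = f y)
      ⟨fun _ => rfl, fun h => h.symm, fun h h' => h.trans h'⟩ ?_ hxy
    intro x
    rw [hπ', Perm.mul_apply, h.apply, hswapc]
  have hstep : ∀ x, π'.SameCycle (swap a b x) (π x) := by
    intro x
    have := sameCycle_apply π' (swap a b x)
    rwa [hπ', Perm.mul_apply, swap_apply_self] at this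
  -- The old cycle is exhausted by the new cycles of `a` and `b`; this is checked along one step of
  -- `π`.
  have hor : ∀ x, f x = q c₁ → π'.SameCycle a x ∨ π'.SameCycle b x := by
    intro x hx
    have hax : π.SameCycle a x := (h.2 a x).1 (ha.trans hx.symm)
    refine (sameCycle_induct (r := fun x y => (π'.SameCycle a x ∨ π'.SameCycle b x) ↔
      (π'.SameCycle a y ∨ π'.SameCycle b y)) ⟨fun _ => Iff.rfl, fun h => h.symm,
        fun h h' => h.trans h'⟩ ?_ hax).1 (Or.inl (Perm.SameCycle.refl _ _))
    intro x
    have h1 := hstep x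
    rcases eq_or_ne x a with rfl | hxa
    · rw [swap_apply_left] at h1
      exact ⟨fun _ => Or.inr h1, fun _ => Or.inl (Perm.SameCycle.refl _ _)⟩
    rcases eq_or_ne x b with rfl | hxb
    · rw [swap_apply_right] at h1
      exact ⟨fun _ => Or.inl h1, fun _ => Or.inr (Perm.SameCycle.refl _ _)⟩
    rw [swap_apply_of_ne_of_ne hxa hxb] at h1
    exact or_congr ⟨fun h => h.trans h1, fun h => h.trans h1.symm⟩
      ⟨fun h => h.trans h1, fun h => h.trans h1.symm⟩
  have hother : ∀ x y, f x ≠ q c₁ → f x = f y → π'.SameCycle x y := by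
    intro x y hx hxy
    refine (sameCycle_induct (r := fun x y => f x = f y ∧ (f x ≠ q c₁ → π'.SameCycle x y))
      ⟨fun _ => ⟨rfl, fun _ => Perm.SameCycle.refl _ _⟩,
        fun h => ⟨h.1.symm, fun h' => (h.2 (h.1 ▸ h')).symm⟩,
        fun h h' => ⟨h.1.trans h'.1, fun h'' => (h.2 h'').trans (h'.2 (h.1 ▸ h''))⟩⟩ ?_
        ((h.2 x y).1 hxy)).2 hx
    intro x
    refine ⟨(h.apply x).symm, fun hx => ?_⟩
    have h1 := hstep x
    rwa [swap_apply_of_ne_of_ne (by rintro rfl; exact hx ha)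
      (by rintro rfl; exact hx hb)] at h1
  refine ⟨f', ⟨fun c => ?_, fun x y => ?_⟩, hf'a, hf'b, hqf⟩
  · obtain ⟨x, hx⟩ := h.1 (q c)
    rcases (hq.2.2 c (f' x)).1 (by rw [hqf, hx]) with h1 | ⟨h1 | h1, -⟩
    · exact ⟨x, h1.symm⟩
    · exact ⟨a, hf'a.trans h1.symm⟩
    · exact ⟨b, hf'b.trans h1.symm⟩
  · constructor
    · intro hxy
      have hfxy : f x = f y := by rw [← hqf x, hxy, hqf]
      by_cases hx : f x = q c₁
      · have hy : f y = q c₁ := hfxy.symm.trans hx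
        simp only [f', if_pos hx, if_pos hy] at hxy
        by_cases hax : π'.SameCycle a x
        · rw [if_pos hax] at hxy
          by_cases hay : π'.SameCycle a y
          · exact hax.symm.trans hay
          · rw [if_neg hay] at hxy
            exact absurd hxy hq.2.1
        · rw [if_neg hax] at hxy
          have hay : ¬π'.SameCycle a y := by
            intro hay
            rw [if_pos hay] at hxy
            exact hq.2.1 hxy.symm
          exact (((hor x hx).resolve_left hax).symm).trans ((hor y hy).resolve_left hay)
      · exact hother x y hx hfxy
    · intro hxy
      have hfxy := hfπ' x y hxy
      have : π'.SameCycle a x ↔ π'.SameCycle a y :=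
        ⟨fun h => h.trans hxy, fun h => h.trans hxy.symm⟩
      simp only [f', hfxy, this]

/-- Only the labels `c₁` and `c₂` are ambiguous for `q`, and they are fixed by their values at `a`
and `b`. This makes cutting and joining mutually inverse. -/
theorem IsLabel.split_unique {π : Perm E} {a b : E} {q : Q' → Q}
    {c₁ c₂ : Q'} (hq : Glues q c₁ c₂) {f f' : E → Q'} (h : IsLabel π f) (h' : IsLabel π f')
    (ha : f a = c₁) (ha' : f' a = c₁) (hb : f b = c₂) (hb' : f' b = c₂)
    (hff' : ∀ x, q (f x) = q (f' x)) : f = f' := by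
  funext x
  rcases (hq.2.2 _ _).1 (hff' x) with h1 | ⟨h1 | h1, -⟩
  · exact h1
  · rw [h1]
    have := (h'.2 x a).2 ((h.2 x a).1 (h1.trans ha.symm))
    rw [this, ha']
  · rw [h1]
    have := (h'.2 x b).2 ((h.2 x b).1 (h1.trans hb.symm))
    rw [this, hb']

end Combinatorics


/-! ### Volume of a graph with a marked point -/

section InsertionVolume

open scoped Classical
open Equiv

variable {E P M Q Q' : Type} [Fintype E]

theorem latInt_swap (K : Submodule ℤ (E → ℤ)) (m₀ : E → ℝ) {G : ℝ → (E → ℝ) → ℝ≥0∞}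
    (hG : Measurable fun p : ℝ × (E → ℝ) => G p.1 p.2) :
    ∫⁻ s, latInt K m₀ (G s) = latInt K m₀ fun m => ∫⁻ s, G s m := by
  refine lintegral_lintegral_swap (f := fun s (t : Module.Free.ChooseBasisIndex ℤ K → ℝ) => G s (fun e => m₀ e + ∑ k, t k *
    ((Module.Free.chooseBasis ℤ K k : E → ℤ) e : ℝ))) (Measurable.aemeasurable ?_)
  exact hG.comp (measurable_fst.prodMk (by fun_prop))

theorem latInt_shift (K : Submodule ℤ (E → ℤ)) (m₀ w : E → ℝ) (F : (E → ℝ) → ℝ≥0∞) :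
    latInt K (fun e => m₀ e + w e) F = latInt K m₀ fun m => F fun e => m e + w e := by
  refine lintegral_congr fun t => ?_
  congr 1
  funext e
  ring

theorem levelInt_mono {fp : E → P} {fm : E → M} {Lp : P → ℝ} {Lm : M → ℝ}
    {F G : (E → ℝ) → ℝ≥0∞} (h : ∀ m, IsLevel fp fm Lp Lm m → F m ≤ G m) :
    levelInt fp fm Lp Lm F ≤ levelInt fp fm Lp Lm G := by
  rw [levelInt, levelInt]
  split_ifs with h'
  · exact lintegral_mono fun t => h _ (h'.choose_spec.comb _ _)
  · exact le_rfl

theorem levelInt_finset_sum {κ : Type} (s : Finset κ) (fp : E → P) (fm : E → M) (Lp : P → ℝ)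
    (Lm : M → ℝ) {F : κ → (E → ℝ) → ℝ≥0∞} (hF : ∀ k, Measurable (F k)) :
    levelInt fp fm Lp Lm (fun m => ∑ k ∈ s, F k m) = ∑ k ∈ s, levelInt fp fm Lp Lm (F k) := by
  simp only [levelInt]
  split_ifs with h'
  · refine lintegral_finsetSum _ fun k _ => (hF k).comp (by fun_prop)
  · simp

theorem levelInt_add (fp : E → P) (fm : E → M) (Lp : P → ℝ)
    (Lm : M → ℝ) {F G : (E → ℝ) → ℝ≥0∞} (hF : Measurable F) :
    levelInt fp fm Lp Lm (fun m => F m + G m) =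
      levelInt fp fm Lp Lm F + levelInt fp fm Lp Lm G := by
  simp only [levelInt]
  split_ifs with h'
  · exact lintegral_add_left (hF.comp (by fun_prop)) _
  · simp

theorem levelInt_const_mul (fp : E → P) (fm : E → M) (Lp : P → ℝ)
    (Lm : M → ℝ) {F : (E → ℝ) → ℝ≥0∞} (hF : Measurable F) (c : ℝ≥0∞) :
    levelInt fp fm Lp Lm (fun m => c * F m) = c * levelInt fp fm Lp Lm F := by
  simp only [levelInt]
  split_ifs with h'
  · exact lintegral_const_mul c (hF.comp (by fun_prop))
  · simp

/-- The weight obtained by cutting a piece of length `s` from the edge `x`. -/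
noncomputable def cutAt {A : Type} [AddCommGroup A] (x : E) (m : E → A) (s : A) (u : Option E) : A :=
  u.elim s fun e => m e - if e = x then s else 0

/-- The weight obtained by merging the added edge with the edge `x`. -/
noncomputable def mergeAt {A : Type} [AddCommGroup A] (x : E) (m : Option E → A) (e : E) : A :=
  m (some e) + if e = x then m none else 0

theorem cutAt_mergeAt {S A : Type} [AddCommGroup A] (x : S) (m : Option S → A) :
    cutAt x (mergeAt x m) (m none) = m := by
  funext u
  cases u <;> simp [cutAt, mergeAt]

theorem mergeAt_cutAt {S A : Type} [AddCommGroup A] (x : S) (m : S → A) (s : A) :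
    mergeAt x (cutAt x m s) = m := by
  funext e
  simp [cutAt, mergeAt]

theorem fibreSum_insLabel {A : Type} [AddCommGroup A] (f : E → Q) (x : E) (m : Option E → A)
    (q : Q) : fibreSum (insLabel f x) m q = fibreSum f (mergeAt x m) q := by
  rw [fibreSum, fibreSum, Fintype.sum_option]
  have : ∀ e, (if f e = q then mergeAt x m e else 0) = (if f e = q then m (some e) else 0) +
      if e = x then (if f x = q then m none else 0) else 0 := by
    intro e
    rw [mergeAt]
    by_cases hx : e = x
    · subst hx; by_cases h : f e = q <;> simp [h]
    · simp [hx]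
  simp only [this, Finset.sum_add_distrib, Finset.sum_ite_eq', Finset.mem_univ, if_true]
  rw [add_comm]
  rfl

theorem isLevel_insLabel {A : Type} [AddCommGroup A] {fp : E → P} {fm : E → M} {Lp : P → A}
    {Lm : M → A} {x : E} {m : Option E → A} :
    IsLevel (insLabel fp x) (insLabel fm x) Lp Lm m ↔ IsLevel fp fm Lp Lm (mergeAt x m) := by
  simp only [IsLevel, fibreSum_insLabel]

/-- A lattice in `ℤ ^ (Option E)` that is the graph of an integral form on a lattice in `ℤ ^ E`. -/
theorem latInt_graph {K : Submodule ℤ (E → ℤ)} {K' : Submodule ℤ (Option E → ℤ)} (x : E)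
    (a : E → ℤ)
    (hK : ∀ z, z ∈ K' ↔ mergeAt x z ∈ K ∧ z none = -∑ e, a e * mergeAt x z e)
    (m₀ : E → ℝ) (c : ℝ) {F : (Option E → ℝ) → ℝ≥0∞} (hF : Measurable F) :
    latInt K' (cutAt x m₀ (c - ∑ e, a e * m₀ e)) F =
      latInt K m₀ fun m => F (cutAt x m (c - ∑ e, a e * m e)) := by
  let j : (E → ℤ) →ₗ[ℤ] (Option E → ℤ) :=
    { toFun := fun z => cutAt x z (-∑ e, a e * z e)
      map_add' := fun z w => by
        funext u
        cases u with
        | none => simp [cutAt, mul_add, Finset.sum_add_distrib]; ring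
        | some e =>
          by_cases h : e = x
          · simp [cutAt, h, mul_add, Finset.sum_add_distrib]; ring
          · simp [cutAt, h]
      map_smul' := fun c z => by
        have : ∑ e, a e * (c * z e) = c * ∑ e, a e * z e := by
          rw [Finset.mul_sum]; exact Finset.sum_congr rfl fun e _ => by ring
        funext u
        cases u with
        | none => simp [cutAt, this]
        | some e =>
          by_cases h : e = x
          · simp [cutAt, h, this]; ring
          · simp [cutAt, h] }
  let J : (E → ℝ) →ₗ[ℝ] (Option E → ℝ) :=
    { toFun := fun z => cutAt x z (-∑ e, a e * z e)
      map_add' := fun z w => by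
        funext u
        cases u with
        | none => simp [cutAt, mul_add, Finset.sum_add_distrib]; ring
        | some e =>
          by_cases h : e = x
          · simp [cutAt, h, mul_add, Finset.sum_add_distrib]; ring
          · simp [cutAt, h]
      map_smul' := fun c z => by
        have : ∑ e, a e * (c * z e) = c * ∑ e, a e * z e := by
          rw [Finset.mul_sum]; exact Finset.sum_congr rfl fun e _ => by ring
        funext u
        cases u with
        | none => simp [cutAt, this]
        | some e =>
          by_cases h : e = x
          · simp [cutAt, h, this]; ring
          · simp [cutAt, h] }
  have hKj : K' = K.map j := by
    ext z
    rw [Submodule.mem_map, hK]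
    constructor
    · rintro ⟨h1, h2⟩
      refine ⟨_, h1, ?_⟩
      change cutAt x (mergeAt x z) _ = z
      rw [← h2, cutAt_mergeAt]
    · rintro ⟨w, hw, rfl⟩
      change mergeAt x (cutAt x w _) ∈ K ∧ _ = -∑ e, a e * mergeAt x (cutAt x w _) e
      rw [mergeAt_cutAt]
      exact ⟨hw, rfl⟩
  have hj : Function.Injective j := by
    intro z w h
    have := congrArg (mergeAt x) h
    change mergeAt x (cutAt x z _) = mergeAt x (cutAt x w _) at this
    rwa [mergeAt_cutAt, mergeAt_cutAt] at this
  have hJ : ∀ z : E → ℤ, J (fun e => (z e : ℝ)) = fun u => (j z u : ℝ) := by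
    intro z
    funext u
    cases u with
    | none => simp [J, j, cutAt]
    | some e =>
      by_cases h : e = x <;> simp [J, j, cutAt, h]
  have hsplit : ∀ m : E → ℝ, cutAt x m (c - ∑ e, a e * m e) =
      fun u => J m u + c * (u.elim 1 fun e => if e = x then -1 else 0) := by
    intro m
    funext u
    cases u with
    | none => simp [J, cutAt]; ring
    | some e =>
      by_cases h : e = x
      · simp [J, cutAt, h]; ring
      · simp [J, cutAt, h]
  rw [hsplit, latInt_shift, hKj, latInt_map j hj J hJ m₀]
  · simp only [hsplit]
  · exact hF.comp (by fun_prop)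

theorem measurable_cutAt {S : Type} (x : S) : Measurable fun p : ℝ × (S → ℝ) => cutAt x p.2 p.1 := by
  rw [measurable_pi_iff]
  intro u
  cases u with
  | none => exact measurable_fst
  | some e =>
    by_cases h : e = x
    · simp only [cutAt, Option.elim, h, if_true]; fun_prop
    · simp only [cutAt, Option.elim, h, if_false]; fun_prop

/-- The length `s` of the new edge is a free unimodular coordinate: moving the marked point along
the edge changes no boundary length. Tonelli then integrates it first. -/
theorem levelInt_insLabel (fp : E → P) (fm : E → M) (x : E) (Lp : P → ℝ) (Lm : M → ℝ)
    {F : (Option E → ℝ) → ℝ≥0∞} (hF : Measurable F) :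
    levelInt (insLabel fp x) (insLabel fm x) Lp Lm F =
      levelInt fp fm Lp Lm fun m => ∫⁻ s, F (cutAt x m s) := by
  have hmeas : Measurable fun p : ℝ × (E → ℝ) => F (cutAt x p.2 p.1) :=
    hF.comp (measurable_cutAt x)
  by_cases h : ∃ m₀, IsLevel fp fm Lp Lm m₀
  swap
  · rw [levelInt_eq_zero h, levelInt_eq_zero]
    rintro ⟨m, hm⟩
    exact h ⟨_, isLevel_insLabel.1 hm⟩
  obtain ⟨m₀, hm⟩ := h
  have hm' : IsLevel (insLabel fp x) (insLabel fm x) Lp Lm (cutAt x m₀ 0) := by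
    rw [isLevel_insLabel, mergeAt_cutAt]; exact hm
  rw [levelInt_eq hm' hF, levelInt_eq hm (hmeas.lintegral_prod_left' (μ := volume))]
  let φ : (Option E → ℤ) →ₗ[ℤ] ℤ := LinearMap.proj none
  let u : Option E → ℤ := cutAt x (fun _ => 0) 1
  have hu : u ∈ kerLat (insLabel fp x) (insLabel fm x) := by
    rw [mem_kerLat, isLevel_insLabel, mergeAt_cutAt]
    exact (kerLat fp fm).zero_mem
  rw [(latInt_slice φ hu rfl _ hF).1, ← latInt_swap _ _ hmeas]
  refine lintegral_congr fun s => ?_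
  have h1 : (fun e => cutAt x m₀ 0 e + s * (u e : ℝ)) =
      cutAt x m₀ (s - ∑ e, ((0 : E → ℤ) e : ℝ) * m₀ e) := by
    funext v
    cases v with
    | none => simp [u, cutAt]
    | some e =>
      by_cases h : e = x
      · simp [u, cutAt, h]; ring
      · simp [u, cutAt, h]
  rw [h1, latInt_graph (K := kerLat fp fm) x 0 _ m₀ s hF]
  · simp
  · intro z
    rw [Submodule.mem_inf, LinearMap.mem_ker, mem_kerLat, isLevel_insLabel]
    simp [mem_kerLat, φ]

theorem posInd_cutAt (x : E) (m : E → ℝ) (s : ℝ) :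
    posInd (cutAt x m s) = posInd m * if 0 < s ∧ s < m x then 1 else 0 := by
  have key : (∀ u, 0 < cutAt x m s u) ↔ (∀ e, 0 < m e) ∧ 0 < s ∧ s < m x := by
    rw [Option.forall]
    constructor
    · rintro ⟨h1, h2⟩
      have h3 : s < m x := by simpa [cutAt] using h2 x
      refine ⟨fun e => ?_, h1, h3⟩
      by_cases he : e = x
      · subst he; exact lt_trans h1 h3
      · simpa [cutAt, he] using h2 e
    · rintro ⟨h1, h2, h3⟩
      refine ⟨h2, fun e => ?_⟩
      by_cases he : e = x
      · subst he; simp [cutAt, h3]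
      · simpa [cutAt, he] using h1 e
  by_cases h1 : ∀ e, 0 < m e <;> by_cases h2 : 0 < s ∧ s < m x <;>
    simp only [posInd, key, h1, h2, and_self, and_true, and_false, if_true,
      if_false, mul_zero, mul_one, implies_true]

theorem measurable_posInd_mul_ofReal (x : E) :
    Measurable fun m : E → ℝ => posInd m * ENNReal.ofReal (m x) :=
  measurable_posInd.mul (ENNReal.measurable_ofReal.comp (measurable_pi_apply x))

/-- The marked point runs over the interior of the edge `x`, an interval of length `m x`. -/
theorem levelVol_insLabel (fp : E → P) (fm : E → M) (x : E) (Lp : P → ℝ) (Lm : M → ℝ) :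
    levelVol (insLabel fp x) (insLabel fm x) Lp Lm =
      levelInt fp fm Lp Lm fun m => posInd m * ENNReal.ofReal (m x) := by
  rw [levelVol, levelInt_insLabel fp fm x Lp Lm measurable_posInd]
  refine levelInt_congr fun m _ => ?_
  simp only [posInd_cutAt]
  rw [lintegral_const_mul]
  · congr 1
    have : (fun s : ℝ => if 0 < s ∧ s < m x then (1 : ℝ≥0∞) else 0) =
        (Set.Ioo 0 (m x)).indicator 1 := by
      funext s
      simp [Set.indicator_apply]
    rw [this, lintegral_indicator_one measurableSet_Ioo, Real.volume_Ioo, sub_zero]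
  · exact Measurable.ite measurableSet_Ioo measurable_const measurable_const

/-- The insertion of a point on the boundary `c`. -/
theorem sum_levelVol_insLabel (fp : E → P) (fm : E → M) (c : P) (Lp : P → ℝ) (Lm : M → ℝ) :
    (∑ x, if fp x = c then levelVol (insLabel fp x) (insLabel fm x) Lp Lm else 0) =
      ENNReal.ofReal (Lp c) * levelVol fp fm Lp Lm := by
  have h1 : ∀ x, (if fp x = c then levelVol (insLabel fp x) (insLabel fm x) Lp Lm else 0) =
      levelInt fp fm Lp Lm fun m =>
        if fp x = c then posInd m * ENNReal.ofReal (m x) else 0 := by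
    intro x
    split_ifs
    · exact levelVol_insLabel _ _ _ _ _
    · simp [levelInt, latInt]
  simp only [h1]
  rw [← levelInt_finset_sum, levelVol, ← levelInt_const_mul _ _ _ _ measurable_posInd]
  · refine levelInt_congr fun m hm => ?_
    rw [posInd]
    split_ifs with hp
    · simp only [one_mul, mul_one]
      -- The lengths of the edges on the boundary `c` add up to `Lp c`.
      rw [← hm.1, fibreSum, ENNReal.ofReal_sum_of_nonneg]
      · refine Finset.sum_congr rfl fun e _ => ?_
        split_ifs <;> simp
      · intro e _
        split_ifs
        exacts [(hp e).le, le_rfl]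
    · simp
  · intro x
    split_ifs
    · exact measurable_posInd_mul_ofReal x
    · exact measurable_const

end InsertionVolume


/-! ### Two marked points at a prescribed distance on a boundary -/

section JoinVolume

open scoped Classical
open Equiv

variable {E P M Q Q' : Type} [Fintype E]

theorem fibreSum_glue_of_ne {A : Type} [AddCommMonoid A] {q : Q' → Q} {c₁ c₂ : Q'}
    (hq : Glues q c₁ c₂) (f : E → Q') (z : E → A) {u : Q'} (h₁ : u ≠ c₁) (h₂ : u ≠ c₂) :
    fibreSum (fun e => q (f e)) z (q u) = fibreSum f z u := by
  refine Finset.sum_congr rfl fun e _ => ?_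
  have : q (f e) = q u ↔ f e = u := by
    rw [hq.2.2]
    constructor
    · rintro (h | ⟨-, h | h⟩)
      exacts [h, absurd h h₁, absurd h h₂]
    · exact Or.inl
  simp only [this]

theorem fibreSum_glue {A : Type} [AddCommMonoid A] {q : Q' → Q} {c₁ c₂ : Q'}
    (hq : Glues q c₁ c₂) (f : E → Q') (z : E → A) :
    fibreSum (fun e => q (f e)) z (q c₁) = fibreSum f z c₁ + fibreSum f z c₂ := by
  rw [fibreSum, fibreSum, fibreSum, ← Finset.sum_add_distrib]
  refine Finset.sum_congr rfl fun e _ => ?_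
  simp only [hq.eq_iff]
  by_cases h₁ : f e = c₁
  · have h₂ : f e ≠ c₂ := fun h => hq.2.1 (h₁.symm.trans h)
    simp [h₁, hq.2.1]
  · by_cases h₂ : f e = c₂ <;> simp [h₁, h₂]
    simp [hq.2.1.symm]

/-- The equation of the joined boundary is the sum of those of the two pieces, so cutting it adds
just one equation. -/
theorem isLevel_glue {A : Type} [AddCommGroup A] {q : Q' → Q} {c₁ c₂ : Q'}
    (hq : Glues q c₁ c₂) {f : E → Q'} {fm : E → M} {L' : Q' → A} {L : Q → A} {Lm : M → A}
    (hL : ∀ u, u ≠ c₁ → u ≠ c₂ → L (q u) = L' u) (hLc : L (q c₁) = L' c₁ + L' c₂) {z : E → A} :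
    IsLevel f fm L' Lm z ↔
      IsLevel (fun e => q (f e)) fm L Lm z ∧ fibreSum f z c₁ = L' c₁ := by
  constructor
  · rintro ⟨h1, h2⟩
    refine ⟨⟨fun k => ?_, h2⟩, h1 c₁⟩
    obtain ⟨u, rfl⟩ := hq.1 k
    by_cases hu : u = c₁ ∨ u = c₂
    · rw [(hq.eq_iff u).2 hu, fibreSum_glue hq, h1, h1, hLc]
    · rw [not_or] at hu
      rw [fibreSum_glue_of_ne hq f z hu.1 hu.2, h1, hL u hu.1 hu.2]
  · rintro ⟨⟨h1, h2⟩, h3⟩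
    refine ⟨fun u => ?_, h2⟩
    by_cases hu₁ : u = c₁
    · rw [hu₁, h3]
    by_cases hu₂ : u = c₂
    · have := h1 (q c₁)
      rw [fibreSum_glue hq, hLc, h3] at this
      rw [hu₂]
      exact add_left_cancel this
    · rw [← fibreSum_glue_of_ne hq f z hu₁ hu₂, h1, hL u hu₁ hu₂]

theorem exists_period {S : Type} [Finite S] (π : Perm S) (b : S) :
    ∃ n, 0 < n ∧ (π ^ n) b = b ∧ ∀ s, 0 < s → s < n → (π ^ s) b ≠ b := by
  obtain ⟨n, hn, hnb, h⟩ := exists_min_arc (Perm.SameCycle.refl π b)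
  exact ⟨n, hn, hnb, fun s h0 h1 => (h s h0 h1).1⟩

theorem pow_injOn_of_period {S : Type} {π : Perm S} {b : S} {n : ℕ}
    (hmin : ∀ s, 0 < s → s < n → (π ^ s) b ≠ b) {s t : ℕ} (hs : s < n) (ht : t < n)
    (h : (π ^ (s + 1)) b = (π ^ (t + 1)) b) : s = t := by
  have key : ∀ s t, s < t → t < n → (π ^ (s + 1)) b ≠ (π ^ (t + 1)) b := by
    intro s t hst ht h
    refine hmin (t - s) (by omega) (by omega) ?_
    rw [show t + 1 = (s + 1) + (t - s) by omega, pow_add π (s + 1) (t - s), Perm.mul_apply] at h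
    exact ((π ^ (s + 1)).injective h).symm
  rcases lt_trichotomy s t with hst | hst | hst
  · exact absurd h (key s t hst ht)
  · exact hst
  · exact absurd h.symm (key t s hst hs)

theorem sum_cycle {A : Type} [AddCommMonoid A] {σ : Perm E} {f : E → Q} (hf : IsLabel σ f) {b : E}
    {n : ℕ} (hn : 0 < n) (hnb : (σ ^ n) b = b) (hmin : ∀ s, 0 < s → s < n → (σ ^ s) b ≠ b)
    (G : E → A) :
    (∑ e, if f e = f b then G e else 0) = ∑ r ∈ Finset.range n, G ((σ ^ (r + 1)) b) := by
  rw [← Finset.sum_filter]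
  symm
  refine Finset.sum_bij (fun r _ => (σ ^ (r + 1)) b) ?_ ?_ ?_ fun _ _ => rfl
  · intro r _
    rw [Finset.mem_filter]
    refine ⟨Finset.mem_univ _, ?_⟩
    rw [hf.2]
    exact Perm.SameCycle.symm ⟨(r + 1 : ℕ), by rw [zpow_natCast]⟩
  · intro s hs t ht h
    exact pow_injOn_of_period hmin (Finset.mem_range.1 hs) (Finset.mem_range.1 ht) h
  · intro e he
    have h := (hf.2 b e).1 (Finset.mem_filter.1 he).2.symm
    obtain ⟨s, hs, hsn, rfl⟩ := (sameCycle_iff_of_pow hn hnb e).1 h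
    exact ⟨s - 1, Finset.mem_range.2 (by omega), by rw [Nat.sub_add_cancel hs]⟩

/-- The sum of the weights of the `r` points that follow `b`. -/
noncomputable def arcSum {S A : Type} [AddCommMonoid A] (σ : Perm S) (b : S) (r : ℕ) (m : S → A) :
    A :=
  ∑ s ∈ Finset.range r, m ((σ ^ (s + 1)) b)

theorem arcSum_eq (σ : Perm E) (b : E) (r : ℕ) :
    ∃ a : E → ℤ, (∀ z : E → ℤ, arcSum σ b r z = ∑ e, a e * z e) ∧
      ∀ m : E → ℝ, arcSum σ b r m = ∑ e, a e * m e := by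
  refine ⟨fun e => ∑ s ∈ Finset.range r, if (σ ^ (s + 1)) b = e then 1 else 0,
    fun z => ?_, fun m => ?_⟩
  · simp only [Finset.sum_mul]
    rw [Finset.sum_comm]
    simp [arcSum]
  · simp only [Int.cast_sum, Int.cast_ite, Int.cast_one, Int.cast_zero, Finset.sum_mul]
    rw [Finset.sum_comm]
    simp [arcSum]

theorem insPerm_inv_pow {S : Type} {σ : Perm S} {b x : S} {r : ℕ} (hmin : ∀ s, 0 < s → s ≤ r → (σ ^ s) b ≠ x)
    {s : ℕ} (hs : s ≤ r) : (((insPerm σ⁻¹ x)⁻¹) ^ s) (some b) = some ((σ ^ s) b) := by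
  induction s with
  | zero => rfl
  | succ s ih =>
    rw [pow_succ', Perm.mul_apply, ih (by omega), Perm.inv_eq_iff_eq, insPerm_of_ne]
    · rw [pow_succ', Perm.mul_apply]; simp
    · exact hmin (s + 1) (by omega) hs

/-- In the positive boundary permutation the new point comes just before `x`. The transposition
closes up the arc going from `b` (excluded) to the new point, whose old points are the `r`
successors of `b`. -/
theorem label_arc {S : Type} {σ : Perm S} {b x : S} {r : ℕ} (hx : (σ ^ (r + 1)) b = x)
    (hmin : ∀ s, 0 < s → s ≤ r → (σ ^ s) b ≠ x ∧ (σ ^ s) b ≠ b) {f : Option S → P}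
    (hf : IsLabel ((insPerm σ⁻¹ x)⁻¹ * swap none (some b)) f) (e : S) :
    f (some e) = f none ↔ ∃ s < r, (σ ^ (s + 1)) b = e := by
  have hpow := fun s (hs : s ≤ r) => insPerm_inv_pow (fun s h h' => (hmin s h h').1) hs
  have hlast : (((insPerm σ⁻¹ x)⁻¹) ^ (r + 1)) (some b) = none := by
    rw [pow_succ', Perm.mul_apply, hpow r le_rfl, Perm.inv_eq_iff_eq, insPerm_none]
    rw [← hx, pow_succ', Perm.mul_apply]; simp
  rw [eq_comm, hf.2, arc_sameCycle (Nat.succ_pos r) hlast]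
  · constructor
    · rintro ⟨s, hs, hsr, h⟩
      rcases Nat.lt_or_ge r s with h' | h'
      · obtain rfl : s = r + 1 := by omega
        rw [hlast] at h
        exact absurd h (by simp)
      · rw [hpow s h'] at h
        exact ⟨s - 1, by omega, by rw [Nat.sub_add_cancel hs]; exact Option.some_injective _ h⟩
    · rintro ⟨s, hs, rfl⟩
      exact ⟨s + 1, by omega, by omega, hpow _ (by omega)⟩
  · intro s hs hsr
    rw [hpow s (by omega)]
    exact ⟨by simp, fun h => (hmin s hs (by omega)).2 (Option.some_injective _ h)⟩

/-- The arc ends with the piece of the edge `x` named `none` and avoids `x` itself, so merging the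
pieces does not alter the other weights on it. -/
theorem fibreSum_arc {A : Type} [AddCommGroup A] {σ : Perm E} {b x : E} {r : ℕ}
    (hx : (σ ^ (r + 1)) b = x)
    (hmin : ∀ s, 0 < s → s ≤ r → (σ ^ s) b ≠ x ∧ (σ ^ s) b ≠ b) {f : Option E → P}
    (hf : IsLabel ((insPerm σ⁻¹ x)⁻¹ * swap none (some b)) f) (z : Option E → A) :
    fibreSum f z (f none) = z none + arcSum σ b r (mergeAt x z) := by
  rw [fibreSum, Fintype.sum_option, if_pos rfl, ← Finset.sum_filter, arcSum]
  congr 1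
  symm
  refine Finset.sum_bij (fun s _ => (σ ^ (s + 1)) b) ?_ ?_ ?_ ?_
  · intro s hs
    rw [Finset.mem_filter, label_arc hx hmin hf]
    exact ⟨Finset.mem_univ _, s, Finset.mem_range.1 hs, rfl⟩
  · intro s hs t ht h
    rw [Finset.mem_range] at hs ht
    exact pow_injOn_of_period (n := r + 1) (fun s hs hs' => (hmin s hs (by omega)).2)
      (by omega) (by omega) h
  · intro e he
    rw [Finset.mem_filter, label_arc hx hmin hf] at he
    obtain ⟨-, s, hs, h⟩ := he
    exact ⟨s, Finset.mem_range.2 hs, h⟩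
  · intro s hs
    rw [Finset.mem_range] at hs
    rw [mergeAt, if_neg (hmin (s + 1) (by omega) (by omega)).1, add_zero]

theorem measurable_arc (σ : Perm E) (b : E) (r : ℕ) (y : ℝ) : Measurable fun m : E → ℝ =>
    posInd m * if arcSum σ b r m < y ∧ y < arcSum σ b (r + 1) m then (1 : ℝ≥0∞) else 0 := by
  have h : ∀ r, Measurable fun m : E → ℝ => arcSum σ b r m := fun r => by
    unfold arcSum; fun_prop
  refine measurable_posInd.mul (Measurable.ite ?_ measurable_const measurable_const)
  exact (measurableSet_lt (h r) measurable_const).inter (measurableSet_lt measurable_const (h _))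

/-- The volume of a graph obtained by joining the point `b` to a point of the edge `x`, at the
prescribed distance from `b` on the boundary. -/
theorem levelVol_join {σ : Perm E} {b x : E} {r : ℕ} (hx : (σ ^ (r + 1)) b = x)
    (hmin : ∀ s, 0 < s → s ≤ r → (σ ^ s) b ≠ x ∧ (σ ^ s) b ≠ b) {f : Option E → Q'}
    (hf : IsLabel ((insPerm σ⁻¹ x)⁻¹ * swap none (some b)) f) {q : Q' → Q} {i j : Q'}
    (hq : Glues q i j) (hfi : f none = i) {fp : E → Q}
    (hqf : ∀ u, q (f u) = insLabel fp x u) (fm : E → M) {L : Q' → ℝ} {L' : Q → ℝ} (Lm : M → ℝ)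
    (hL : ∀ u, u ≠ i → u ≠ j → L' (q u) = L u) (hLij : L' (q i) = L i + L j) :
    levelVol f (insLabel fm x) L Lm = levelInt fp fm L' Lm fun m =>
      posInd m * if arcSum σ b r m < L i ∧ L i < arcSum σ b (r + 1) m then 1 else 0 := by
  have hlev : ∀ {A : Type} [AddCommGroup A] {L : Q' → A} {L' : Q → A} {Lm : M → A}
      (_ : ∀ u, u ≠ i → u ≠ j → L' (q u) = L u) (_ : L' (q i) = L i + L j) {z : Option E → A},
      IsLevel f (insLabel fm x) L Lm z ↔ IsLevel fp fm L' Lm (mergeAt x z) ∧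
        z none = L i - arcSum σ b r (mergeAt x z) := by
    intro A _ L L' Lm hL hLij z
    rw [isLevel_glue hq hL hLij, ← hfi, fibreSum_arc hx hmin hf, eq_sub_iff_add_eq,
      funext hqf]
    exact and_congr_left fun _ => isLevel_insLabel
  -- Prescribing `L i` makes the new length an affine function of the merged weights with integral
  -- linear part. The lattice is thus a graph over `kerLat fp fm` and the volume is unchanged.
  obtain ⟨a, haz, ham⟩ := arcSum_eq σ b r
  rw [levelVol]
  by_cases h : ∃ m₀, IsLevel fp fm L' Lm m₀
  swap
  · rw [levelInt_eq_zero h, levelInt_eq_zero]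
    rintro ⟨m, hm⟩
    exact h ⟨_, ((hlev hL hLij).1 hm).1⟩
  obtain ⟨m₀, hm⟩ := h
  -- The piece cut from `x` has the length that remains of `L i` after the first `r` edges.
  have hm' : IsLevel f (insLabel fm x) L Lm (cutAt x m₀ (L i - ∑ e, a e * m₀ e)) := by
    rw [hlev hL hLij, mergeAt_cutAt, ham]
    exact ⟨hm, rfl⟩
  rw [levelInt_eq hm' measurable_posInd, levelInt_eq hm (measurable_arc σ b r (L i)),
    latInt_graph (K := kerLat fp fm) x a _ m₀ (L i) measurable_posInd]
  · congr 1
    funext m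
    rw [posInd_cutAt, ← ham]
    congr 1
    have : arcSum σ b (r + 1) m = arcSum σ b r m + m x := by
      rw [arcSum, Finset.sum_range_succ, hx]; rfl
    rw [this]
    congr 1
    refine propext (and_congr ?_ ?_)
    · rw [sub_pos]
    · rw [sub_lt_iff_lt_add']
  · intro z
    rw [mem_kerLat, hlev (A := ℤ) (L' := 0) (by simp) (by simp), mem_kerLat, haz]
    simp

/-- The open intervals between successive values of an increasing sequence are disjoint; by the next
lemma they cover everything but these values. -/
theorem sum_interval_le_one {S : ℕ → ℝ} {n : ℕ} (hS : ∀ r < n, S r < S (r + 1)) (y : ℝ) :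
    (∑ r ∈ Finset.range n, if S r < y ∧ y < S (r + 1) then (1 : ℝ≥0∞) else 0) ≤ 1 := by
  have hmono : ∀ r s, r < s → s ≤ n → S r < S s := by
    intro r s hrs
    induction s, hrs using Nat.le_induction with
    | base => intro h; exact hS r (by omega)
    | succ s hs ih => intro h; exact (ih (by omega)).trans (hS s (by omega))
  rw [Finset.sum_boole]
  have : (Finset.filter (fun r => S r < y ∧ y < S (r + 1)) (Finset.range n)).card ≤ 1 := by
    rw [Finset.card_le_one]
    intro s hs t ht
    simp only [Finset.mem_filter, Finset.mem_range] at hs ht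
    have key : ∀ s t, s < n → t < n → y < S (s + 1) → S t < y → ¬s < t := by
      intro s t hs ht h1 h2 hst
      rcases (show s + 1 ≤ t from hst).eq_or_lt with h | h
      · rw [h] at h1; exact lt_asymm h1 h2
      · exact lt_asymm (hmono _ _ h ht.le) (h2.trans h1)
    rcases lt_trichotomy s t with h | h | h
    · exact absurd h (key s t hs.1 ht.1 hs.2.2 ht.2.1)
    · exact h
    · exact absurd h (key t s ht.1 hs.1 ht.2.2 hs.2.1)
  exact_mod_cast this

theorem one_le_sum_interval {S : ℕ → ℝ} {n : ℕ} {y : ℝ} (h0 : S 0 < y) (hn : y < S n)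
    (hne : ∀ r, 0 < r → r < n → S r ≠ y) :
    1 ≤ ∑ r ∈ Finset.range n, if S r < y ∧ y < S (r + 1) then (1 : ℝ≥0∞) else 0 := by
  have hex : ∃ r, y < S r := ⟨n, hn⟩
  have h1 := Nat.find_spec hex
  have hmin := fun m (hm : m < Nat.find hex) => Nat.find_min hex hm
  have hle : Nat.find hex ≤ n := Nat.find_min' hex hn
  set r := Nat.find hex
  have hr : 0 < r := by
    rcases Nat.eq_zero_or_pos r with h | h
    · rw [h] at h1; exact absurd h1 (lt_asymm h0)
    · exact h
  have h2 : S (r - 1) < y := by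
    refine lt_of_le_of_ne (not_lt.1 (hmin (r - 1) (by omega))) ?_
    rcases Nat.eq_zero_or_pos (r - 1) with h | h
    · rw [h]; exact h0.ne
    · exact hne _ h (by omega)
  refine le_trans ?_ (Finset.single_le_sum (fun _ _ => zero_le) (Finset.mem_range.2
    (show r - 1 < n by omega)))
  rw [Nat.sub_add_cancel hr, if_pos ⟨h2, h1⟩]

/-- Joining the point `b` to the point at distance `L i` on its boundary. -/
theorem sum_levelVol_join {σ : Perm E} {b : E} {q : Q' → Q} {i j : Q'} (hq : Glues q i j)
    {fp : E → Q} (hfp : IsLabel σ fp) (hb : fp b = q i) {fm : E → M} (hfm : fm (σ b) = fm b)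
    {f : E → Option E → Q'}
    (hf : ∀ x, fp x = q i → IsLabel ((insPerm σ⁻¹ x)⁻¹ * swap none (some b)) (f x) ∧
      f x none = i ∧ ∀ u, q (f x u) = insLabel fp x u)
    {L : Q' → ℝ} {L' : Q → ℝ} (Lm : M → ℝ)
    (hL : ∀ u, u ≠ i → u ≠ j → L' (q u) = L u) (hLij : L' (q i) = L i + L j)
    (hi : 0 < L i) (hj : 0 < L j) :
    (∑ x, if fp x = q i then levelVol (f x) (insLabel fm x) L Lm else 0) =
      levelVol fp fm L' Lm := by
  obtain ⟨n, hn, hnb, hmin⟩ := exists_period σ b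
  have hfpb : ∀ s : ℕ, fp ((σ ^ s) b) = q i := by
    intro s
    rw [← hb, hfp.2]
    exact Perm.SameCycle.symm ⟨s, by simp⟩
  rw [← hb, sum_cycle hfp hn hnb hmin]
  have h1 : ∀ r ∈ Finset.range n, levelVol (f ((σ ^ (r + 1)) b)) (insLabel fm ((σ ^ (r + 1)) b)) L Lm
      = levelInt fp fm L' Lm fun m => posInd m *
        if arcSum σ b r m < L i ∧ L i < arcSum σ b (r + 1) m then 1 else 0 := by
    intro r hr
    rw [Finset.mem_range] at hr
    obtain ⟨h1, h2, h3⟩ := hf _ (hfpb (r + 1))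
    refine levelVol_join rfl (fun s hs hsr => ⟨fun h => ?_, hmin s hs (by omega)⟩) h1 hq h2 h3 fm Lm
      hL hLij
    have := pow_injOn_of_period hmin (s := s - 1) (t := r) (by omega) hr
      (by rwa [Nat.sub_add_cancel hs])
    omega
  rw [Finset.sum_congr rfl h1, ← levelInt_finset_sum _ _ _ _ _ fun r => measurable_arc σ b r (L i)]
  have harc0 : ∀ m : E → ℝ, arcSum σ b 0 m = 0 := fun m => by simp [arcSum]
  have hsucc : ∀ (m : E → ℝ) r, arcSum σ b (r + 1) m = arcSum σ b r m + m ((σ ^ (r + 1)) b) :=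
    fun m r => Finset.sum_range_succ _ _
  have harcn : ∀ m, IsLevel fp fm L' Lm m → arcSum σ b n m = L i + L j := by
    intro m hm
    rw [arcSum, ← sum_cycle hfp hn hnb hmin, ← hLij, ← hm.1, ← hb]
    rfl
  -- The metrics for which the point at distance `L i` falls on the end of an edge are negligible.
  have hnull : ∀ r ∈ Finset.range n, levelInt fp fm L' Lm (fun m => posInd m *
      if 0 < r ∧ arcSum σ b r m = L i then 1 else 0) = 0 := by
    intro r hr
    rw [Finset.mem_range] at hr
    rcases Nat.eq_zero_or_pos r with rfl | hr0
    · simp [levelInt, latInt]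
    by_cases h : ∃ m₀, IsLevel fp fm L' Lm m₀
    swap
    · rw [levelInt_eq_zero h]
    obtain ⟨m₀, hm⟩ := h
    obtain ⟨a, haz, ham⟩ := arcSum_eq σ b r
    have hmeas : Measurable fun m : E → ℝ => posInd m *
        if 0 < r ∧ arcSum σ b r m = L i then (1 : ℝ≥0∞) else 0 := by
      refine measurable_posInd.mul (Measurable.ite ?_ measurable_const measurable_const)
      simp only [hr0, true_and]
      have : Measurable fun m : E → ℝ => arcSum σ b r m := by unfold arcSum; fun_prop
      exact this (measurableSet_singleton (L i))
    rw [levelInt_eq hm hmeas]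
    have hne : σ b ≠ b := by simpa using hmin 1 one_pos (by omega)
    -- By `hfm`, `b` and `σ b` lie on the same two boundaries, so moving a unit of length from one
    -- to the other preserves all lengths. The arc of `0 < r < n` points contains `σ b` but not `b`,
    -- so its length changes by 1.
    let u : E → ℤ := fun e => (Pi.single (σ b) (1 : ℤ) : E → ℤ) e - (Pi.single b (1 : ℤ) : E → ℤ) e
    have hu : u ∈ kerLat fp fm := by
      constructor
      · intro c
        rw [fibreSum_sub, fibreSum_single, fibreSum_single, hfp.apply]; simp
      · intro c
        rw [fibreSum_sub, fibreSum_single, fibreSum_single, hfm]; simp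
    refine latInt_level_eq_zero a hu ?_ m₀ (L i) hmeas ?_
    · rw [← haz, arcSum, Finset.sum_eq_single 0]
      · simp [u, hne]
      · intro s hs hs0
        rw [Finset.mem_range] at hs
        have h1 : (σ ^ (s + 1)) b ≠ b := hmin _ (by omega) (by omega)
        have h2 : (σ ^ (s + 1)) b ≠ σ b := fun h => hs0
          (pow_injOn_of_period hmin (s := s) (t := 0) (by omega) hn (by simpa using h))
        simp only [u, Pi.single_eq_of_ne h1, Pi.single_eq_of_ne h2, sub_zero]
      · simp [hr0.ne']
    · intro m h
      rw [← ham] at h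
      rw [if_neg (fun h' => h h'.2), mul_zero]
  -- On positive weights the sum of the indicators is at most 1, and at least 1 once the indicators
  -- of the exceptional metrics are added.
  apply le_antisymm
  · refine levelInt_mono fun m hm => ?_
    rw [← Finset.mul_sum, posInd]
    split_ifs with hp
    · rw [one_mul]
      exact sum_interval_le_one (S := fun r => arcSum σ b r m)
        (fun r _ => by simp only [hsucc]; linarith [hp ((σ ^ (r + 1)) b)]) _
    · simp
  · have hmeas : ∀ r, Measurable fun m : E → ℝ => posInd m *
        if 0 < r ∧ arcSum σ b r m = L i then (1 : ℝ≥0∞) else 0 := by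
      intro r
      refine measurable_posInd.mul (Measurable.ite ?_ measurable_const measurable_const)
      have : Measurable fun m : E → ℝ => arcSum σ b r m := by unfold arcSum; fun_prop
      exact (MeasurableSet.const _).inter (this (measurableSet_singleton (L i)))
    calc levelVol fp fm L' Lm
        ≤ levelInt fp fm L' Lm fun m => (∑ r ∈ Finset.range n, posInd m *
            if arcSum σ b r m < L i ∧ L i < arcSum σ b (r + 1) m then 1 else 0) +
          ∑ r ∈ Finset.range n, posInd m * if 0 < r ∧ arcSum σ b r m = L i then 1 else 0 := by
          refine levelInt_mono fun m hm => ?_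
          rw [← Finset.mul_sum, ← Finset.mul_sum, ← mul_add]
          refine le_mul_of_one_le_right' ?_
          by_cases h : ∃ r, 0 < r ∧ r < n ∧ arcSum σ b r m = L i
          · obtain ⟨r, h0, h1, h2⟩ := h
            refine le_add_left (le_trans ?_ (Finset.single_le_sum (fun _ _ => zero_le)
              (Finset.mem_range.2 h1)))
            rw [if_pos ⟨h0, h2⟩]
          · push Not at h
            refine le_add_right (one_le_sum_interval (S := fun r => arcSum σ b r m) ?_ ?_ h)
            · simp only [harc0]; exact hi
            · simp only [harcn m hm]; linarith
      _ = _ := by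
          rw [levelInt_add, levelInt_finset_sum _ _ _ _ _ hmeas, Finset.sum_eq_zero hnull, add_zero]
          exact Finset.measurable_sum _ fun r _ => measurable_arc σ b r (L i)

end JoinVolume


/-! ### Sums over maps, and the vertex between two distinct positive boundaries -/

section VolumeSums

open scoped Classical
open Equiv

variable {E E' P M P' M' Q Q' : Type}

/-! ### Transport of maps -/

theorem sameCycle_permCongr {π : Perm E} {π' : Perm E'} (e : E ≃ E') (h : ∀ x, π' (e x) = e (π x))
    (x y : E) : π'.SameCycle (e x) (e y) ↔ π.SameCycle x y := by
  have h' : ∀ x, π (e.symm x) = e.symm (π' x) := fun x => by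
    rw [← e.apply_symm_apply x, h]; simp
  constructor
  · intro hxy
    have := sameCycle_induct (r := fun x y => π.SameCycle (e.symm x) (e.symm y))
      ((sameCycle_equivalence π).comap e.symm)
      (fun x => by rw [← h']; exact sameCycle_apply π _) hxy
    simpa using this
  · intro hxy
    exact sameCycle_induct (r := fun x y => π'.SameCycle (e x) (e y))
      ((sameCycle_equivalence π').comap e)
      (fun x => by rw [← h]; exact sameCycle_apply π' _) hxy

theorem IsLabel.relabel {π : Perm E} {π' : Perm E'} (e : E ≃ E') (h : ∀ x, π' (e x) = e (π x))
    {f : E → Q} (hf : IsLabel π f) (p : Q ≃ Q') : IsLabel π' fun x => p (f (e.symm x)) := by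
  refine ⟨p.surjective.comp (hf.1.comp e.symm.surjective), fun x y => ?_⟩
  rw [p.injective.eq_iff, hf.2, ← sameCycle_permCongr e h]
  simp

theorem IsLinked.relabel {fp : E → P} {fm : E → M} (h : IsLinked fp fm) (e : E ≃ E') (p : P → P')
    (m : M → M') : IsLinked (fun x => p (fp (e.symm x))) (fun x => m (fm (e.symm x))) := by
  obtain ⟨⟨x⟩, h⟩ := h
  refine ⟨⟨e x⟩, fun u v => ?_⟩
  have := Relation.ReflTransGen.lift (r := fun a b => fp a = fp b ∨ fm a = fm b)
    (p := fun a b => p (fp (e.symm a)) = p (fp (e.symm b)) ∨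
      m (fm (e.symm a)) = m (fm (e.symm b))) e (fun a b hab => by
      rcases hab with hab | hab
      · exact Or.inl (by simp [hab])
      · exact Or.inr (by simp [hab])) (e.symm u) (e.symm v) (h _ _)
  simpa [Function.onFun] using this

/-- The transport of a map along bijections of the edges and of the labels. -/
def CMap.relabel {ι : Perm E} {ι' : Perm E'} (s : CMap ι P M) (e : E ≃ E')
    (h : ∀ x, ι' (e x) = e (ι x)) (p : P ≃ P') (m : M ≃ M') : CMap ι' P' M' where
  τ := (e.symm.trans s.τ).trans e
  fp := fun x => p (s.fp (e.symm x))
  fm := fun x => m (s.fm (e.symm x))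
  isMap := by
    refine ⟨s.isMap.1.relabel e (fun x => ?_) p, s.isMap.2.1.relabel e (fun x => by simp) m,
      s.isMap.2.2.relabel e p m⟩
    rw [Perm.mul_apply, h, Perm.inv_eq_iff_eq]
    simp

variable [Fintype E] [Fintype E'] [Finite P] [Finite M] [Finite P'] [Finite M']

/-- The sum over the maps of the volumes of the spaces of metrics. -/
noncomputable def volSum (ι : Perm E) (Lp : P → ℝ) (Lm : M → ℝ) : ℝ≥0∞ :=
  ∑ s : CMap ι P M, levelVol s.fp s.fm Lp Lm

/-- The sum over the maps with a bivalent vertex on the boundary `c` of the volumes of the spaces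
of metrics. -/
noncomputable def pointedVolSum (ι : Perm E) (c : P) (Lp : P → ℝ) (Lm : M → ℝ) : ℝ≥0∞ :=
  ∑ s : CMap (extPerm ι) P M, if s.fp none = c then levelVol s.fp s.fm Lp Lm else 0

theorem volSum_relabel {ι : Perm E} {ι' : Perm E'} (e : E ≃ E') (h : ∀ x, ι' (e x) = e (ι x))
    (p : P ≃ P') (m : M ≃ M') (Lp : P' → ℝ) (Lm : M' → ℝ) :
    volSum ι (fun i => Lp (p i)) (fun j => Lm (m j)) = volSum ι' Lp Lm := by
  have h' : ∀ x, ι (e.symm x) = e.symm (ι' x) := fun x => by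
    rw [← e.apply_symm_apply x, h]; simp
  refine Fintype.sum_bijective (fun s : CMap ι P M => s.relabel e h p m)
    (Function.bijective_iff_has_inverse.2 ⟨fun s => s.relabel e.symm h' p.symm m.symm,
      fun s => ?_, fun s => ?_⟩) _ _ fun s => ?_
  · refine CMap.ext' (Equiv.ext fun x => ?_) (funext fun x => ?_) (funext fun x => ?_) <;>
      simp [CMap.relabel]
  · refine CMap.ext' (Equiv.ext fun x => ?_) (funext fun x => ?_) (funext fun x => ?_) <;>
      simp [CMap.relabel]
  · have h1 := levelVol_comp_equiv e.symm (fun x => p (s.fp x)) (fun x => m (s.fm x)) Lp Lm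
    refine Eq.trans ?_ h1.symm
    have hf : ∀ {Q Q' A : Type} [AddCommMonoid A] (f : E → Q) (p : Q ≃ Q') (z : E → A) (k : Q),
        fibreSum (fun x => p (f x)) z (p k) = fibreSum f z k := by
      intro Q Q' A _ f p z k
      refine Finset.sum_congr rfl fun x _ => ?_
      simp only [p.injective.eq_iff]
    refine levelInt_congr_level (fun z => ?_) (fun z => ?_) measurable_posInd
    · simp only [IsLevel, p.forall_congr_left, m.forall_congr_left]
      simp [← hf s.fp p, ← hf s.fm m]
    · simp only [IsLevel, p.forall_congr_left, m.forall_congr_left]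
      simp [← hf s.fp p, ← hf s.fm m]

theorem volSum_eq_zero_of_nonpos_left {ι : Perm E} {Lp : P → ℝ} {Lm : M → ℝ} {i : P}
    (hi : Lp i ≤ 0) : volSum ι Lp Lm = 0 :=
  Finset.sum_eq_zero fun s _ => levelVol_eq_zero_of_nonpos_left s.isMap.1.1 hi

theorem volSum_ne_top (ι : Perm E) (Lp : P → ℝ) (Lm : M → ℝ) : volSum ι Lp Lm ≠ ∞ :=
  ENNReal.sum_ne_top.2 fun s _ => levelVol_ne_top s.fp s.fm Lp Lm

theorem volSum_of_isEmpty [IsEmpty E] (ι : Perm E) (Lp : P → ℝ) (Lm : M → ℝ) :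
    volSum ι Lp Lm = 0 :=
  Finset.sum_eq_zero fun s _ => by
    obtain ⟨x⟩ := s.isMap.2.2.1
    exact isEmptyElim x

theorem sum_cmap_extPerm [Nonempty E] (ι : Perm E) (G : CMap (extPerm ι) P M → ℝ≥0∞) :
    ∑ s, G s = ∑ s : CMap ι P M, ∑ x, G (s.insert x) := by
  rw [← Fintype.sum_prod_type' (f := fun (s : CMap ι P M) x => G (s.insert x))]
  exact (Fintype.sum_bijective _ (CMap.insert_bijective ι) _ _ fun _ => rfl).symm

/-- A marked point can be placed anywhere on the boundary `c`, whose length is `Lp c`. `E` is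
nonempty because the circle with one marked point is not obtained by insertion. -/
theorem pointedVolSum_eq [Nonempty E] (ι : Perm E) (c : P) (Lp : P → ℝ) (Lm : M → ℝ) :
    pointedVolSum ι c Lp Lm = ENNReal.ofReal (Lp c) * volSum ι Lp Lm := by
  rw [pointedVolSum, sum_cmap_extPerm, volSum, Finset.mul_sum]
  refine Finset.sum_congr rfl fun s _ => ?_
  rw [← sum_levelVol_insLabel]
  rfl

theorem doublyPointed_eq [Nonempty E] (ι : Perm E) (c₁ c₂ : P) (Lp : P → ℝ) (Lm : M → ℝ) :
    (∑ s : CMap (extPerm (extPerm ι)) P M, if s.fp none = c₁ ∧ s.fp (some none) = c₂ then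
      levelVol s.fp s.fm Lp Lm else 0) =
      ENNReal.ofReal (Lp c₁) * (ENNReal.ofReal (Lp c₂) * volSum ι Lp Lm) := by
  rw [sum_cmap_extPerm, ← pointedVolSum_eq, pointedVolSum, Finset.mul_sum]
  refine Finset.sum_congr rfl fun s _ => ?_
  by_cases h : s.fp none = c₂
  · rw [if_pos h, ← sum_levelVol_insLabel]
    refine Finset.sum_congr rfl fun x _ => ?_
    have : (s.insert x).fp (some none) = c₂ := h
    rw [this]
    simp only [and_true]
    rfl
  · rw [if_neg h, mul_zero]
    refine Finset.sum_eq_zero fun x _ => if_neg ?_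
    rintro ⟨-, h'⟩
    exact h h'

/-! ### The vertex joining two positive boundaries -/

/-- The involution obtained by joining the first two points. -/
noncomputable def joinPerm (ι : Perm E) : Perm (Option (Option E)) :=
  extPerm (extPerm ι) * swap none (some none)

/-- A path of the coarser graph fails to lift only where it jumps between `c₁` and `c₂`, and the
path `hab` bridges this gap. -/
theorem isLinked_of_glue {S N : Type} {f : S → Q'} {fm : S → N} {q : Q' → Q} {c₁ c₂ : Q'}
    (hq : Glues q c₁ c₂) (h : IsLinked (fun x => q (f x)) fm) {a b : S} (ha : f a = c₁)
    (hb : f b = c₂)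
    (hab : Relation.ReflTransGen (fun x y => f x = f y ∨ fm x = fm y) a b) : IsLinked f fm := by
  refine ⟨h.1, fun x y => ?_⟩
  let R : S → S → Prop := fun x y => f x = f y ∨ fm x = fm y
  have hsymm : Relation.ReflTransGen R b a := by
    refine Relation.reflTransGen_swap.1 (Relation.ReflTransGen.mono
      (fun x y hxy => ?_) _ _ hab)
    exact hxy.imp Eq.symm Eq.symm
  induction h.2 x y with
  | refl => exact .refl
  | @tail y z _ hyz ih =>
    refine ih.trans ?_
    rcases hyz with hyz | hyz
    · rcases (hq.2.2 _ _).1 hyz with h1 | ⟨h1 | h1, h2 | h2⟩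
      · exact .single (Or.inl h1)
      · exact .single (Or.inl (h1.trans h2.symm))
      · exact (Relation.ReflTransGen.single (r := R) (Or.inl (h1.trans ha.symm))).trans
          (hab.trans (.single (Or.inl (hb.trans h2.symm))))
      · exact (Relation.ReflTransGen.single (r := R) (Or.inl (h1.trans hb.symm))).trans
          (hsymm.trans (.single (Or.inl (ha.trans h2.symm))))
      · exact .single (Or.inl (h1.trans h2.symm))
    · exact .single (Or.inr hyz)

theorem IsLinked.of_refine {S N : Type} {f : S → Q'} {fm : S → N} (q : Q' → Q) (h : IsLinked f fm) :
    IsLinked (fun x => q (f x)) fm :=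
  h.relabel (Equiv.refl S) q id

/-- Cutting the first vertex yields a map with two marked points on the merged boundary. Erasing the
point `none` leaves a map `s` with one marked point, and `x` records the edge that contained the
erased one. For fixed `s` the sum over `x` is `sum_levelVol_join`, and the sum over `s` gives the
factor `L i + L j`. -/
theorem sum_join [Nonempty E] [Finite Q] [Finite Q'] (ι : Perm E) {q : Q' → Q} {i j : Q'}
    (hq : Glues q i j) {L : Q' → ℝ} {L' : Q → ℝ} (Lm : M → ℝ)
    (hL : ∀ u, u ≠ i → u ≠ j → L' (q u) = L u) (hLij : L' (q i) = L i + L j)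
    (hi : 0 < L i) (hj : 0 < L j) :
    (∑ s : CMap (joinPerm ι) Q' M, if s.fp none = i ∧ s.fp (some none) = j then
      levelVol s.fp s.fm L Lm else 0) = ENNReal.ofReal (L i + L j) * volSum ι L' Lm := by
  have hex : ∀ (s : CMap (extPerm ι) Q M) (x : Option E), ∃ f : Option (Option E) → Q',
      s.fp none = q i → s.fp x = q i →
      IsLabel ((insPerm s.τ x)⁻¹ * joinPerm ι) f ∧ f none = i ∧ f (some none) = j ∧
        ∀ u, q (f u) = insLabel s.fp x u := by
    intro s x
    by_cases h : s.fp none = q i ∧ s.fp x = q i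
    · obtain ⟨f, h1, h2, h3, h4⟩ := (s.insert x).isMap.1.exists_split hq
        (a := none) (b := some none) (by simp) h.2 h.1
      exact ⟨f, fun _ _ => ⟨h1, h2, h3, h4⟩⟩
    · exact ⟨fun _ => i, fun h1 h2 => absurd ⟨h1, h2⟩ h⟩
  choose f hf using hex
  have hmap : ∀ s x, s.fp none = q i → s.fp x = q i →
      IsMap (joinPerm ι) (insPerm s.τ x) (f s x) (insLabel s.fm x) := by
    intro s x hs hx
    obtain ⟨h1, h2, h3, h4⟩ := hf s x hs hx
    refine ⟨h1, (s.insert x).isMap.2.1, isLinked_of_glue hq ?_ h2 h3 ?_⟩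
    · have := (s.insert x).isMap.2.2
      simp only [h4]
      exact this
    -- `none` and `some x` share a negative boundary, and `some x` follows `some none` on its
    -- positive boundary.
    · refine Relation.ReflTransGen.head (b := some x) (Or.inr rfl) (.single (Or.inl ?_))
      rw [← h1.apply (some none)]
      congr 1
  -- The distribution of the labels `i` and `j` after the cut is unique, so the pairs `(s, x)`
  -- parametrise the maps.
  have key : (∑ s : CMap (joinPerm ι) Q' M, if s.fp none = i ∧ s.fp (some none) = j then
      levelVol s.fp s.fm L Lm else 0) = ∑ p : CMap (extPerm ι) Q M × Option E,
      if p.1.fp none = q i ∧ p.1.fp p.2 = q i then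
        levelVol (f p.1 p.2) (insLabel p.1.fm p.2) L Lm else 0 := by
    rw [← Finset.sum_filter, ← Finset.sum_filter]
    symm
    refine Finset.sum_bij (fun p hp => ⟨insPerm p.1.τ p.2, f p.1 p.2, insLabel p.1.fm p.2,
      hmap p.1 p.2 (Finset.mem_filter.1 hp).2.1 (Finset.mem_filter.1 hp).2.2⟩) ?_ ?_ ?_ ?_
    · intro p hp
      have hp := (Finset.mem_filter.1 hp).2
      exact Finset.mem_filter.2 ⟨Finset.mem_univ _, (hf _ _ hp.1 hp.2).2.1, (hf _ _ hp.1 hp.2).2.2.1⟩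
    · intro p hp p' hp' h
      have hp := (Finset.mem_filter.1 hp).2
      have hp' := (Finset.mem_filter.1 hp').2
      have hτ : insPerm p.1.τ p.2 = insPerm p'.1.τ p'.2 := congrArg CMap.τ h
      have hfm : insLabel p.1.fm p.2 = insLabel p'.1.fm p'.2 := congrArg CMap.fm h
      refine (CMap.insert_bijective (extPerm ι)).1 (CMap.ext' hτ ?_ hfm)
      funext u
      have h1 := congrFun (congrArg CMap.fp h) u
      change insLabel p.1.fp p.2 u = insLabel p'.1.fp p'.2 u
      rw [← (hf _ _ hp.1 hp.2).2.2.2, ← (hf _ _ hp'.1 hp'.2).2.2.2]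
      exact congrArg q h1
    · intro s hs
      have hs := (Finset.mem_filter.1 hs).2
      have hlab : IsLabel (s.τ⁻¹ * extPerm (extPerm ι)) fun u => q (s.fp u) := by
        refine IsLabel.glue (a := none) (b := some none) hq ?_ hs.1 hs.2
        rw [mul_assoc]
        exact s.isMap.1
      obtain ⟨⟨s₁, x⟩, h⟩ := (CMap.insert_bijective (extPerm ι)).2 ⟨s.τ, fun u => q (s.fp u), s.fm,
        hlab, s.isMap.2.1, s.isMap.2.2.of_refine q⟩
      have hτ : insPerm s₁.τ x = s.τ := congrArg CMap.τ h
      have hfp : insLabel s₁.fp x = fun u => q (s.fp u) := congrArg CMap.fp h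
      have hfm : insLabel s₁.fm x = s.fm := congrArg CMap.fm h
      have h1 : s₁.fp none = q i := by
        have := congrFun hfp (some none)
        rw [hs.2, ← hq.eq] at this
        exact this
      have h2 : s₁.fp x = q i := by
        have := congrFun hfp none
        rw [hs.1] at this
        exact this
      refine ⟨(s₁, x), Finset.mem_filter.2 ⟨Finset.mem_univ _, h1, h2⟩, CMap.ext' hτ ?_ hfm⟩
      obtain ⟨g1, g2, g3, g4⟩ := hf s₁ x h1 h2
      rw [hτ] at g1
      exact g1.split_unique hq s.isMap.1 g2 hs.1 g3 hs.2 fun u => by rw [g4, hfp]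
    · intro p _
      rfl
  rw [key, Fintype.sum_prod_type, ← hLij, ← pointedVolSum_eq, pointedVolSum]
  refine Finset.sum_congr rfl fun s _ => ?_
  by_cases hs : s.fp none = q i
  · simp only [hs, true_and, if_true]
    refine sum_levelVol_join (σ := s.τ⁻¹ * extPerm ι) hq s.isMap.1 hs ?_ ?_ Lm hL hLij hi hj
    · rw [Perm.mul_apply, extPerm_none, ← s.isMap.2.1.apply (s.τ⁻¹ none)]
      simp
    · intro x hx
      obtain ⟨g1, g2, g3, g4⟩ := hf s x hs hx
      refine ⟨?_, g2, g4⟩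
      rw [joinPerm, ← mul_assoc, insert_inv_mul] at g1
      convert g1
  · simp [hs]

end VolumeSums


/-! ### A vertex touching a positive boundary twice, with connected complement -/

section CutVolume

open scoped Classical
open Equiv

variable {E P M Q Q' : Type} [Fintype E]

/-- In a connected graph the difference of two vertices of the same colour is an integral
boundary. -/
theorem IsLinked.exists_boundary {fp : E → P} {fm : E → M} (h : IsLinked fp fm) (e e' : E) :
    ∃ u : E → ℤ, (∀ i, fibreSum fp u i = (if fp e = i then 1 else 0) - if fp e' = i then 1 else 0) ∧
      ∀ j, fibreSum fm u j = 0 := by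
  induction h.2 e e' with
  | refl => exact ⟨fun _ => 0, fun i => by rw [fibreSum_zero, sub_self], fun j => fibreSum_zero fm j⟩
  | @tail y z _ hyz ih =>
    obtain ⟨u, h1, h2⟩ := ih
    rcases hyz with hyz | hyz
    · exact ⟨u, fun i => by rw [h1, hyz], h2⟩
    -- A step through a negative boundary moves a unit of weight from `z` to `y`, with no effect on
    -- the negative sums.
    · refine ⟨fun x => u x + ((Pi.single y (1 : ℤ) : E → ℤ) x - (Pi.single z (1 : ℤ) : E → ℤ) x),
        fun i => ?_, fun j => ?_⟩
      · rw [fibreSum_add, fibreSum_sub, fibreSum_single, fibreSum_single, h1]; ring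
      · rw [fibreSum_add, fibreSum_sub, fibreSum_single, fibreSum_single, h2, hyz]; ring

/-- The volume of a graph, cut along the length of a boundary of the cut graph. -/
theorem levelVol_slice {q : Q' → Q} {c₁ c₂ : Q'} (hq : Glues q c₁ c₂) {f : E → Q'} {fm : E → M}
    (hf : Function.Surjective f) (h : IsLinked f fm) {L : Q → ℝ} {L' : ℝ → Q' → ℝ} (Lm : M → ℝ)
    (hL : ∀ x u, u ≠ c₁ → u ≠ c₂ → L (q u) = L' x u) (hL₁ : ∀ x, L' x c₁ = x)
    (hL₂ : ∀ x, L' x c₂ = L (q c₁) - x) :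
    levelVol (fun e => q (f e)) fm L Lm = ∫⁻ x, levelVol f fm (L' x) Lm ∧
      Measurable fun x => levelVol f fm (L' x) Lm := by
  have hlev := fun x (z : E → ℝ) => isLevel_glue (Lm := Lm) (fm := fm) (f := f) hq (L := L) (L' := L' x)
    (hL x) (by rw [hL₁, hL₂]; ring) (z := z)
  by_cases hm : ∃ m₀, IsLevel (fun e => q (f e)) fm L Lm m₀
  swap
  · have h0 : ∀ x, levelVol f fm (L' x) Lm = 0 := by
      intro x
      rw [levelVol, levelInt_eq_zero]
      rintro ⟨m, hm'⟩
      exact hm ⟨m, ((hlev x m).1 hm').1⟩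
    simp only [h0]
    rw [levelVol, levelInt_eq_zero hm]
    simp
  obtain ⟨m₀, hm⟩ := hm
  obtain ⟨e, he⟩ := hf c₁
  obtain ⟨e', he'⟩ := hf c₂
  -- Connectedness provides an integral weight that moves a unit of length from `c₂` to `c₁`. Hence
  -- the length of `c₁` takes the value 1 on the lattice, and the slices are integrated against `dx`
  -- exactly.
  obtain ⟨u, hu1, hu2⟩ := h.exists_boundary e e'
  rw [he, he'] at hu1
  let φ : (E → ℤ) →ₗ[ℤ] ℤ :=
    { toFun := fun z => fibreSum f z c₁
      map_add' := fun z w => fibreSum_add f z w c₁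
      map_smul' := fun a z => fibreSum_mul f a z c₁ }
  have hφu : φ u = 1 := by
    change fibreSum f u c₁ = 1
    rw [hu1]; simp [hq.2.1.symm]
  have hu : u ∈ kerLat (fun e => q (f e)) fm := by
    refine ⟨fun k => ?_, hu2⟩
    obtain ⟨v, rfl⟩ := hq.1 k
    by_cases hv : v = c₁ ∨ v = c₂
    · rw [(hq.eq_iff v).2 hv, fibreSum_glue hq, hu1, hu1]
      simp [hq.2.1, hq.2.1.symm]
    · rw [not_or] at hv
      rw [fibreSum_glue_of_ne hq f u hv.1 hv.2, hu1]
      simp [Ne.symm hv.1, Ne.symm hv.2]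
  have hK : kerLat (fun e => q (f e)) fm ⊓ LinearMap.ker φ = kerLat f fm := by
    ext z
    rw [Submodule.mem_inf, mem_kerLat, mem_kerLat, LinearMap.mem_ker,
      isLevel_glue (A := ℤ) (L := 0) hq (by simp) (by simp)]
    rfl
  have hx : ∀ x, levelVol f fm (L' x) Lm =
      latInt (kerLat f fm) (fun e => m₀ e + (x - fibreSum f m₀ c₁) * u e) posInd := by
    intro x
    refine levelInt_eq ?_ measurable_posInd
    rw [hlev x]
    refine ⟨⟨fun k => ?_, fun j => ?_⟩, ?_⟩
    · rw [fibreSum_add, fibreSum_mul, fibreSum_cast, hu.1, hm.1]; simp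
    · rw [fibreSum_add, fibreSum_mul, fibreSum_cast, hu.2, hm.2]; simp
    · rw [fibreSum_add, fibreSum_mul, fibreSum_cast, hL₁, hu1]; simp [hq.2.1.symm]
  obtain ⟨h1, h2⟩ := latInt_slice φ hu hφu m₀ measurable_posInd
  rw [hK] at h1 h2
  simp only [hx]
  refine ⟨?_, h2.comp (measurable_id.sub_const _)⟩
  rw [levelVol, levelInt_eq hm measurable_posInd, h1]
  exact (lintegral_sub_right_eq_self
    (fun x => latInt (kerLat f fm) (fun e => m₀ e + x * u e) posInd) (fibreSum f m₀ c₁)).symm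

theorem measurable_volSum [Finite Q'] [Finite M] (ι : Perm E) {q : Q' → Q} {c₁ c₂ : Q'}
    (hq : Glues q c₁ c₂) {L : Q → ℝ} {L' : ℝ → Q' → ℝ} (Lm : M → ℝ)
    (hL : ∀ x u, u ≠ c₁ → u ≠ c₂ → L (q u) = L' x u) (hL₁ : ∀ x, L' x c₁ = x)
    (hL₂ : ∀ x, L' x c₂ = L (q c₁) - x) : Measurable fun x => volSum ι (L' x) Lm :=
  Finset.measurable_sum _ fun s _ =>
    (levelVol_slice hq s.isMap.1.1 s.isMap.2.2 Lm hL hL₁ hL₂).2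

/-- The part of a map that remains connected with the first point when the first vertex is cut. -/
def CMap.Reach {ι : Perm E} (s : CMap (joinPerm ι) P M) (u : Option (Option E)) : Prop :=
  Relation.ReflTransGen (fun u v => (s.τ⁻¹ * extPerm (extPerm ι)).SameCycle u v ∨
    s.τ.SameCycle u v) none u

theorem joinPerm_mul_swap {S : Type} (ι : Perm S) :
    joinPerm ι * swap none (some none) = extPerm (extPerm ι) := by
  rw [joinPerm, mul_assoc, swap_mul_self, mul_one]

theorem CMap.exists_cut {S : Type} [Finite S] {ι : Perm S} (s : CMap (joinPerm ι) Q M) {q : Q' → Q}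
    {c₁ c₂ : Q'} (hq : Glues q c₁ c₂) (ha : s.fp none = q c₁) (hb : s.fp (some none) = q c₁) :
    ∃ f : Option (Option S) → Q', IsLabel (s.τ⁻¹ * extPerm (extPerm ι)) f ∧ f none = c₁ ∧
      f (some none) = c₂ ∧ ∀ u, q (f u) = s.fp u := by
  obtain ⟨f, h1, h2, h3, h4⟩ := s.isMap.1.exists_split hq (a := none) (b := some none) (by simp) ha hb
  refine ⟨f, ?_, h2, h3, h4⟩
  rwa [mul_assoc, joinPerm_mul_swap] at h1

/-- The maps with a vertex that touches twice the same positive boundary, and that stay connected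
when the vertex is cut. -/
theorem sum_cut_connected [Nonempty E] [Finite Q] [Finite Q'] [Finite M] (ι : Perm E)
    {q : Q' → Q} {c₁ c₂ : Q'}
    (hq : Glues q c₁ c₂) {L : Q → ℝ} {L' : ℝ → Q' → ℝ} (Lm : M → ℝ)
    (hL : ∀ x u, u ≠ c₁ → u ≠ c₂ → L (q u) = L' x u) (hL₁ : ∀ x, L' x c₁ = x)
    (hL₂ : ∀ x, L' x c₂ = L (q c₁) - x) :
    (∑ s : CMap (joinPerm ι) Q M, if (s.fp none = q c₁ ∧ s.fp (some none) = q c₁) ∧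
      s.Reach (some none) then levelVol s.fp s.fm L Lm else 0) =
      ∫⁻ x, ENNReal.ofReal x * (ENNReal.ofReal (L (q c₁) - x) * volSum ι (L' x) Lm) := by
  -- Cutting the vertex is a bijection onto the connected maps with marked points on `c₁` and `c₂`;
  -- `Reach` is the condition that the cut graph stays connected.
  have key : (∑ s : CMap (joinPerm ι) Q M, if (s.fp none = q c₁ ∧ s.fp (some none) = q c₁) ∧
      s.Reach (some none) then levelVol s.fp s.fm L Lm else 0) =
      ∑ s : CMap (extPerm (extPerm ι)) Q' M, if s.fp none = c₁ ∧ s.fp (some none) = c₂ then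
        levelVol (fun e => q (s.fp e)) s.fm L Lm else 0 := by
    rw [← Finset.sum_filter, ← Finset.sum_filter]
    symm
    have hmap : ∀ s : CMap (extPerm (extPerm ι)) Q' M, s.fp none = c₁ ∧ s.fp (some none) = c₂ →
        IsMap (joinPerm ι) s.τ (fun u => q (s.fp u)) s.fm := by
      intro s hs
      refine ⟨IsLabel.glue (a := none) (b := some none) hq ?_ hs.1 hs.2, s.isMap.2.1,
        s.isMap.2.2.of_refine q⟩
      rw [mul_assoc, joinPerm_mul_swap]
      exact s.isMap.1
    refine Finset.sum_bij (fun s hs => ⟨s.τ, fun u => q (s.fp u), s.fm,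
      hmap s (Finset.mem_filter.1 hs).2⟩) ?_ ?_ ?_ ?_
    · intro s hs
      have hs := (Finset.mem_filter.1 hs).2
      refine Finset.mem_filter.2 ⟨Finset.mem_univ _, ⟨congrArg q hs.1, ?_⟩, ?_⟩
      · exact (congrArg q hs.2).trans hq.eq.symm
      · refine Relation.ReflTransGen.mono (fun u v huv => ?_) _ _ (s.isMap.2.2.2 none (some none))
        exact huv.imp (s.isMap.1.2 _ _).1 (s.isMap.2.1.2 _ _).1
    · intro s hs t ht h
      have hs := (Finset.mem_filter.1 hs).2
      have ht := (Finset.mem_filter.1 ht).2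
      have hτ : s.τ = t.τ := (congrArg CMap.τ h :)
      refine CMap.ext' hτ ?_ (congrArg CMap.fm h :)
      have h1 := t.isMap.1
      rw [← hτ] at h1
      exact s.isMap.1.split_unique hq h1 hs.1 ht.1 hs.2 ht.2 fun u =>
        congrFun (congrArg CMap.fp h) u
    · intro s hs
      obtain ⟨⟨ha, hb⟩, hr⟩ := (Finset.mem_filter.1 hs).2
      obtain ⟨f, h1, h2, h3, h4⟩ := s.exists_cut hq ha hb
      have hl : IsLinked f s.fm := by
        refine isLinked_of_glue hq ?_ h2 h3 ?_
        · simp only [h4]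
          exact s.isMap.2.2
        · refine Relation.ReflTransGen.mono (fun u v huv => ?_) _ _ hr
          exact huv.imp (h1.2 _ _).2 (s.isMap.2.1.2 _ _).2
      exact ⟨⟨s.τ, f, s.fm, h1, s.isMap.2.1, hl⟩, Finset.mem_filter.2 ⟨Finset.mem_univ _, h2, h3⟩,
        CMap.ext' rfl (funext h4) rfl⟩
    · intro s _
      rfl
  rw [key]
  -- The marked points on the boundaries of lengths `x` and `L (q c₁) - x` account for these two
  -- factors.
  have h1 : ∀ x, ENNReal.ofReal x * (ENNReal.ofReal (L (q c₁) - x) * volSum ι (L' x) Lm) =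
      ∑ s : CMap (extPerm (extPerm ι)) Q' M, if s.fp none = c₁ ∧ s.fp (some none) = c₂ then
        levelVol s.fp s.fm (L' x) Lm else 0 := by
    intro x
    rw [doublyPointed_eq, hL₁, hL₂]
  simp only [h1]
  rw [lintegral_finsetSum]
  · refine Finset.sum_congr rfl fun s _ => ?_
    split_ifs
    · exact (levelVol_slice hq s.isMap.1.1 s.isMap.2.2 Lm hL hL₁ hL₂).1
    · simp
  · intro s _
    split_ifs
    · exact (levelVol_slice hq s.isMap.1.1 s.isMap.2.2 Lm hL hL₁ hL₂).2
    · exact measurable_const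

end CutVolume


/-! ### Joining two maps at a vertex -/

section Disconnected

open scoped Classical
open Equiv

variable {E E₁ E₂ P M P₁ P₂ M₁ M₂ Q : Type}

theorem sumCongr_zpow (τ₁ : Perm E₁) (τ₂ : Perm E₂) (n : ℤ) :
    (Perm.sumCongr τ₁ τ₂) ^ n = Perm.sumCongr (τ₁ ^ n) (τ₂ ^ n) :=
  ((Perm.sumCongrHom E₁ E₂).map_zpow (τ₁, τ₂) n).symm

theorem isLabel_sum {τ₁ : Perm E₁} {τ₂ : Perm E₂} {f₁ : E₁ → P₁} {f₂ : E₂ → P₂} :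
    IsLabel (Perm.sumCongr τ₁ τ₂) (Sum.map f₁ f₂) ↔ IsLabel τ₁ f₁ ∧ IsLabel τ₂ f₂ := by
  have h1 : ∀ x y, (Perm.sumCongr τ₁ τ₂).SameCycle (Sum.inl x) (Sum.inl y) ↔ τ₁.SameCycle x y :=
    fun x y => exists_congr fun n => by simp [sumCongr_zpow]
  have h2 : ∀ x y, (Perm.sumCongr τ₁ τ₂).SameCycle (Sum.inr x) (Sum.inr y) ↔ τ₂.SameCycle x y :=
    fun x y => exists_congr fun n => by simp [sumCongr_zpow]
  have h3 : ∀ x y, ¬(Perm.sumCongr τ₁ τ₂).SameCycle (Sum.inl x) (Sum.inr y) := by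
    rintro x y ⟨n, hn⟩
    simp [sumCongr_zpow] at hn
  have h4 : ∀ x y, ¬(Perm.sumCongr τ₁ τ₂).SameCycle (Sum.inr x) (Sum.inl y) := by
    rintro x y ⟨n, hn⟩
    simp [sumCongr_zpow] at hn
  simp only [IsLabel, Sum.map_surjective, Sum.forall, h1, h2, h3, h4, Sum.map_inl, Sum.map_inr,
    Sum.inl.injEq, Sum.inr.injEq, reduceCtorEq, implies_true, and_true, true_and]
  tauto

theorem isLinked_of_base {fp : E → P} {fm : E → M} (b : E)
    (h : ∀ x, Relation.ReflTransGen (fun x y => fp x = fp y ∨ fm x = fm y) b x) :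
    IsLinked fp fm := by
  refine ⟨⟨b⟩, fun x y => Relation.ReflTransGen.trans ?_ (h y)⟩
  refine Relation.reflTransGen_swap.1 (Relation.ReflTransGen.mono (fun x y hxy => ?_) _ _ (h x))
  exact hxy.imp Eq.symm Eq.symm

section Glue

variable {ι : Perm E} {ι₁ : Perm E₁} {ι₂ : Perm E₂}

/-- A pair of maps on complementary sets of edges. -/
structure Cutting (ι : Perm E) (ι₁ : Perm E₁) (ι₂ : Perm E₂) where
  e : Option E₁ ⊕ Option E₂ ≃ Option (Option E)
  inl_none : e (Sum.inl none) = none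
  inr_none : e (Sum.inr none) = some none
  map_ι : ∀ x, extPerm (extPerm ι) (e x) = e (Perm.sumCongr (extPerm ι₁) (extPerm ι₂) x)

variable (c : Cutting ι ι₁ ι₂) {q : Option P₁ ⊕ Option P₂ → P}
  (m : M₁ ⊕ M₂ ≃ M)

theorem Glues.inl_injective (hq : Glues q (Sum.inl none) (Sum.inr none)) {k l : Option P₁} (h : q (Sum.inl k) = q (Sum.inl l)) : k = l := by
  rcases (hq.2.2 _ _).1 h with h | ⟨h1, h2⟩
  · exact Sum.inl_injective h
  · simp at h1 h2
    rw [h1, h2]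

theorem Glues.inr_injective (hq : Glues q (Sum.inl none) (Sum.inr none)) {k l : Option P₂} (h : q (Sum.inr k) = q (Sum.inr l)) : k = l := by
  rcases (hq.2.2 _ _).1 h with h | ⟨h1, h2⟩
  · exact Sum.inr_injective h
  · simp at h1 h2
    rw [h1, h2]

theorem Glues.inl_eq_inr (hq : Glues q (Sum.inl none) (Sum.inr none)) {k : Option P₁} {l : Option P₂} (h : q (Sum.inl k) = q (Sum.inr l)) :
    k = none ∧ l = none := by
  rcases (hq.2.2 _ _).1 h with h | ⟨h1, h2⟩
  · simp at h
  · simp at h1 h2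
    exact ⟨h1, h2⟩

/-- The permutation of all edges defined by permutations of the two parts. -/
def Cutting.perm (c : Cutting ι ι₁ ι₂) (τ₁ : Perm (Option E₁)) (τ₂ : Perm (Option E₂)) :
    Perm (Option (Option E)) :=
  (c.e.symm.trans (Perm.sumCongr τ₁ τ₂)).trans c.e

theorem Cutting.perm_apply (τ₁ : Perm (Option E₁)) (τ₂ : Perm (Option E₂)) (x) :
    c.perm τ₁ τ₂ (c.e x) = c.e (Perm.sumCongr τ₁ τ₂ x) := by
  simp [Cutting.perm]

theorem Cutting.inv_mul_apply (τ₁ : Perm (Option E₁)) (τ₂ : Perm (Option E₂)) (x) :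
    ((c.perm τ₁ τ₂)⁻¹ * extPerm (extPerm ι)) (c.e x) =
      c.e (Perm.sumCongr (τ₁⁻¹ * extPerm ι₁) (τ₂⁻¹ * extPerm ι₂) x) := by
  rw [Perm.mul_apply, c.map_ι, Perm.inv_eq_iff_eq, c.perm_apply]
  cases x <;> simp

/-- Before the vertex is created the permutations are direct sums. The transposition then joins the
two marked boundaries and thereby connects the parts. -/
theorem Cutting.isMap_glue (hq : Glues q (Sum.inl none) (Sum.inr none)) (s₁ : CMap (extPerm ι₁) (Option P₁) M₁)
    (s₂ : CMap (extPerm ι₂) (Option P₂) M₂) (h₁ : s₁.fp none = none) (h₂ : s₂.fp none = none)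
    [Finite E] :
    IsMap (joinPerm ι) (c.perm s₁.τ s₂.τ)
      (fun u => q (Sum.map s₁.fp s₂.fp (c.e.symm u)))
      (fun u => m (Sum.map s₁.fm s₂.fm (c.e.symm u))) := by
  refine ⟨?_, ?_, ?_⟩
  · refine IsLabel.glue (a := none) (b := some none) hq
      (f := fun u => Sum.map s₁.fp s₂.fp (c.e.symm u)) ?_ ?_ ?_
    · rw [mul_assoc, joinPerm_mul_swap]
      exact (isLabel_sum.2 ⟨s₁.isMap.1, s₂.isMap.1⟩).relabel c.e (c.inv_mul_apply s₁.τ s₂.τ)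
        (Equiv.refl _)
    · rw [← c.inl_none]; simp [h₁]
    · rw [← c.inr_none]; simp [h₂]
  · exact (isLabel_sum.2 ⟨s₁.isMap.2.1, s₂.isMap.2.1⟩).relabel c.e (c.perm_apply s₁.τ s₂.τ) m
  · refine isLinked_of_base none fun u => ?_
    obtain ⟨x, rfl⟩ := c.e.surjective u
    cases x with
    | inl x =>
      rw [← c.inl_none]
      refine Relation.ReflTransGen.lift (fun x => c.e (Sum.inl x)) (fun x y hxy => ?_) _ _
        (s₁.isMap.2.2.2 none x)
      rcases hxy with hxy | hxy
      · exact Or.inl (by simp [hxy])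
      · exact Or.inr (by simp [hxy])
    | inr x =>
      refine Relation.ReflTransGen.head (b := some none) (Or.inl ?_) ?_
      · rw [← c.inl_none, ← c.inr_none]
        simp [h₁, h₂, hq.eq]
      rw [← c.inr_none]
      refine Relation.ReflTransGen.lift (fun x => c.e (Sum.inr x)) (fun x y hxy => ?_) _ _
        (s₂.isMap.2.2.2 none x)
      rcases hxy with hxy | hxy
      · exact Or.inl (by simp [hxy])
      · exact Or.inr (by simp [hxy])

/-- The map obtained by joining the marked points of two maps. -/
noncomputable def Cutting.glue (hq : Glues q (Sum.inl none) (Sum.inr none)) (s₁ : CMap (extPerm ι₁) (Option P₁) M₁)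
    (s₂ : CMap (extPerm ι₂) (Option P₂) M₂) (h₁ : s₁.fp none = none) (h₂ : s₂.fp none = none)
    [Finite E] : CMap (joinPerm ι) P M :=
  ⟨_, _, _, c.isMap_glue m hq s₁ s₂ h₁ h₂⟩

/-- After the cut both permutations preserve the two parts, and the left part is connected through
its own path relation. -/
theorem Cutting.reach_glue (hq : Glues q (Sum.inl none) (Sum.inr none)) (s₁ : CMap (extPerm ι₁) (Option P₁) M₁)
    (s₂ : CMap (extPerm ι₂) (Option P₂) M₂) (h₁ : s₁.fp none = none) (h₂ : s₂.fp none = none)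
    [Finite E] (u) : (c.glue m hq s₁ s₂ h₁ h₂).Reach u ↔ (c.e.symm u).isLeft := by
  obtain ⟨x, rfl⟩ := c.e.surjective u
  rw [symm_apply_apply]
  constructor
  · intro h
    have hinv : ∀ {π : Perm (Option (Option E))} {τ₁ : Perm (Option E₁)} {τ₂ : Perm (Option E₂)},
        (∀ x, π (c.e x) = c.e (Perm.sumCongr τ₁ τ₂ x)) → ∀ {u v}, π.SameCycle u v →
        ((c.e.symm u).isLeft = (c.e.symm v).isLeft) := by
      intro π τ₁ τ₂ hπ u v huv
      refine sameCycle_induct (r := fun u v => (c.e.symm u).isLeft = (c.e.symm v).isLeft)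
        ⟨fun _ => rfl, fun h => h.symm, fun h h' => h.trans h'⟩ (fun u => ?_) huv
      obtain ⟨x, rfl⟩ := c.e.surjective u
      rw [hπ]
      cases x <;> simp
    suffices ∀ u, (c.glue m hq s₁ s₂ h₁ h₂).Reach u → (c.e.symm u).isLeft by
      have := this _ h
      rwa [symm_apply_apply] at this
    intro u hu
    induction hu with
    | refl => rw [← c.inl_none]; simp
    | tail _ huv ih =>
      rcases huv with huv | huv
      · rwa [← hinv (c.inv_mul_apply s₁.τ s₂.τ) huv]
      · rwa [← hinv (c.perm_apply s₁.τ s₂.τ) huv]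
  · intro h
    cases x with
    | inr x => simp at h
    | inl x =>
      rw [CMap.Reach, ← c.inl_none]
      refine Relation.ReflTransGen.lift (fun x => c.e (Sum.inl x)) (fun x y hxy => ?_) _ _
        (s₁.isMap.2.2.2 none x)
      have hs := isLabel_sum.2 ⟨s₁.isMap.1, s₂.isMap.1⟩
      have ht := isLabel_sum.2 ⟨s₁.isMap.2.1, s₂.isMap.2.1⟩
      refine hxy.imp (fun hxy => ?_) fun hxy => ?_
      · refine (sameCycle_permCongr c.e (c.inv_mul_apply s₁.τ s₂.τ) _ _).2 ((hs.2 _ _).1 ?_)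
        simp [hxy]
      · refine (sameCycle_permCongr c.e (c.perm_apply s₁.τ s₂.τ) _ _).2 ((ht.2 _ _).1 ?_)
        simp [hxy]

/-- The map `s` is cut in two pieces by its first vertex, and these pieces are as prescribed. -/
def Cutting.Splits (c : Cutting ι ι₁ ι₂) (q : Option P₁ ⊕ Option P₂ → P) (m : M₁ ⊕ M₂ ≃ M)
    (s : CMap (joinPerm ι) P M) : Prop :=
  ∀ u, (s.Reach u ↔ (c.e.symm u).isLeft) ∧ (s.Reach u ↔ (m.symm (s.fm u)).isLeft) ∧
    (s.Reach u → ∃ k, s.fp u = q (Sum.inl k)) ∧ (¬s.Reach u → ∃ k, s.fp u = q (Sum.inr k))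

theorem Cutting.splits_glue (hq : Glues q (Sum.inl none) (Sum.inr none)) (s₁ : CMap (extPerm ι₁) (Option P₁) M₁)
    (s₂ : CMap (extPerm ι₂) (Option P₂) M₂) (h₁ : s₁.fp none = none) (h₂ : s₂.fp none = none)
    [Finite E] : c.Splits q m (c.glue m hq s₁ s₂ h₁ h₂) := by
  intro u
  rw [c.reach_glue m hq]
  refine ⟨Iff.rfl, ?_, ?_, ?_⟩
  · rw [Cutting.glue]
    cases h : c.e.symm u <;> simp [h]
  · intro h
    obtain ⟨x, hx⟩ := Sum.isLeft_iff.1 h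
    exact ⟨s₁.fp x, by simp [Cutting.glue, hx]⟩
  · intro h
    rw [Sum.not_isLeft, Sum.isRight_iff] at h
    obtain ⟨x, hx⟩ := h
    exact ⟨s₂.fp x, by simp [Cutting.glue, hx]⟩

/-- The set of points reached from `none` is stable under `τ` and under the cut positive
permutation, so these permutations and all labels restrict to the two parts. -/
theorem Cutting.exists_glue (hq : Glues q (Sum.inl none) (Sum.inr none)) [Finite E] [Finite E₁] [Finite E₂] (s : CMap (joinPerm ι) P M)
    (hs : c.Splits q m s)
    (ha : s.fp none = q (Sum.inl none)) (hb : s.fp (some none) = q (Sum.inl none)) :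
    ∃ s₁ s₂ h₁ h₂, c.glue m hq s₁ s₂ h₁ h₂ = s := by
  obtain ⟨f, hf, hfa, hfb, hqf⟩ := s.exists_cut hq ha hb
  have hleft : ∀ x, ∃ k, f (c.e (Sum.inl x)) = Sum.inl k := by
    intro x
    have hr : s.Reach (c.e (Sum.inl x)) := by rw [(hs _).1]; simp
    obtain ⟨k, hk⟩ := (hs _).2.2.1 hr
    rw [← hqf] at hk
    cases h : f (c.e (Sum.inl x)) with
    | inl l => exact ⟨l, rfl⟩
    | inr l =>
      rw [h] at hk
      -- A label from the wrong side must be the glued one; its cycle contains `some none`, which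
      -- would then be reached from the left part.
      rw [(hq.inl_eq_inr hk.symm).2, ← hfb, hf.2] at h
      have : s.Reach (some none) := hr.tail (Or.inl h)
      rw [(hs _).1, ← c.inr_none] at this
      simp at this
  have hright : ∀ x, ∃ k, f (c.e (Sum.inr x)) = Sum.inr k := by
    intro x
    have hr : ¬s.Reach (c.e (Sum.inr x)) := by rw [(hs _).1]; simp
    obtain ⟨k, hk⟩ := (hs _).2.2.2 hr
    rw [← hqf] at hk
    cases h : f (c.e (Sum.inr x)) with
    | inr l => exact ⟨l, rfl⟩
    | inl l =>
      rw [h] at hk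
      rw [(hq.inl_eq_inr hk).1, ← hfa, hf.2] at h
      exact absurd (.single (Or.inl h.symm)) hr
  have hmleft : ∀ x, ∃ k, s.fm (c.e (Sum.inl x)) = m (Sum.inl k) := by
    intro x
    have h1 := (hs (c.e (Sum.inl x))).1.symm.trans (hs _).2.1
    rw [symm_apply_apply] at h1
    obtain ⟨k, hk⟩ := Sum.isLeft_iff.1 (h1.1 rfl)
    exact ⟨k, by rw [← hk, apply_symm_apply]⟩
  have hmright : ∀ x, ∃ k, s.fm (c.e (Sum.inr x)) = m (Sum.inr k) := by
    intro x
    have h1 := (hs (c.e (Sum.inr x))).1.symm.trans (hs _).2.1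
    rw [symm_apply_apply] at h1
    have h2 : ¬(m.symm (s.fm (c.e (Sum.inr x)))).isLeft := fun h => by simpa using h1.2 h
    rw [Sum.not_isLeft, Sum.isRight_iff] at h2
    obtain ⟨k, hk⟩ := h2
    exact ⟨k, by rw [← hk, apply_symm_apply]⟩
  choose f₁ hf₁ using hleft
  choose f₂ hf₂ using hright
  choose g₁ hg₁ using hmleft
  choose g₂ hg₂ using hmright
  let T : Perm (Option E₁ ⊕ Option E₂) := (c.e.trans s.τ).trans c.e.symm
  -- A permutation of a sum that preserves one summand is a sum of permutations.
  have hT : Set.MapsTo T (Set.range Sum.inl) (Set.range Sum.inl) := by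
    rintro _ ⟨x, rfl⟩
    have hr : s.Reach (c.e (Sum.inl x)) := by rw [(hs _).1]; simp
    have hr' : s.Reach (s.τ (c.e (Sum.inl x))) := hr.tail (Or.inr (sameCycle_apply _ _))
    rw [(hs _).1] at hr'
    obtain ⟨y, hy⟩ := Sum.isLeft_iff.1 hr'
    exact ⟨y, hy.symm⟩
  obtain ⟨⟨τ₁, τ₂⟩, hτ⟩ := Perm.mem_sumCongrHom_range_of_perm_mapsTo_inl hT
  have hτ' : s.τ = c.perm τ₁ τ₂ := by
    have : T = Perm.sumCongr τ₁ τ₂ := hτ.symm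
    rw [Cutting.perm, ← this]
    ext x
    simp [T]
  have hfe : f = fun u => Sum.map f₁ f₂ (c.e.symm u) := by
    funext u
    obtain ⟨x, rfl⟩ := c.e.surjective u
    cases x <;> simp [hf₁, hf₂]
  have hge : s.fm = fun u => m (Sum.map g₁ g₂ (c.e.symm u)) := by
    funext u
    obtain ⟨x, rfl⟩ := c.e.surjective u
    cases x <;> simp [hg₁, hg₂]
  have hpe : s.fp = fun u => q (Sum.map f₁ f₂ (c.e.symm u)) := by
    funext u
    rw [← hqf, hfe]
  have hlab : IsLabel (Perm.sumCongr (τ₁⁻¹ * extPerm ι₁) (τ₂⁻¹ * extPerm ι₂)) (Sum.map f₁ f₂) := by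
    have h1 := hf.relabel (π' := Perm.sumCongr (τ₁⁻¹ * extPerm ι₁) (τ₂⁻¹ * extPerm ι₂)) c.e.symm
      (fun x => by
        obtain ⟨x, rfl⟩ := c.e.surjective x
        rw [hτ', c.inv_mul_apply, symm_apply_apply, symm_apply_apply]) (Equiv.refl _)
    simpa [hfe] using h1
  have hlabm : IsLabel (Perm.sumCongr τ₁ τ₂) (Sum.map g₁ g₂) := by
    have h1 := s.isMap.2.1.relabel (π' := Perm.sumCongr τ₁ τ₂) c.e.symm
      (fun x => by
        obtain ⟨x, rfl⟩ := c.e.surjective x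
        rw [hτ', c.perm_apply, symm_apply_apply, symm_apply_apply]) m.symm
    simpa [hge] using h1
  have h₁ : f₁ none = none := by
    have := hf₁ none
    rw [c.inl_none, hfa] at this
    exact (Sum.inl_injective this).symm
  have h₂ : f₂ none = none := by
    have := hf₂ none
    rw [c.inr_none, hfb] at this
    exact (Sum.inr_injective this).symm
  have hlink₁ : IsLinked f₁ g₁ := by
    refine isLinked_of_base none fun x => ?_
    suffices ∀ u, Relation.ReflTransGen (fun u v => s.fp u = s.fp v ∨ s.fm u = s.fm v) none u →
        ∀ x, u = c.e (Sum.inl x) →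
        Relation.ReflTransGen (fun u v => f₁ u = f₁ v ∨ g₁ u = g₁ v) none x from
      this _ (s.isMap.2.2.2 _ _) x rfl
    intro u hu
    induction hu with
    | refl =>
      intro x hx
      rw [← c.inl_none] at hx
      rw [← Sum.inl_injective (c.e.injective hx)]
    | @tail y z _ hyz ih =>
      rintro x rfl
      obtain ⟨y, rfl⟩ := c.e.surjective y
      rw [hpe, hge] at hyz
      simp only [symm_apply_apply] at hyz
      cases y with
      | inl y =>
        refine (ih y rfl).tail (hyz.imp (fun h => hq.inl_injective h) fun h => ?_)
        exact Sum.inl_injective (m.injective h)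
      | inr y =>
        rcases hyz with hyz | hyz
        -- A step between the parts can only use the glued boundary, which on this side is the
        -- boundary of the marked point.
        · exact .single (Or.inl (h₁.trans (hq.inl_eq_inr hyz.symm).1.symm))
        · have := m.injective hyz
          simp at this
  have hlink₂ : IsLinked f₂ g₂ := by
    refine isLinked_of_base none fun x => ?_
    suffices ∀ u, Relation.ReflTransGen (fun u v => s.fp u = s.fp v ∨ s.fm u = s.fm v) (some none) u →
        ∀ x, u = c.e (Sum.inr x) →
        Relation.ReflTransGen (fun u v => f₂ u = f₂ v ∨ g₂ u = g₂ v) none x from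
      this _ (s.isMap.2.2.2 _ _) x rfl
    intro u hu
    induction hu with
    | refl =>
      intro x hx
      rw [← c.inr_none] at hx
      rw [← Sum.inr_injective (c.e.injective hx)]
    | @tail y z _ hyz ih =>
      rintro x rfl
      obtain ⟨y, rfl⟩ := c.e.surjective y
      rw [hpe, hge] at hyz
      simp only [symm_apply_apply] at hyz
      cases y with
      | inr y =>
        refine (ih y rfl).tail (hyz.imp (fun h => hq.inr_injective h) fun h => ?_)
        exact Sum.inr_injective (m.injective h)
      | inl y =>
        rcases hyz with hyz | hyz
        · exact .single (Or.inl (h₂.trans (hq.inl_eq_inr hyz).2.symm))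
        · have := m.injective hyz
          simp at this
  rw [isLabel_sum] at hlab hlabm
  exact ⟨⟨τ₁, f₁, g₁, hlab.1, hlabm.1, hlink₁⟩, ⟨τ₂, f₂, g₂, hlab.2, hlabm.2, hlink₂⟩, h₁, h₂,
    CMap.ext' hτ'.symm hpe.symm hge.symm⟩

theorem Cutting.glue_injective (hq : Glues q (Sum.inl none) (Sum.inr none)) [Finite E] {s₁ t₁ : CMap (extPerm ι₁) (Option P₁) M₁}
    {s₂ t₂ : CMap (extPerm ι₂) (Option P₂) M₂} {h₁ h₂ h₁' h₂'}
    (h : c.glue m hq s₁ s₂ h₁ h₂ = c.glue m hq t₁ t₂ h₁' h₂') : s₁ = t₁ ∧ s₂ = t₂ := by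
  have hτ : c.perm s₁.τ s₂.τ = c.perm t₁.τ t₂.τ := congrArg CMap.τ h
  have hp := fun x => congrFun (congrArg CMap.fp h) (c.e x)
  have hm := fun x => congrFun (congrArg CMap.fm h) (c.e x)
  have hτ' := fun x => congrArg c.e.symm (congrFun (congrArg DFunLike.coe hτ) (c.e x))
  simp only [c.perm_apply, symm_apply_apply] at hτ'
  simp only [Cutting.glue, symm_apply_apply] at hp hm
  constructor
  · refine CMap.ext' (Equiv.ext fun x => ?_) (funext fun x => ?_) (funext fun x => ?_)
    · simpa using hτ' (Sum.inl x)
    · exact hq.inl_injective (hp (Sum.inl x))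
    · exact Sum.inl_injective (m.injective (hm (Sum.inl x)))
  · refine CMap.ext' (Equiv.ext fun x => ?_) (funext fun x => ?_) (funext fun x => ?_)
    · simpa using hτ' (Sum.inr x)
    · exact hq.inr_injective (hp (Sum.inr x))
    · exact Sum.inr_injective (m.injective (hm (Sum.inr x)))

end Glue

end Disconnected


/-! ### Volumes of maps joined at a vertex -/

section DisconnectedVolume

open scoped Classical
open Equiv

variable {E E₁ E₂ P M P₁ P₂ M₁ M₂ Q Q' : Type}

theorem fibreSum_comp_injective [Fintype E] {A : Type} [AddCommMonoid A] (f : E → Q) {p : Q → Q'}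
    (hp : Function.Injective p) (z : E → A) (k : Q) :
    fibreSum (fun x => p (f x)) z (p k) = fibreSum f z k := by
  refine Finset.sum_congr rfl fun x _ => ?_
  simp only [hp.eq_iff]

variable [Fintype E₁] [Fintype E₂]

theorem fibreSum_sum_inl {A : Type} [AddCommMonoid A] (f₁ : E₁ → P₁) (f₂ : E₂ → P₂)
    (z : E₁ ⊕ E₂ → A) (k : P₁) :
    fibreSum (Sum.map f₁ f₂) z (Sum.inl k) = fibreSum f₁ (fun e => z (Sum.inl e)) k := by
  simp [fibreSum, Fintype.sum_sum_type]

theorem fibreSum_sum_inr {A : Type} [AddCommMonoid A] (f₁ : E₁ → P₁) (f₂ : E₂ → P₂)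
    (z : E₁ ⊕ E₂ → A) (k : P₂) :
    fibreSum (Sum.map f₁ f₂) z (Sum.inr k) = fibreSum f₂ (fun e => z (Sum.inr e)) k := by
  simp [fibreSum, Fintype.sum_sum_type]

theorem isLevel_sum {A : Type} [AddCommMonoid A] {fp₁ : E₁ → P₁} {fp₂ : E₂ → P₂} {fm₁ : E₁ → M₁}
    {fm₂ : E₂ → M₂} {Lp : P₁ ⊕ P₂ → A} {Lm : M₁ ⊕ M₂ → A} {z : E₁ ⊕ E₂ → A} :
    IsLevel (Sum.map fp₁ fp₂) (Sum.map fm₁ fm₂) Lp Lm z ↔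
      IsLevel fp₁ fm₁ (fun i => Lp (Sum.inl i)) (fun j => Lm (Sum.inl j)) (fun e => z (Sum.inl e)) ∧
      IsLevel fp₂ fm₂ (fun i => Lp (Sum.inr i)) (fun j => Lm (Sum.inr j))
        (fun e => z (Sum.inr e)) := by
  simp only [IsLevel, Sum.forall, fibreSum_sum_inl, fibreSum_sum_inr]
  tauto

theorem levelVol_sum (fp₁ : E₁ → P₁) (fp₂ : E₂ → P₂) (fm₁ : E₁ → M₁)
    (fm₂ : E₂ → M₂) (Lp : P₁ ⊕ P₂ → ℝ) (Lm : M₁ ⊕ M₂ → ℝ) :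
    levelVol (Sum.map fp₁ fp₂) (Sum.map fm₁ fm₂) Lp Lm =
      levelVol fp₁ fm₁ (fun i => Lp (Sum.inl i)) (fun j => Lm (Sum.inl j)) *
      levelVol fp₂ fm₂ (fun i => Lp (Sum.inr i)) (fun j => Lm (Sum.inr j)) := by
  by_cases h₁ : ∃ m₀, IsLevel fp₁ fm₁ (fun i => Lp (Sum.inl i)) (fun j => Lm (Sum.inl j)) m₀
  swap
  · rw [levelVol, levelVol, levelInt_eq_zero h₁, levelInt_eq_zero, zero_mul]
    rintro ⟨m, hm⟩
    exact h₁ ⟨_, (isLevel_sum.1 hm).1⟩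
  by_cases h₂ : ∃ m₀, IsLevel fp₂ fm₂ (fun i => Lp (Sum.inr i)) (fun j => Lm (Sum.inr j)) m₀
  swap
  · rw [levelVol, levelVol, levelVol, levelInt_eq_zero h₂, levelInt_eq_zero, mul_zero]
    rintro ⟨m, hm⟩
    exact h₂ ⟨_, (isLevel_sum.1 hm).2⟩
  obtain ⟨m₁, hm₁⟩ := h₁
  obtain ⟨m₂, hm₂⟩ := h₂
  have hm : IsLevel (Sum.map fp₁ fp₂) (Sum.map fm₁ fm₂) Lp Lm (Sum.elim m₁ m₂) :=
    isLevel_sum.2 ⟨hm₁, hm₂⟩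
  rw [levelVol, levelVol, levelVol, levelInt_eq hm measurable_posInd,
    levelInt_eq hm₁ measurable_posInd, levelInt_eq hm₂ measurable_posInd]
  refine latInt_prod _ _ _ (fun z => ?_) m₁ m₂ measurable_posInd measurable_posInd
    measurable_posInd fun m => ?_
  · rw [mem_kerLat, mem_kerLat, mem_kerLat, isLevel_sum]
    rfl
  · by_cases h1 : ∀ e, 0 < m (Sum.inl e) <;> by_cases h2 : ∀ e, 0 < m (Sum.inr e) <;>
      simp [posInd, h1, h2]

/-- The length of the marked boundary of one of the parts is determined by the other lengths. -/
theorem fibreSum_none {E P M A : Type} [Fintype E] [Fintype P] [Fintype M] [AddCommGroup A]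
    {fp : E → Option P} {fm : E → M} {Lp : P → A} {Lm : M → A} {z : E → A}
    (hp : ∀ k, fibreSum fp z (some k) = Lp k) (hm : ∀ j, fibreSum fm z j = Lm j) :
    fibreSum fp z none = ∑ j, Lm j - ∑ k, Lp k := by
  have h1 := sum_fibreSum fp z
  rw [Fintype.sum_option, ← sum_fibreSum fm z] at h1
  simp only [hp, hm] at h1
  exact eq_sub_of_add_eq h1

variable [Fintype E] {ι : Perm E} {ι₁ : Perm E₁} {ι₂ : Perm E₂} (c : Cutting ι ι₁ ι₂)
  {q : Option P₁ ⊕ Option P₂ → P} (m : M₁ ⊕ M₂ ≃ M) [Fintype P₁] [Fintype M₁]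

/-- In each part the total positive length equals the total negative length, which determines the
lengths of the two pieces of the cut boundary. Unlike the connected case there is nothing to
integrate: both affine space and lattice are products. -/
theorem levelVol_glue (hq : Glues q (Sum.inl none) (Sum.inr none))
    (s₁ : CMap (extPerm ι₁) (Option P₁) M₁)
    (s₂ : CMap (extPerm ι₂) (Option P₂) M₂) (h₁ : s₁.fp none = none) (h₂ : s₂.fp none = none)
    {Lp : P → ℝ} {Lm : M → ℝ} {x₁ x₂ : ℝ}
    (hx₁ : x₁ = ∑ j, Lm (m (Sum.inl j)) - ∑ k, Lp (q (Sum.inl (some k))))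
    (hsum : Lp (q (Sum.inl none)) = x₁ + x₂) :
    levelVol (c.glue m hq s₁ s₂ h₁ h₂).fp (c.glue m hq s₁ s₂ h₁ h₂).fm Lp Lm =
      levelVol s₁.fp s₁.fm (adjoinVar x₁ fun k => Lp (q (Sum.inl (some k))))
        (fun j => Lm (m (Sum.inl j))) *
      levelVol s₂.fp s₂.fm (adjoinVar x₂ fun k => Lp (q (Sum.inr (some k))))
        (fun j => Lm (m (Sum.inr j))) := by
  have hlev : ∀ {A : Type} [AddCommGroup A] {Lp : P → A} {Lm : M → A} {x₁ x₂ : A}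
      (_ : x₁ = ∑ j, Lm (m (Sum.inl j)) - ∑ k, Lp (q (Sum.inl (some k))))
      (_ : Lp (q (Sum.inl none)) = x₁ + x₂) {z : Option E₁ ⊕ Option E₂ → A},
      IsLevel (fun x => q (Sum.map s₁.fp s₂.fp x)) (fun x => m (Sum.map s₁.fm s₂.fm x)) Lp Lm z ↔
      IsLevel (Sum.map s₁.fp s₂.fp) (Sum.map s₁.fm s₂.fm)
        (Sum.elim (fun k => k.elim x₁ fun k => Lp (q (Sum.inl (some k))))
          (fun k => k.elim x₂ fun k => Lp (q (Sum.inr (some k))))) (fun j => Lm (m j)) z := by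
    intro A _ Lp Lm x₁ x₂ hx hs z
    have hm : IsLevel (fun x => q (Sum.map s₁.fp s₂.fp x)) (fun x => m (Sum.map s₁.fm s₂.fm x))
        Lp Lm z ↔ IsLevel (fun x => q (Sum.map s₁.fp s₂.fp x)) (Sum.map s₁.fm s₂.fm)
        Lp (fun j => Lm (m j)) z := by
      refine and_congr_right fun _ => ?_
      rw [m.forall_congr_left]
      refine forall_congr' fun j => ?_
      rw [← m.apply_symm_apply j, fibreSum_comp_injective _ m.injective]
      simp
    rw [hm, isLevel_glue (f := Sum.map s₁.fp s₂.fp) (L := Lp) hq]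
    -- The extra equation created by the cut follows from the other equations of the left part.
    · refine ⟨fun h => ⟨h, ?_⟩, fun h => h.1⟩
      rw [fibreSum_sum_inl]
      refine (fibreSum_none (fp := s₁.fp) (fm := s₁.fm) (Lp := fun k => Lp (q (Sum.inl (some k))))
        (Lm := fun j => Lm (m (Sum.inl j))) (fun k => ?_) fun j => ?_).trans hx.symm
      · rw [← fibreSum_sum_inl s₁.fp s₂.fp, ← fibreSum_glue_of_ne hq _ _ (by simp) (by simp), h.1]
      · rw [← fibreSum_sum_inl s₁.fm s₂.fm, h.2]
    · rintro (u | u) h1 h2 <;> cases u <;> simp at h1 h2 ⊢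
    · exact hs
  have h0 : levelVol (c.glue m hq s₁ s₂ h₁ h₂).fp (c.glue m hq s₁ s₂ h₁ h₂).fm Lp Lm =
      levelVol (fun x => q (Sum.map s₁.fp s₂.fp x)) (fun x => m (Sum.map s₁.fm s₂.fm x)) Lp Lm :=
    levelVol_comp_equiv c.e.symm (fun x => q (Sum.map s₁.fp s₂.fp x))
      (fun x => m (Sum.map s₁.fm s₂.fm x)) Lp Lm
  rw [h0]
  refine Eq.trans ?_ (levelVol_sum s₁.fp s₂.fp s₁.fm s₂.fm
    (Sum.elim (adjoinVar x₁ fun k => Lp (q (Sum.inl (some k))))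
      (adjoinVar x₂ fun k => Lp (q (Sum.inr (some k))))) fun j => Lm (m j))
  refine levelInt_congr_level (fun z => ?_) (fun z => hlev hx₁ hsum) measurable_posInd
  rw [hlev (A := ℤ) (x₁ := 0) (x₂ := 0) (by simp) (by simp)]
  have : (Sum.elim (fun k : Option P₁ => k.elim 0 fun k => (0 : P → ℤ) (q (Sum.inl (some k))))
      (fun k : Option P₂ => k.elim 0 fun k => (0 : P → ℤ) (q (Sum.inr (some k))))) = 0 := by
    funext k
    rcases k with k | k <;> cases k <;> rfl
  rw [this]
  rfl

theorem sum_cut_splits [Fintype P₂] [Fintype M₂] [Finite P] [Finite M] (hq : Glues q (Sum.inl none) (Sum.inr none))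
    {Lp : P → ℝ} {Lm : M → ℝ} {x₁ x₂ : ℝ}
    (hx₁ : x₁ = ∑ j, Lm (m (Sum.inl j)) - ∑ k, Lp (q (Sum.inl (some k))))
    (hsum : Lp (q (Sum.inl none)) = x₁ + x₂) :
    (∑ s : CMap (joinPerm ι) P M, if (s.fp none = q (Sum.inl none) ∧
      s.fp (some none) = q (Sum.inl none)) ∧ c.Splits q m s then levelVol s.fp s.fm Lp Lm else 0) =
      pointedVolSum ι₁ none (adjoinVar x₁ fun k => Lp (q (Sum.inl (some k))))
        (fun j => Lm (m (Sum.inl j))) *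
      pointedVolSum ι₂ none (adjoinVar x₂ fun k => Lp (q (Sum.inr (some k))))
        (fun j => Lm (m (Sum.inr j))) := by
  rw [pointedVolSum, pointedVolSum, Finset.sum_mul_sum, ← Finset.sum_product']
  have : ∀ p : CMap (extPerm ι₁) (Option P₁) M₁ × CMap (extPerm ι₂) (Option P₂) M₂,
      ((if p.1.fp none = none then levelVol p.1.fp p.1.fm
        (adjoinVar x₁ fun k => Lp (q (Sum.inl (some k)))) (fun j => Lm (m (Sum.inl j))) else 0) *
      if p.2.fp none = none then levelVol p.2.fp p.2.fm
        (adjoinVar x₂ fun k => Lp (q (Sum.inr (some k)))) (fun j => Lm (m (Sum.inr j))) else 0) =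
      if p.1.fp none = none ∧ p.2.fp none = none then
        levelVol p.1.fp p.1.fm
        (adjoinVar x₁ fun k => Lp (q (Sum.inl (some k)))) (fun j => Lm (m (Sum.inl j))) *
        levelVol p.2.fp p.2.fm
        (adjoinVar x₂ fun k => Lp (q (Sum.inr (some k)))) (fun j => Lm (m (Sum.inr j))) else 0 := by
    intro p
    by_cases h1 : p.1.fp none = none <;> by_cases h2 : p.2.fp none = none <;> simp [h1, h2]
  refine Eq.trans ?_ (Finset.sum_congr rfl fun p _ => (this p).symm.trans (by congr))
  rw [← Finset.sum_filter, ← Finset.sum_filter]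
  symm
  refine Finset.sum_bij (fun p hp => c.glue m hq p.1 p.2 (Finset.mem_filter.1 hp).2.1
    (Finset.mem_filter.1 hp).2.2) ?_ ?_ ?_ ?_
  · intro p hp
    have hp := (Finset.mem_filter.1 hp).2
    refine Finset.mem_filter.2 ⟨Finset.mem_univ _, ⟨?_, ?_⟩, c.splits_glue m hq p.1 p.2 hp.1 hp.2⟩
    · have : c.e.symm none = Sum.inl none := by rw [← c.inl_none, symm_apply_apply]
      simp [Cutting.glue, this, hp.1]
    · have : c.e.symm (some none) = Sum.inr none := by rw [← c.inr_none, symm_apply_apply]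
      simp [Cutting.glue, this, hp.2, hq.eq]
  · intro p hp p' hp' h
    obtain ⟨h1, h2⟩ := c.glue_injective m hq h
    exact Prod.ext h1 h2
  · intro s hs
    obtain ⟨⟨ha, hb⟩, hsp⟩ := (Finset.mem_filter.1 hs).2
    obtain ⟨s₁, s₂, h1, h2, h⟩ := c.exists_glue m hq s hsp ha hb
    exact ⟨(s₁, s₂), Finset.mem_filter.2 ⟨by simp, h1, h2⟩, h⟩
  · intro p hp
    exact (levelVol_glue c m hq p.1 p.2 _ _ hx₁ hsum).symm

end DisconnectedVolume

/-! ### Classification of the disconnected cuts by their two parts -/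

section Flip

open scoped Classical
open Equiv

/-- The involution exchanging the two positive half-edges of each vertex. -/
def flipPerm (V : Type) : Perm (V × Bool) := prodCongr (Equiv.refl V) boolNot

@[simp] theorem flipPerm_apply {V : Type} (v : V) (t : Bool) : flipPerm V (v, t) = (v, !t) := rfl

/-- The decomposition of the edges defined by a set of vertices. -/
noncomputable def flipCutting {V : Type} [Fintype V] [DecidableEq V] (U : Finset V) :
    Cutting (flipPerm V) (flipPerm U) (flipPerm ↥Uᶜ) where
  e := Equiv.ofBijective
    (Sum.elim (fun x => x.elim none fun p => some (some (p.1, p.2)))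
      (fun x => x.elim (some none) fun p => some (some (p.1, p.2)))) (by
      constructor
      · rintro ((_ | ⟨⟨v, hv⟩, t⟩) | (_ | ⟨⟨v, hv⟩, t⟩)) ((_ | ⟨⟨w, hw⟩, t'⟩) | (_ | ⟨⟨w, hw⟩, t'⟩)) h <;>
          simp at h ⊢ <;> try exact h
        · obtain ⟨rfl, rfl⟩ := h
          exact (Finset.mem_compl.1 hw hv).elim
        · obtain ⟨rfl, rfl⟩ := h
          exact (Finset.mem_compl.1 hv hw).elim
      · rintro (_ | _ | ⟨v, t⟩)
        · exact ⟨Sum.inl none, rfl⟩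
        · exact ⟨Sum.inr none, rfl⟩
        · by_cases hv : v ∈ U
          · exact ⟨Sum.inl (some (⟨v, hv⟩, t)), rfl⟩
          · exact ⟨Sum.inr (some (⟨v, Finset.mem_compl.2 hv⟩, t)), rfl⟩)
  inl_none := rfl
  inr_none := rfl
  map_ι := by
    rintro ((_ | ⟨⟨v, hv⟩, t⟩) | (_ | ⟨⟨v, hv⟩, t⟩)) <;> rfl

/-- A set and its complement. -/
noncomputable def finsetSumCompl {M : Type} [Fintype M] [DecidableEq M] (J : Finset M) :
    J ⊕ ↥Jᶜ ≃ M :=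
  Equiv.ofBijective (Sum.elim (fun j => j) (fun j => j)) (by
    constructor
    · rintro (⟨v, hv⟩ | ⟨v, hv⟩) (⟨w, hw⟩ | ⟨w, hw⟩) h <;> simp at h ⊢ <;> try exact h
      · subst h; exact (Finset.mem_compl.1 hw hv).elim
      · subst h; exact (Finset.mem_compl.1 hv hw).elim
    · intro v
      by_cases hv : v ∈ J
      · exact ⟨Sum.inl ⟨v, hv⟩, rfl⟩
      · exact ⟨Sum.inr ⟨v, Finset.mem_compl.2 hv⟩, rfl⟩)

/-- The labels of the two parts of a graph cut along the boundary `i`. -/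
def glueLabel {P : Type} (i : P) (I I' : Finset P) : Option I ⊕ Option I' → P :=
  Sum.elim (fun k => k.elim i fun k => k) (fun k => k.elim i fun k => k)

theorem glues_glueLabel {P : Type} [Fintype P] [DecidableEq P] {i : P} {I : Finset P}
    (hI : I ⊆ {i}ᶜ) : Glues (glueLabel i I ({i}ᶜ \ I)) (Sum.inl none) (Sum.inr none) := by
  have hi : i ∉ I := fun h => by simpa using hI h
  refine ⟨fun k => ?_, by simp, ?_⟩
  · by_cases hk : k = i
    · exact ⟨Sum.inl none, hk.symm⟩
    by_cases hkI : k ∈ I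
    · exact ⟨Sum.inl (some ⟨k, hkI⟩), rfl⟩
    · exact ⟨Sum.inr (some ⟨k, by simp [hk, hkI]⟩), rfl⟩
  · rintro ((_ | ⟨v, hv⟩) | (_ | ⟨v, hv⟩)) ((_ | ⟨w, hw⟩) | (_ | ⟨w, hw⟩)) <;> simp [glueLabel]
    all_goals
      try simp only [Finset.mem_sdiff, Finset.mem_compl, Finset.mem_singleton] at hv
      try simp only [Finset.mem_sdiff, Finset.mem_compl, Finset.mem_singleton] at hw
      rintro rfl
      tauto

theorem CMap.Reach.sameCycle {E P M : Type} {ι : Perm E} {s : CMap (joinPerm ι) P M} {u v}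
    (h : s.Reach u) (huv : s.τ.SameCycle u v) : s.Reach v := h.tail (Or.inr huv)

/-- The part of the first point contains both edges of each of its remaining vertices, so it is
described by a set of vertices. -/
theorem CMap.Reach.map_ι {E P M : Type} {ι : Perm E} {s : CMap (joinPerm ι) P M} {u}
    (h : s.Reach u) : s.Reach (extPerm (extPerm ι) u) := by
  have h1 : s.Reach ((s.τ⁻¹ * extPerm (extPerm ι)) u) := h.tail (Or.inl (sameCycle_apply _ _))
  have h2 := h1.sameCycle (sameCycle_apply s.τ _)
  rwa [Perm.mul_apply, ← Perm.mul_apply, mul_inv_cancel, Perm.one_apply] at h2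

variable {V P M : Type} [Fintype V] [Fintype P] [Fintype M] [DecidableEq V] [DecidableEq P]
  [DecidableEq M]

/-- The sets `U`, `I` and `J` are determined by the points reached from `none`; thus each
disconnected map has just one splitting type. -/
theorem splits_iff (s : CMap (joinPerm (flipPerm V)) P M) {i : P} (ha : s.fp none = i)
    (hb : s.fp (some none) = i) (U : Finset V) {I : Finset P} (hI : I ⊆ {i}ᶜ) (J : Finset M) :
    (flipCutting U).Splits (glueLabel i I ({i}ᶜ \ I)) (finsetSumCompl J) s ↔
      ¬s.Reach (some none) ∧ (∀ v, v ∈ U ↔ s.Reach (some (some (v, false)))) ∧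
      (∀ k, k ∈ I ↔ k ≠ i ∧ ∃ u, s.Reach u ∧ s.fp u = k) ∧
      (∀ j, j ∈ J ↔ ∃ u, s.Reach u ∧ s.fm u = j) := by
  have hJ : ∀ j, (((finsetSumCompl J).symm j).isLeft : Prop) ↔ j ∈ J := by
    intro j
    obtain ⟨j | j, rfl⟩ := (finsetSumCompl J).surjective j
    · rw [symm_apply_apply]
      exact iff_of_true rfl j.2
    · rw [symm_apply_apply]
      exact iff_of_false (by simp) (Finset.mem_compl.1 j.2)
  have hU : ∀ v t, (((flipCutting U).e.symm (some (some (v, t)))).isLeft : Prop) ↔ v ∈ U := by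
    intro v t
    by_cases hv : v ∈ U
    · have : some (some (v, t)) = (flipCutting U).e (Sum.inl (some (⟨v, hv⟩, t))) := rfl
      rw [this, symm_apply_apply]; simp [hv]
    · have : some (some (v, t)) =
        (flipCutting U).e (Sum.inr (some (⟨v, Finset.mem_compl.2 hv⟩, t))) := rfl
      rw [this, symm_apply_apply]; simp [hv]
  have hl : ∀ k, (∃ k', k = glueLabel i I ({i}ᶜ \ I) (Sum.inl k')) ↔ k = i ∨ k ∈ I := by
    intro k
    simp [Option.exists, glueLabel]
  have hr : ∀ k, (∃ k', k = glueLabel i I ({i}ᶜ \ I) (Sum.inr k')) ↔ k = i ∨ k ∉ I := by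
    intro k
    by_cases hk : k = i <;> simp [Option.exists, glueLabel, hk]
  have hn : (flipCutting U).e.symm none = Sum.inl none := by
    rw [← (flipCutting U).inl_none, symm_apply_apply]
  have hsn : (flipCutting U).e.symm (some none) = Sum.inr none := by
    rw [← (flipCutting U).inr_none, symm_apply_apply]
  have hi : i ∉ I := fun h => by simpa using hI h
  simp only [Cutting.Splits, hJ, hl, hr]
  constructor
  · intro h
    refine ⟨?_, fun v => ?_, fun k => ?_, fun j => ?_⟩
    · rw [(h _).1, hsn]; simp
    · rw [(h _).1, hU]
    · constructor
      · intro hk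
        refine ⟨fun h => hi (h ▸ hk), ?_⟩
        obtain ⟨u, rfl⟩ := s.isMap.1.1 k
        refine ⟨u, ?_, rfl⟩
        by_contra hu
        rcases (h u).2.2.2 hu with h1 | h1
        · exact hi (h1 ▸ hk)
        · exact h1 hk
      · rintro ⟨hk, u, hu, rfl⟩
        exact ((h u).2.2.1 hu).resolve_left hk
    · constructor
      · intro hj
        obtain ⟨u, rfl⟩ := s.isMap.2.1.1 j
        exact ⟨u, (h u).2.1.2 hj, rfl⟩
      · rintro ⟨u, hu, rfl⟩
        exact (h u).2.1.1 hu
  · rintro ⟨h1, h2, h3, h4⟩ u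
    refine ⟨?_, ?_, ?_, ?_⟩
    · rcases u with _ | _ | ⟨v, t⟩
      · rw [hn]; exact iff_of_true Relation.ReflTransGen.refl rfl
      · rw [hsn]; simpa using h1
      · rw [hU, h2]
        cases t with
        | false => rfl
        | true => exact ⟨fun h => h.map_ι, fun h => h.map_ι⟩
    · rw [h4]
      refine ⟨fun h => ⟨u, h, rfl⟩, ?_⟩
      rintro ⟨w, hw, hwu⟩
      exact hw.sameCycle ((s.isMap.2.1.2 _ _).1 hwu)
    · intro hu
      by_cases h : s.fp u = i
      · exact Or.inl h
      · exact Or.inr ((h3 _).2 ⟨h, u, hu, rfl⟩)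
    · intro hu
      by_cases h : s.fp u = i
      · exact Or.inl h
      -- A boundary other than `i` is not cut, so it lies entirely in one of the parts.
      refine Or.inr fun hI' => hu ?_
      obtain ⟨-, w, hw, hwu⟩ := (h3 _).1 hI'
      have hq := glues_glueLabel hI
      obtain ⟨f, hf, -, -, hqf⟩ := s.exists_cut hq ha hb
      refine hw.tail (Or.inl ((hf.2 _ _).1 ?_))
      rcases (hq.2.2 (f w) (f u)).1 (by rw [hqf, hqf, hwu]) with h' | ⟨-, h' | h'⟩
      · exact h'
      · exact absurd ((hqf u).symm.trans (by rw [h']; rfl)) h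
      · exact absurd ((hqf u).symm.trans (by rw [h']; rfl)) h

/-- The maps with a vertex that touches twice the positive boundary `i`, and that are disconnected
when the vertex is cut. -/
theorem sum_cut_disconnected {Lp : P → ℝ} {Lm : M → ℝ} (hsum : ∑ i, Lp i = ∑ j, Lm j) (i : P) :
    (∑ s : CMap (joinPerm (flipPerm V)) P M, if (s.fp none = i ∧ s.fp (some none) = i) ∧
      ¬s.Reach (some none) then levelVol s.fp s.fm Lp Lm else 0) =
    ∑ U : Finset V, ∑ I ∈ ({i}ᶜ : Finset P).powerset, ∑ J : Finset M,
      pointedVolSum (flipPerm U) none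
        (adjoinVar (∑ k ∈ J, Lm k - ∑ k ∈ I, Lp k) (restrictTo Lp I)) (restrictTo Lm J) *
      pointedVolSum (flipPerm ↥Uᶜ) none
        (adjoinVar (∑ k ∈ Jᶜ, Lm k - ∑ k ∈ {i}ᶜ \ I, Lp k) (restrictTo Lp ({i}ᶜ \ I)))
        (restrictTo Lm Jᶜ) := by
  -- The vertices and the uncut boundaries on the side of `none`; the sum is fibred over these data.
  let idx : CMap (joinPerm (flipPerm V)) P M → Finset V × Finset P × Finset M := fun s =>
    (Finset.univ.filter fun v => s.Reach (some (some (v, false))),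
      Finset.univ.filter fun k => k ≠ i ∧ ∃ u, s.Reach u ∧ s.fp u = k,
      Finset.univ.filter fun j => ∃ u, s.Reach u ∧ s.fm u = j)
  have hidx : ∀ s U I J, idx s = (U, I, J) ↔ (∀ v, v ∈ U ↔ s.Reach (some (some (v, false)))) ∧
      (∀ k, k ∈ I ↔ k ≠ i ∧ ∃ u, s.Reach u ∧ s.fp u = k) ∧
      (∀ j, j ∈ J ↔ ∃ u, s.Reach u ∧ s.fm u = j) := by
    intro s U I J
    simp only [idx, Prod.mk.injEq, Finset.ext_iff, Finset.mem_filter, Finset.mem_univ, true_and]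
    refine and_congr ?_ (and_congr ?_ ?_) <;> exact forall_congr' fun _ => Iff.comm
  rw [← Finset.sum_filter, ← Finset.sum_fiberwise_of_maps_to (g := idx)
    (t := Finset.univ ×ˢ ({i}ᶜ : Finset P).powerset ×ˢ Finset.univ)]
  · rw [Finset.sum_product]
    refine Finset.sum_congr rfl fun U _ => ?_
    rw [Finset.sum_product]
    refine Finset.sum_congr rfl fun I hI => Finset.sum_congr rfl fun J _ => ?_
    rw [Finset.mem_powerset] at hI
    have hi : i ∉ I := fun h => by simpa using hI h
    have hJ1 : ∑ j : J, Lm j = ∑ j ∈ J, Lm j := Finset.sum_coe_sort J Lm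
    have hI1 : ∑ k : I, Lp k = ∑ k ∈ I, Lp k := Finset.sum_coe_sort I Lp
    refine Eq.trans ?_ (sum_cut_splits (flipCutting U) (finsetSumCompl J) (glues_glueLabel hI)
      (Lp := Lp) (Lm := Lm) (x₁ := ∑ k ∈ J, Lm k - ∑ k ∈ I, Lp k)
      (x₂ := ∑ k ∈ Jᶜ, Lm k - ∑ k ∈ {i}ᶜ \ I, Lp k) ?_ ?_)
    · rw [Finset.filter_filter, Finset.sum_filter]
      refine Finset.sum_congr rfl fun s _ => ?_
      congr 1
      refine propext ?_
      change _ ↔ (s.fp none = i ∧ s.fp (some none) = i) ∧ _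
      rw [and_assoc]
      refine and_congr_right fun h => ?_
      rw [splits_iff s h.1 h.2 U hI J, hidx]
    · rw [← hJ1, ← hI1]
      rfl
    -- The two forced lengths add up to `Lp i` because the total positive and negative lengths
    -- agree.
    · change Lp i = _
      have h1 := Finset.sum_add_sum_compl J Lm
      have h2 := Finset.sum_sdiff (f := Lp) hI
      have h3 := Finset.sum_add_sum_compl {i} Lp
      rw [Finset.sum_singleton] at h3
      linarith
  · intro s _
    simp only [Finset.mem_product, Finset.mem_univ, Finset.mem_powerset, true_and, and_true]
    intro k hk
    have := (Finset.mem_filter.1 hk).2.1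
    simpa using this

end Flip


/-! ### The recursion for maps with numbered vertices -/

section Recursion

open scoped Classical
open Equiv

/-! ### The graph without vertices -/

/-- The lattice is zero, so the affine space is one point, of mass 1 for the Lebesgue measure in
dimension zero. -/
theorem levelVol_of_subsingleton {S P M : Type} [Fintype S] [Subsingleton S] [Subsingleton P]
    [Subsingleton M] (x : S) {fp : S → P} {fm : S → M} {Lp : P → ℝ} {Lm : M → ℝ}
    (h : Lp (fp x) = Lm (fm x)) (hpos : 0 < Lp (fp x)) : levelVol fp fm Lp Lm = 1 := by
  have hsum : ∀ {Q A : Type} [AddCommMonoid A] (f : S → Q) (z : S → A), fibreSum f z (f x) = z x := by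
    intro Q A _ f z
    rw [fibreSum, Fintype.sum_subsingleton _ x, if_pos rfl]
  have hlev : IsLevel fp fm Lp Lm fun _ => Lp (fp x) := by
    refine ⟨fun i => ?_, fun j => ?_⟩
    · rw [Subsingleton.elim i (fp x), hsum]
    · rw [Subsingleton.elim j (fm x), hsum, h]
  have : Subsingleton (kerLat fp fm) := by
    refine ⟨fun a b => Subtype.ext (funext fun e => ?_)⟩
    rw [Subsingleton.elim e x, ← hsum fp a.1, ← hsum fp b.1, a.2.1, b.2.1]
  rw [levelVol, levelInt_eq hlev measurable_posInd,
    latInt_eq_of_basis (Module.Basis.empty (ι := Fin 0) (kerLat fp fm)) _ measurable_posInd]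
  simp [posInd, hpos, volume_pi]

theorem pointedVolSum_of_isEmpty {E P M : Type} [Fintype E] [IsEmpty E] [Finite P] [Finite M]
    [Subsingleton P] [Subsingleton M] (ι : Perm E) {c : P} {d : M} {Lp : P → ℝ} {Lm : M → ℝ}
    (h : Lp c = Lm d) (hpos : 0 < Lp c) : pointedVolSum ι c Lp Lm = 1 := by
  have hlab : ∀ {Q : Type} [Subsingleton Q] (π : Perm (Option E)) (q : Q), IsLabel π fun _ => q := by
    intro Q _ π q
    exact ⟨fun k => ⟨none, Subsingleton.elim _ _⟩, fun x y => by
      rw [Subsingleton.elim x y]; simp [Perm.SameCycle.refl]⟩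
  let s : CMap (extPerm ι) P M := ⟨1, fun _ => c, fun _ => d, hlab _ _, hlab _ _, ⟨none⟩,
    fun x y => by rw [Subsingleton.elim x y]⟩
  rw [pointedVolSum, Fintype.sum_eq_single s]
  · rw [if_pos rfl, levelVol_of_subsingleton none h hpos]
  · intro t ht
    refine absurd (CMap.ext' ?_ ?_ ?_) ht
    · exact Equiv.ext fun x => Subsingleton.elim _ _
    · exact funext fun x => Subsingleton.elim _ _
    · exact funext fun x => Subsingleton.elim _ _

theorem pointedVolSum_of_isEmpty_eq_zero {E P M : Type} [Fintype E] [IsEmpty E] [Finite P] [Finite M]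
    (ι : Perm E) (c : P) (Lp : P → ℝ) (Lm : M → ℝ)
    (h : ¬(Subsingleton P ∧ Subsingleton M ∧ Nonempty M)) : pointedVolSum ι c Lp Lm = 0 := by
  refine Finset.sum_eq_zero fun s _ => (h ⟨?_, ?_, ⟨s.fm none⟩⟩).elim
  · exact s.isMap.1.1.subsingleton
  · exact s.isMap.2.1.1.subsingleton

/-! ### The recursion -/

/-- The labels of the positive boundaries after `i` and `j` have been merged. -/
noncomputable def joinLabel {P : Type} [Fintype P] [DecidableEq P] (i j : P) (u : P) :
    Option ↥({i, j}ᶜ : Finset P) :=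
  if h : u ∈ ({i, j}ᶜ : Finset P) then some ⟨u, h⟩ else none

/-- The labels of the positive boundaries after `i` has been cut. -/
def cutLabel {P : Type} [Fintype P] [DecidableEq P] (i : P)
    (u : Option (Option ↥({i}ᶜ : Finset P))) : P :=
  u.elim i fun v => v.elim i fun w => w

variable {P M : Type} [Fintype P] [Fintype M] [DecidableEq P] [DecidableEq M]

theorem glues_joinLabel {i j : P} (hij : i ≠ j) : Glues (joinLabel i j) i j := by
  refine ⟨?_, hij, fun u v => ?_⟩
  · rintro (_ | ⟨u, hu⟩)
    · exact ⟨i, dif_neg (by simp)⟩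
    · exact ⟨u, dif_pos hu⟩
  · have hmem : ∀ w : P, w ∈ ({i, j}ᶜ : Finset P) ↔ ¬(w = i ∨ w = j) := fun w => by
      rw [Finset.mem_compl, Finset.mem_insert, Finset.mem_singleton]
    by_cases hu : u = i ∨ u = j <;> by_cases hv : v = i ∨ v = j
    · rw [joinLabel, dif_neg (by rwa [hmem, not_not]), joinLabel,
        dif_neg (by rwa [hmem, not_not])]
      exact iff_of_true rfl (Or.inr ⟨hu, hv⟩)
    · rw [joinLabel, dif_neg (by rwa [hmem, not_not]), joinLabel, dif_pos ((hmem v).2 hv)]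
      refine iff_of_false (by simp) ?_
      rintro (rfl | h)
      exacts [hv hu, hv h.2]
    · rw [joinLabel, dif_pos ((hmem u).2 hu), joinLabel, dif_neg (by rwa [hmem, not_not])]
      refine iff_of_false (by simp) ?_
      rintro (rfl | h)
      exacts [hu hv, hu h.1]
    · rw [joinLabel, dif_pos ((hmem u).2 hu), joinLabel, dif_pos ((hmem v).2 hv)]
      simp [hu]

theorem glues_cutLabel (i : P) : Glues (cutLabel i) none (some none) := by
  refine ⟨fun u => ?_, by simp, ?_⟩
  · by_cases hu : u = i
    · exact ⟨none, hu.symm⟩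
    · exact ⟨some (some ⟨u, by simpa using hu⟩), rfl⟩
  · rintro (_ | _ | ⟨u, hu⟩) (_ | _ | ⟨v, hv⟩) <;> simp [cutLabel]
    · rintro rfl; simp at hv
    · rintro rfl; simp at hv
    · rintro rfl; simp at hu
    · rintro rfl; simp at hu

/-- The sum of the volumes of the spaces of metrics over the maps with `k` numbered vertices, whose
half-edges are distinguished. -/
noncomputable def flipVol (k : ℕ) {P M : Type} [Finite P] [Finite M] (Lp : P → ℝ) (Lm : M → ℝ) :
    ℝ≥0∞ :=
  volSum (flipPerm (Fin k)) Lp Lm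

theorem volSum_flipPerm {V P M : Type} [Fintype V] [Finite P] [Finite M] (Lp : P → ℝ) (Lm : M → ℝ) :
    volSum (flipPerm V) Lp Lm = flipVol (Fintype.card V) Lp Lm :=
  volSum_relabel (prodCongr (Fintype.equivFin V) (Equiv.refl Bool)) (fun _ => rfl) (Equiv.refl P)
    (Equiv.refl M) Lp Lm

/-- Singles out one vertex, whose two edges become `none` and `some none`. -/
theorem flipVol_succ_eq {P M : Type} [Finite P] [Finite M] (k : ℕ) (Lp : P → ℝ) (Lm : M → ℝ) :
    flipVol (k + 1) Lp Lm = volSum (joinPerm (flipPerm (Fin k))) Lp Lm := by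
  let e : Option (Option (Fin k × Bool)) ≃ Option (Fin k) × Bool :=
    { toFun := fun u => u.elim (none, false) fun v => v.elim (none, true) fun w => (some w.1, w.2)
      invFun := fun u => u.1.elim (if u.2 then some none else none) fun w => some (some (w, u.2))
      left_inv := by rintro (_ | _ | ⟨v, t⟩) <;> rfl
      right_inv := by rintro ⟨_ | v, _ | _⟩ <;> rfl }
  have h1 : flipVol (k + 1) Lp Lm = volSum (flipPerm (Option (Fin k))) Lp Lm := by
    rw [volSum_flipPerm, Fintype.card_option, Fintype.card_fin]
  rw [h1]
  refine (volSum_relabel e (fun x => ?_) (Equiv.refl P) (Equiv.refl M) Lp Lm).symm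
  rcases x with _ | _ | ⟨v, t⟩
  · simp [joinPerm, e]
  · simp [joinPerm, e]
  · have : swap (none : Option (Option (Fin k × Bool))) (some none) (some (some (v, t))) =
      some (some (v, t)) := swap_apply_of_ne_of_ne (by simp) (by simp)
    rw [joinPerm, Perm.mul_apply]
    erw [this]
    rfl

theorem flipVol_zero {P M : Type} [Finite P] [Finite M] (Lp : P → ℝ) (Lm : M → ℝ) :
    flipVol 0 Lp Lm = 0 :=
  volSum_of_isEmpty _ _ _

theorem flipVol_ne_top {P M : Type} [Finite P] [Finite M] (k : ℕ) (Lp : P → ℝ) (Lm : M → ℝ) :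
    flipVol k Lp Lm ≠ ∞ :=
  volSum_ne_top _ _ _

theorem measurable_flipVol_cut {P M : Type} [Fintype P] [Finite M] [DecidableEq P] (k : ℕ) (Lp : P → ℝ) (Lm : M → ℝ) (i : P) :
    Measurable fun x : ℝ =>
      flipVol k (adjoinVar x (adjoinVar (Lp i - x) (restrictTo Lp {i}ᶜ))) Lm := by
  refine measurable_volSum (flipPerm (Fin k)) (glues_cutLabel i) (L := Lp) Lm ?_ ?_ ?_
  · rintro x (_ | _ | u) h1 h2
    · exact absurd rfl h1
    · exact absurd rfl h2
    · rfl
  · intro x; rfl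
  · intro x; rfl

/-- The maps are sorted by the positive boundaries that meet the distinguished vertex: two distinct
ones, or one boundary with connected or disconnected complement. Ordered pairs `(i, j)` occur
because the two edges of the vertex are distinguished. -/
theorem flipVol_succ_eq_sum {k : ℕ} (hk : k ≠ 0) {Lp : P → ℝ} {Lm : M → ℝ} (hLp : ∀ i, 0 < Lp i)
    (hsum : ∑ i, Lp i = ∑ j, Lm j) :
    flipVol (k + 1) Lp Lm =
      (∑ i, ∑ j with j ≠ i, ENNReal.ofReal (Lp i + Lp j) *
        flipVol k (adjoinVar (Lp i + Lp j) (restrictTo Lp {i, j}ᶜ)) Lm) +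
      (∑ i, ∫⁻ x, ENNReal.ofReal x * (ENNReal.ofReal (Lp i - x) *
        flipVol k (adjoinVar x (adjoinVar (Lp i - x) (restrictTo Lp {i}ᶜ))) Lm)) +
      ∑ i, ∑ U : Finset (Fin k), ∑ I ∈ ({i}ᶜ : Finset P).powerset, ∑ J : Finset M,
        pointedVolSum (flipPerm U) none
          (adjoinVar (∑ k ∈ J, Lm k - ∑ k ∈ I, Lp k) (restrictTo Lp I)) (restrictTo Lm J) *
        pointedVolSum (flipPerm ↥Uᶜ) none
          (adjoinVar (∑ k ∈ Jᶜ, Lm k - ∑ k ∈ {i}ᶜ \ I, Lp k) (restrictTo Lp ({i}ᶜ \ I)))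
          (restrictTo Lm Jᶜ) := by
  have : NeZero k := ⟨hk⟩
  let A : P → P → ℝ≥0∞ := fun i j => ∑ s : CMap (joinPerm (flipPerm (Fin k))) P M,
    if s.fp none = i ∧ s.fp (some none) = j then levelVol s.fp s.fm Lp Lm else 0
  have hA : flipVol (k + 1) Lp Lm = ∑ i, ∑ j, A i j := by
    simp only [A]
    rw [flipVol_succ_eq, volSum]
    rw [Finset.sum_congr rfl fun i _ => Finset.sum_comm, Finset.sum_comm]
    refine Finset.sum_congr rfl fun s _ => ?_
    rw [Finset.sum_eq_single (s.fp none), Finset.sum_eq_single (s.fp (some none))]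
    · rw [if_pos ⟨rfl, rfl⟩]
    · exact fun j _ hj => if_neg fun h => hj h.2.symm
    · exact fun h => absurd (Finset.mem_univ _) h
    · exact fun i _ hi => Finset.sum_eq_zero fun j _ => if_neg fun h => hi h.1.symm
    · exact fun h => absurd (Finset.mem_univ _) h
  have hjoin : ∀ i j, j ≠ i → A i j = ENNReal.ofReal (Lp i + Lp j) *
      flipVol k (adjoinVar (Lp i + Lp j) (restrictTo Lp {i, j}ᶜ)) Lm := by
    intro i j hij
    refine Eq.trans (Finset.sum_congr rfl fun s _ => ?_) (sum_join (flipPerm (Fin k))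
      (glues_joinLabel hij.symm) Lm (fun u h1 h2 => ?_) ?_ (hLp i) (hLp j))
    · congr
    · have hu : u ∈ ({i, j}ᶜ : Finset P) := by simp [h1, h2]
      rw [joinLabel, dif_pos hu]
      rfl
    · rw [joinLabel, dif_neg (by simp)]
      rfl
  have hcut : ∀ i, A i i = (∫⁻ x, ENNReal.ofReal x * (ENNReal.ofReal (Lp i - x) *
        flipVol k (adjoinVar x (adjoinVar (Lp i - x) (restrictTo Lp {i}ᶜ))) Lm)) +
      ∑ s : CMap (joinPerm (flipPerm (Fin k))) P M, if (s.fp none = i ∧ s.fp (some none) = i) ∧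
      ¬s.Reach (some none) then levelVol s.fp s.fm Lp Lm else 0 := by
    intro i
    have := sum_cut_connected (flipPerm (Fin k)) (glues_cutLabel i) (L := Lp)
      (L' := fun x => adjoinVar x (adjoinVar (Lp i - x) (restrictTo Lp {i}ᶜ))) Lm (by
        rintro x (_ | _ | u) h1 h2
        · exact absurd rfl h1
        · exact absurd rfl h2
        · rfl) (fun x => rfl) (fun x => rfl)
    change _ = ∫⁻ x, ENNReal.ofReal x * (ENNReal.ofReal (Lp i - x) *
        flipVol k (adjoinVar x (adjoinVar (Lp i - x) (restrictTo Lp {i}ᶜ))) Lm) at this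
    rw [← this, ← Finset.sum_add_distrib]
    refine Finset.sum_congr rfl fun s _ => ?_
    have hc : cutLabel i none = i := rfl
    by_cases h1 : s.fp none = i ∧ s.fp (some none) = i <;> by_cases h2 : s.Reach (some none) <;>
      simp [hc, h1, h2]
  rw [hA, add_assoc, ← Finset.sum_add_distrib, ← Finset.sum_add_distrib]
  refine Finset.sum_congr rfl fun i _ => ?_
  rw [← Finset.sum_filter_add_sum_filter_not Finset.univ (fun j => j ≠ i)]
  congr 1
  · exact Finset.sum_congr rfl fun j hj => hjoin i j (Finset.mem_filter.1 hj).2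
  · have : (Finset.univ.filter fun j => ¬j ≠ i) = {i} := by ext j; simp
    rw [this, Finset.sum_singleton, hcut]
    congr 1
    refine Eq.trans (Finset.sum_congr rfl fun s _ => ?_) (sum_cut_disconnected hsum i)
    congr

end Recursion


/-! ### Parts without vertices, and division by the number of numberings -/

section Normalised

open Equiv

variable {P M : Type} [Fintype P] [Fintype M] [DecidableEq P] [DecidableEq M]

theorem pointedVolSum_flipPerm {V P M : Type} [Fintype V] [Nonempty V] [Finite P] [Finite M] (c : P)
    (Lp : P → ℝ) (Lm : M → ℝ) :
    pointedVolSum (flipPerm V) c Lp Lm = ENNReal.ofReal (Lp c) * flipVol (Fintype.card V) Lp Lm := by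
  rw [pointedVolSum_eq, volSum_flipPerm]

/-- Without vertices the part is a circle with its marked point: one edge between the cut boundary
and a single negative boundary, whose length it has. -/
theorem pointedVolSum_flipPerm_of_isEmpty {V : Type} [Fintype V] [IsEmpty V] {Lp : P → ℝ}
    {Lm : M → ℝ} (hLm : ∀ j, 0 < Lm j) (I : Finset P) (J : Finset M) :
    pointedVolSum (flipPerm V) none
      (adjoinVar (∑ k ∈ J, Lm k - ∑ k ∈ I, Lp k) (restrictTo Lp I)) (restrictTo Lm J) =
      if I = ∅ ∧ ∃ j, J = {j} then 1 else 0 := by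
  split_ifs with h
  · obtain ⟨rfl, j, rfl⟩ := h
    have h1 : Subsingleton ↥({j} : Finset M) := ⟨fun a b => Subtype.ext
      ((Finset.mem_singleton.1 a.2).trans (Finset.mem_singleton.1 b.2).symm)⟩
    have h2 : Subsingleton (Option ↥(∅ : Finset P)) := ⟨by
      rintro (_ | a) (_ | b)
      · rfl
      all_goals first | exact absurd b.2 (Finset.notMem_empty _) | exact absurd a.2 (Finset.notMem_empty _)⟩
    refine pointedVolSum_of_isEmpty (flipPerm V) (d := ⟨j, by simp⟩) ?_ ?_ <;>
      simp [adjoinVar, restrictTo, hLm]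
  · refine pointedVolSum_of_isEmpty_eq_zero _ _ _ _ fun ⟨h1, h2, h3⟩ => h ⟨?_, ?_⟩
    · refine Finset.eq_empty_of_forall_notMem fun x hx => ?_
      exact absurd (h1.elim none (some ⟨x, hx⟩)) (by simp)
    · obtain ⟨j⟩ := h3
      exact ⟨j, Finset.eq_singleton_iff_unique_mem.2 ⟨j.2, fun x hx =>
        congrArg Subtype.val (h2.elim ⟨x, hx⟩ j)⟩⟩

theorem sum_powerset_sdiff_compl {P M : Type} [Fintype M] [DecidableEq P] [DecidableEq M] {A : Type} [AddCommMonoid A] (S : Finset P)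
    (F : Finset P → Finset M → A) :
    ∑ I ∈ S.powerset, ∑ J, F (S \ I) Jᶜ = ∑ I ∈ S.powerset, ∑ J, F I J := by
  have hJ : ∀ I, ∑ J, F I Jᶜ = ∑ J, F I J := fun I =>
    Fintype.sum_bijective _ compl_bijective _ _ fun _ => rfl
  simp only [hJ]
  refine Finset.sum_bij' (fun I _ => S \ I) (fun I _ => S \ I) ?_ ?_ ?_ ?_ ?_
  · exact fun I _ => Finset.mem_powerset.2 Finset.sdiff_subset
  · exact fun I _ => Finset.mem_powerset.2 Finset.sdiff_subset
  · exact fun I hI => Finset.sdiff_sdiff_eq_self (Finset.mem_powerset.1 hI)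
  · exact fun I hI => Finset.sdiff_sdiff_eq_self (Finset.mem_powerset.1 hI)
  · exact fun I _ => rfl

theorem sum_powerset_empty_singleton {P M : Type} [Fintype M] [DecidableEq P] [DecidableEq M] (S : Finset P) (F : Finset P → Finset M → ℝ≥0∞) :
    (∑ I ∈ S.powerset, ∑ J, (if I = ∅ ∧ ∃ j, J = {j} then 1 else 0) * F I J) = ∑ j, F ∅ {j} := by
  rw [Finset.sum_eq_single ∅]
  · simp only [true_and, ite_mul, one_mul, zero_mul]
    rw [← Finset.sum_filter]
    have : (Finset.univ.filter fun J : Finset M => ∃ j, J = {j}) =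
        Finset.univ.map ⟨fun j => {j}, Finset.singleton_injective⟩ := by
      ext J
      simp [eq_comm]
    rw [this, Finset.sum_map]
    rfl
  · intro I _ hI
    refine Finset.sum_eq_zero fun J _ => ?_
    rw [if_neg fun h => hI h.1, zero_mul]
  · intro h
    simp at h

/-- The contribution of one of the two parts of a graph cut along a boundary. -/
noncomputable def partVol (Lp : P → ℝ) (Lm : M → ℝ) (a : ℕ) (I : Finset P) (J : Finset M) : ℝ≥0∞ :=
  ENNReal.ofReal (∑ k ∈ J, Lm k - ∑ k ∈ I, Lp k) *
    flipVol a (adjoinVar (∑ k ∈ J, Lm k - ∑ k ∈ I, Lp k) (restrictTo Lp I)) (restrictTo Lm J)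

theorem pointedVolSum_flipPerm_finset {V : Type} [Fintype V] {Lp : P → ℝ} {Lm : M → ℝ}
    (hLm : ∀ j, 0 < Lm j) (I : Finset P) (J : Finset M) :
    pointedVolSum (flipPerm V) none
      (adjoinVar (∑ k ∈ J, Lm k - ∑ k ∈ I, Lp k) (restrictTo Lp I)) (restrictTo Lm J) =
      (if Fintype.card V = 0 then (if I = ∅ ∧ ∃ j, J = {j} then 1 else 0) else 0) +
        partVol Lp Lm (Fintype.card V) I J := by
  split_ifs with h h'
  all_goals
    first
    | have := Fintype.card_eq_zero_iff.1 h
      rw [pointedVolSum_flipPerm_of_isEmpty hLm]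
      simp [partVol, flipVol_zero, h']
    | have := Fintype.card_pos_iff.1 (Nat.pos_of_ne_zero h)
      rw [pointedVolSum_flipPerm, zero_add]
      rfl

/-- The sets `∅` and `univ` of vertices leave a circle on one side, of length `Lm j`, while the
other side keeps all vertices and a boundary of length `Lp i - Lm j`. Both give the same sum, and
they are distinct since `k ≠ 0`; hence the factor 2. The remaining sets only matter through their
cardinality. -/
theorem sum_finset_pointedVolSum {k : ℕ} (hk : k ≠ 0) {Lp : P → ℝ} {Lm : M → ℝ}
    (hLm : ∀ j, 0 < Lm j) (hsum : ∑ i, Lp i = ∑ j, Lm j) (i : P) :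
    (∑ U : Finset (Fin k), ∑ I ∈ ({i}ᶜ : Finset P).powerset, ∑ J : Finset M,
        pointedVolSum (flipPerm U) none
          (adjoinVar (∑ k ∈ J, Lm k - ∑ k ∈ I, Lp k) (restrictTo Lp I)) (restrictTo Lm J) *
        pointedVolSum (flipPerm ↥Uᶜ) none
          (adjoinVar (∑ k ∈ Jᶜ, Lm k - ∑ k ∈ {i}ᶜ \ I, Lp k) (restrictTo Lp ({i}ᶜ \ I)))
          (restrictTo Lm Jᶜ)) =
      2 * (∑ j, ENNReal.ofReal (Lp i - Lm j) *
        flipVol k (adjoinVar (Lp i - Lm j) (restrictTo Lp {i}ᶜ)) (restrictTo Lm {j}ᶜ)) +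
      ∑ a ∈ Finset.range (k + 1), k.choose a • ∑ I ∈ ({i}ᶜ : Finset P).powerset, ∑ J : Finset M,
        partVol Lp Lm a I J * partVol Lp Lm (k - a) ({i}ᶜ \ I) Jᶜ := by
  let e : Finset P → Finset M → ℝ≥0∞ := fun I J => if I = ∅ ∧ ∃ j, J = {j} then 1 else 0
  let D : ℝ≥0∞ := ∑ j, ENNReal.ofReal (Lp i - Lm j) *
        flipVol k (adjoinVar (Lp i - Lm j) (restrictTo Lp {i}ᶜ)) (restrictTo Lm {j}ᶜ)
  let G : ℕ → ℝ≥0∞ := fun a => ∑ I ∈ ({i}ᶜ : Finset P).powerset, ∑ J : Finset M,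
        partVol Lp Lm a I J * partVol Lp Lm (k - a) ({i}ᶜ \ I) Jᶜ
  have hD : (∑ I ∈ ({i}ᶜ : Finset P).powerset, ∑ J, e I J * partVol Lp Lm k ({i}ᶜ \ I) Jᶜ) = D := by
    refine (sum_powerset_empty_singleton _ _).trans (Finset.sum_congr rfl fun j _ => ?_)
    have hx : ∑ k ∈ {j}ᶜ, Lm k - ∑ k ∈ {i}ᶜ, Lp k = Lp i - Lm j := by
      have h1 := Finset.sum_add_sum_compl {i} Lp
      have h2 := Finset.sum_add_sum_compl {j} Lm
      rw [Finset.sum_singleton] at h1 h2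
      linarith
    rw [Finset.sdiff_empty, partVol, hx]
  have hD' : (∑ I ∈ ({i}ᶜ : Finset P).powerset, ∑ J, partVol Lp Lm k I J * e ({i}ᶜ \ I) Jᶜ) = D := by
    rw [← hD, ← sum_powerset_sdiff_compl]
    refine Finset.sum_congr rfl fun I hI => Finset.sum_congr rfl fun J _ => ?_
    rw [Finset.sdiff_sdiff_eq_self (Finset.mem_powerset.1 hI), compl_compl, mul_comm]
  have hU : ∀ U : Finset (Fin k), (∑ I ∈ ({i}ᶜ : Finset P).powerset, ∑ J : Finset M,
        pointedVolSum (flipPerm U) none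
          (adjoinVar (∑ k ∈ J, Lm k - ∑ k ∈ I, Lp k) (restrictTo Lp I)) (restrictTo Lm J) *
        pointedVolSum (flipPerm ↥Uᶜ) none
          (adjoinVar (∑ k ∈ Jᶜ, Lm k - ∑ k ∈ {i}ᶜ \ I, Lp k) (restrictTo Lp ({i}ᶜ \ I)))
          (restrictTo Lm Jᶜ)) =
      (if U = ∅ then D else 0) + (if U = Finset.univ then D else 0) + G U.card := by
    intro U
    simp only [pointedVolSum_flipPerm_finset hLm, Fintype.card_coe, Finset.card_compl,
      Fintype.card_fin]
    by_cases h0 : U = ∅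
    · subst h0
      have h1 : (∅ : Finset (Fin k)) ≠ Finset.univ := by
        intro h
        have := congrArg Finset.card h
        simp at this
        exact hk this.symm
      have hz : ∀ I J, partVol Lp Lm 0 I J = 0 := fun I J => by
        rw [partVol, flipVol_zero, mul_zero]
      simp only [Finset.card_empty, if_true, if_neg h1, tsub_zero, if_neg hk, hz, add_zero,
        zero_add, G, zero_mul, Finset.sum_const_zero]
      exact hD
    by_cases h1 : U = Finset.univ
    · subst h1
      have hz : ∀ I J, partVol Lp Lm 0 I J = 0 := fun I J => by
        rw [partVol, flipVol_zero, mul_zero]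
      simp only [Finset.card_univ, Fintype.card_fin, if_true, if_neg h0, tsub_self, if_neg hk, hz,
        add_zero, zero_add, G, mul_zero, Finset.sum_const_zero]
      exact hD'
    · have h2 : U.card ≠ 0 := fun h => h0 (Finset.card_eq_zero.1 h)
      have h3 : k - U.card ≠ 0 := fun h => h1 ((Finset.card_eq_iff_eq_univ U).1
        (le_antisymm (Finset.card_le_univ U) (by rw [Fintype.card_fin]; omega)))
      simp only [if_neg h0, if_neg h1, if_neg h2, if_neg h3, zero_add, G]
  simp only [hU]
  rw [Finset.sum_add_distrib, Finset.sum_add_distrib, Finset.sum_ite_eq' Finset.univ ∅,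
    Finset.sum_ite_eq' Finset.univ Finset.univ, if_pos (Finset.mem_univ _),
    if_pos (Finset.mem_univ _), ← two_mul]
  congr 1
  rw [← Finset.powerset_univ, Finset.sum_powerset_apply_card]
  simp [G]

/-- The volume of the moduli space of metric graphs with `k` vertices. -/
noncomputable def mapVol (k : ℕ) {P M : Type} [Finite P] [Finite M] (Lp : P → ℝ) (Lm : M → ℝ) :
    ℝ≥0∞ :=
  flipVol k Lp Lm / (2 ^ k * k.factorial : ℕ)

theorem flipVol_eq (k : ℕ) {P M : Type} [Finite P] [Finite M] (Lp : P → ℝ) (Lm : M → ℝ) :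
    flipVol k Lp Lm = (2 ^ k * k.factorial : ℕ) * mapVol k Lp Lm := by
  rw [mapVol, ENNReal.mul_div_cancel]
  · exact Nat.cast_ne_zero.2 (by positivity)
  · exact ENNReal.natCast_ne_top _

theorem mapVol_ne_top (k : ℕ) {P M : Type} [Finite P] [Finite M] (Lp : P → ℝ) (Lm : M → ℝ) :
    mapVol k Lp Lm ≠ ∞ :=
  ENNReal.div_ne_top (flipVol_ne_top _ _ _) (Nat.cast_ne_zero.2 (by positivity))

theorem measurable_mapVol_cut {P M : Type} [Fintype P] [Finite M] [DecidableEq P] (k : ℕ)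
    (Lp : P → ℝ) (Lm : M → ℝ) (i : P) : Measurable fun x : ℝ =>
      mapVol k (adjoinVar x (adjoinVar (Lp i - x) (restrictTo Lp {i}ᶜ))) Lm :=
  (measurable_flipVol_cut k Lp Lm i).div_const _

/-- This is `flipVol_succ_eq_sum` divided by `2 ^ k * k!`. Boundaries of non-positive length need no
case distinction, since `ENNReal.ofReal` kills these terms. -/
theorem mapVol_succ {k : ℕ} (hk : k ≠ 0) {Lp : P → ℝ} {Lm : M → ℝ} (hLp : ∀ i, 0 < Lp i)
    (hLm : ∀ j, 0 < Lm j) (hsum : ∑ i, Lp i = ∑ j, Lm j) :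
    2 * (k + 1) * mapVol (k + 1) Lp Lm =
      2 * (∑ i, ∑ j, ENNReal.ofReal (Lp i - Lm j) *
        mapVol k (adjoinVar (Lp i - Lm j) (restrictTo Lp {i}ᶜ)) (restrictTo Lm {j}ᶜ)) +
      (∑ i, ∑ j with j ≠ i, ENNReal.ofReal (Lp i + Lp j) *
        mapVol k (adjoinVar (Lp i + Lp j) (restrictTo Lp {i, j}ᶜ)) Lm) +
      (∑ i, ∫⁻ x, ENNReal.ofReal x * (ENNReal.ofReal (Lp i - x) *
        mapVol k (adjoinVar x (adjoinVar (Lp i - x) (restrictTo Lp {i}ᶜ))) Lm)) +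
      ∑ i, ∑ a ∈ Finset.HasAntidiagonal.antidiagonal k,
        ∑ I ∈ ({i}ᶜ : Finset P).powerset, ∑ J : Finset M,
        (ENNReal.ofReal (∑ k ∈ J, Lm k - ∑ k ∈ I, Lp k) *
          mapVol a.1 (adjoinVar (∑ k ∈ J, Lm k - ∑ k ∈ I, Lp k) (restrictTo Lp I))
            (restrictTo Lm J)) *
        (ENNReal.ofReal (∑ k ∈ Jᶜ, Lm k - ∑ k ∈ {i}ᶜ \ I, Lp k) *
          mapVol a.2 (adjoinVar (∑ k ∈ Jᶜ, Lm k - ∑ k ∈ {i}ᶜ \ I, Lp k)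
            (restrictTo Lp ({i}ᶜ \ I))) (restrictTo Lm Jᶜ)) := by
  have hc0 : ((2 ^ k * k.factorial : ℕ) : ℝ≥0∞) ≠ 0 := Nat.cast_ne_zero.2 (by positivity)
  have hc1 : ((2 ^ k * k.factorial : ℕ) : ℝ≥0∞) ≠ ∞ := ENNReal.natCast_ne_top _
  refine (ENNReal.mul_right_inj hc0 hc1).1 ?_
  have h := flipVol_succ_eq_sum hk hLp hsum
  simp only [sum_finset_pointedVolSum hk hLm hsum] at h
  have hl : ((2 ^ k * k.factorial : ℕ) : ℝ≥0∞) * (2 * (k + 1) * mapVol (k + 1) Lp Lm) =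
      flipVol (k + 1) Lp Lm := by
    rw [flipVol_eq, pow_succ, Nat.factorial_succ]
    push_cast
    ring
  rw [hl, h, Finset.sum_add_distrib, ← Finset.mul_sum]
  set c : ℝ≥0∞ := ((2 ^ k * k.factorial : ℕ) : ℝ≥0∞) with hc
  have h1 : (∑ i, ∑ j with j ≠ i, ENNReal.ofReal (Lp i + Lp j) *
      flipVol k (adjoinVar (Lp i + Lp j) (restrictTo Lp {i, j}ᶜ)) Lm) =
      c * ∑ i, ∑ j with j ≠ i, ENNReal.ofReal (Lp i + Lp j) *
        mapVol k (adjoinVar (Lp i + Lp j) (restrictTo Lp {i, j}ᶜ)) Lm := by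
    simp only [Finset.mul_sum]
    refine Finset.sum_congr rfl fun i _ => Finset.sum_congr rfl fun j _ => ?_
    rw [flipVol_eq]
    ring
  have h2 : (∑ i, ∫⁻ x, ENNReal.ofReal x * (ENNReal.ofReal (Lp i - x) *
        flipVol k (adjoinVar x (adjoinVar (Lp i - x) (restrictTo Lp {i}ᶜ))) Lm)) =
      c * ∑ i, ∫⁻ x, ENNReal.ofReal x * (ENNReal.ofReal (Lp i - x) *
        mapVol k (adjoinVar x (adjoinVar (Lp i - x) (restrictTo Lp {i}ᶜ))) Lm) := by
    rw [Finset.mul_sum]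
    refine Finset.sum_congr rfl fun i _ => ?_
    rw [← lintegral_const_mul' _ _ hc1]
    refine lintegral_congr fun x => ?_
    rw [flipVol_eq]
    ring
  have h3 : (∑ i, ∑ j, ENNReal.ofReal (Lp i - Lm j) *
        flipVol k (adjoinVar (Lp i - Lm j) (restrictTo Lp {i}ᶜ)) (restrictTo Lm {j}ᶜ)) =
      c * ∑ i, ∑ j, ENNReal.ofReal (Lp i - Lm j) *
        mapVol k (adjoinVar (Lp i - Lm j) (restrictTo Lp {i}ᶜ)) (restrictTo Lm {j}ᶜ) := by
    simp only [Finset.mul_sum]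
    refine Finset.sum_congr rfl fun i _ => Finset.sum_congr rfl fun j _ => ?_
    rw [flipVol_eq]
    ring
  have h4 : ∀ i, (∑ a ∈ Finset.range (k + 1), k.choose a • ∑ I ∈ ({i}ᶜ : Finset P).powerset,
        ∑ J : Finset M, partVol Lp Lm a I J * partVol Lp Lm (k - a) ({i}ᶜ \ I) Jᶜ) =
      c * ∑ a ∈ Finset.HasAntidiagonal.antidiagonal k,
        ∑ I ∈ ({i}ᶜ : Finset P).powerset, ∑ J : Finset M,
        (ENNReal.ofReal (∑ k ∈ J, Lm k - ∑ k ∈ I, Lp k) *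
          mapVol a.1 (adjoinVar (∑ k ∈ J, Lm k - ∑ k ∈ I, Lp k) (restrictTo Lp I))
            (restrictTo Lm J)) *
        (ENNReal.ofReal (∑ k ∈ Jᶜ, Lm k - ∑ k ∈ {i}ᶜ \ I, Lp k) *
          mapVol a.2 (adjoinVar (∑ k ∈ Jᶜ, Lm k - ∑ k ∈ {i}ᶜ \ I, Lp k)
            (restrictTo Lp ({i}ᶜ \ I))) (restrictTo Lm Jᶜ)) := by
    intro i
    rw [Finset.Nat.sum_antidiagonal_eq_sum_range_succ_mk]
    simp only [Finset.mul_sum, Finset.smul_sum]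
    refine Finset.sum_congr rfl fun a ha => Finset.sum_congr rfl fun I _ =>
      Finset.sum_congr rfl fun J _ => ?_
    have hak : a ≤ k := Nat.lt_succ_iff.1 (Finset.mem_range.1 ha)
    -- The binomial coefficient, which counts the sets of `a` vertices, turns the numberings of the
    -- two parts into those of the whole.
    have hcc : c = (k.choose a : ℝ≥0∞) * ((2 ^ a * a.factorial : ℕ) *
        (2 ^ (k - a) * (k - a).factorial : ℕ)) := by
      rw [hc, ← Nat.choose_mul_factorial_mul_factorial hak]
      nth_rewrite 1 [← Nat.add_sub_cancel' hak]
      rw [pow_add]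
      push_cast
      ring
    rw [hcc, partVol, partVol, flipVol_eq, flipVol_eq, nsmul_eq_mul]
    ring
  rw [h1, h2, h3, Finset.sum_congr rfl fun i _ => h4 i, ← Finset.mul_sum]
  ring

end Normalised


/-! ### The genus of a map, from the recursion -/

section Euler

open Equiv

theorem pos_of_levelVol_ne_zero {E P M : Type} [Fintype E] [Fintype P] [Fintype M] {fp : E → P}
    {fm : E → M} (hfp : Function.Surjective fp) (hfm : Function.Surjective fm) {Lp : P → ℝ}
    {Lm : M → ℝ} (h : levelVol fp fm Lp Lm ≠ 0) :
    (∀ i, 0 < Lp i) ∧ (∀ j, 0 < Lm j) ∧ ∑ i, Lp i = ∑ j, Lm j := by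
  refine ⟨fun i => ?_, fun j => ?_, ?_⟩
  · by_contra hi
    exact h (levelVol_eq_zero_of_nonpos_left hfp (not_lt.1 hi))
  · by_contra hj
    exact h (levelVol_eq_zero_of_nonpos_right hfm (not_lt.1 hj))
  · by_contra hs
    refine h (levelVol_eq_zero fun m hm _ => hs ?_)
    rw [← Finset.sum_congr rfl fun i _ => hm.1 i, ← Finset.sum_congr rfl fun j _ => hm.2 j,
      sum_fibreSum, sum_fibreSum]

theorem exists_of_flipVol_ne_zero {k : ℕ} {P M : Type} [Finite P] [Finite M] {Lp : P → ℝ}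
    {Lm : M → ℝ} (h : flipVol k Lp Lm ≠ 0) :
    ∃ s : CMap (flipPerm (Fin k)) P M, levelVol s.fp s.fm Lp Lm ≠ 0 := by
  by_contra! hs
  exact h (Finset.sum_eq_zero fun s _ => hs s)

theorem pos_of_flipVol_ne_zero {k : ℕ} {P M : Type} [Fintype P] [Fintype M] {Lp : P → ℝ}
    {Lm : M → ℝ} (h : flipVol k Lp Lm ≠ 0) :
    (∀ i, 0 < Lp i) ∧ (∀ j, 0 < Lm j) ∧ ∑ i, Lp i = ∑ j, Lm j := by
  obtain ⟨s, hs⟩ := exists_of_flipVol_ne_zero h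
  exact pos_of_levelVol_ne_zero s.isMap.1.1 s.isMap.2.1.1 hs

theorem flipVol_ne_zero_of_mapVol {k : ℕ} {P M : Type} [Finite P] [Finite M] {Lp : P → ℝ}
    {Lm : M → ℝ} (h : mapVol k Lp Lm ≠ 0) : flipVol k Lp Lm ≠ 0 :=
  fun h' => h (by rw [mapVol, h', ENNReal.zero_div])

theorem isLabel_one_card {S Q : Type} [Fintype S] [Fintype Q] {f : S → Q} (h : IsLabel 1 f) :
    Fintype.card Q = Fintype.card S :=
  (Fintype.card_of_bijective ⟨fun x y hxy => Perm.sameCycle_one.1 ((h.2 x y).1 hxy), h.1⟩).symm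

theorem isLabel_flip_card {Q : Type} [Fintype Q] {f : Fin 1 × Bool → Q}
    (h : IsLabel (flipPerm (Fin 1)) f) : Fintype.card Q = 1 := by
  have h1 : f (0, true) = f (0, false) := by
    rw [h.2]
    exact ⟨1, rfl⟩
  refine Fintype.card_eq_one_iff.2 ⟨f (0, true), fun y => ?_⟩
  obtain ⟨⟨i, t⟩, rfl⟩ := h.1 y
  rw [Subsingleton.elim i 0]
  cases t
  · exact h1.symm
  · rfl

/-- A connected map with `k` vertices has a genus. -/
theorem exists_genus (k : ℕ) : ∀ {P M : Type} [Fintype P] [Fintype M] {Lp : P → ℝ} {Lm : M → ℝ},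
    mapVol k Lp Lm ≠ 0 → ∃ g, k + 2 = 2 * g + Fintype.card P + Fintype.card M := by
  -- Euler's relation needs no topology here: a nonzero volume forces a nonzero term in the
  -- recursion, and the genera of its pieces determine that of the whole.
  induction k using Nat.strong_induction_on with
  | _ k ih =>
  intro P M _ _ Lp Lm h
  classical
  have hf := flipVol_ne_zero_of_mapVol h
  obtain ⟨hLp, hLm, hsum⟩ := pos_of_flipVol_ne_zero hf
  rcases k with _ | _ | k
  · exact absurd (flipVol_zero _ _) hf
  · obtain ⟨s, -⟩ := exists_of_flipVol_ne_zero hf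
    refine ⟨0, ?_⟩
    -- With one vertex there are two edges. One of `τ` and `τ⁻¹ * ι` is trivial and the other is the
    -- transposition, so there are three boundaries and the genus is 0.
    have hτ : ∀ τ : Perm (Fin 1 × Bool), τ = 1 ∨ τ = flipPerm (Fin 1) := by
      intro τ
      have hx : ∀ x : Fin 1 × Bool, x = (0, false) ∨ x = (0, true) := by decide
      have hne : τ (0, false) ≠ τ (0, true) := fun h => by simpa using τ.injective h
      rcases hx (τ (0, false)) with h0 | h0 <;> rcases hx (τ (0, true)) with h1 | h1
      · exact absurd (h0.trans h1.symm) hne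
      · left
        ext1 x
        rcases hx x with rfl | rfl
        exacts [h0, h1]
      · right
        ext1 x
        rcases hx x with rfl | rfl
        exacts [h0, h1]
      · exact absurd (h0.trans h1.symm) hne
    have hp := s.isMap.1
    have hm := s.isMap.2.1
    rcases hτ s.τ with h1 | h1
    · rw [h1] at hp hm
      rw [inv_one, one_mul] at hp
      rw [isLabel_flip_card hp, isLabel_one_card hm]
      simp
    · rw [h1] at hp hm
      rw [inv_mul_cancel] at hp
      rw [isLabel_one_card hp, isLabel_flip_card hm]
      simp
  · by_contra hn
    have hz : ∀ a < k + 1 + 1, ∀ {P' M' : Type} [Fintype P'] [Fintype M'] (Lp' : P' → ℝ) (Lm' : M' → ℝ),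
        (∀ g, a + 2 = 2 * g + Fintype.card P' + Fintype.card M' →
          ∃ g, k + 1 + 1 + 2 = 2 * g + Fintype.card P + Fintype.card M) →
        mapVol a Lp' Lm' = 0 := by
      intro a ha P' M' _ _ Lp' Lm' h'
      by_contra hne
      obtain ⟨g, hg⟩ := ih a ha hne
      exact hn (h' g hg)
    have hcard1 : ∀ i : P, ({i}ᶜ : Finset P).card + 1 = Fintype.card P := fun i => by
      have := Finset.card_add_card_compl {i}
      rw [Finset.card_singleton] at this
      omega
    have hcard1' : ∀ j : M, ({j}ᶜ : Finset M).card + 1 = Fintype.card M := fun i => by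
      have := Finset.card_add_card_compl {i}
      rw [Finset.card_singleton] at this
      omega
    have hrec := mapVol_succ (k := k + 1) (by omega) hLp hLm hsum
    have e1 : (∑ i, ∑ j, ENNReal.ofReal (Lp i - Lm j) *
        mapVol (k + 1) (adjoinVar (Lp i - Lm j) (restrictTo Lp {i}ᶜ)) (restrictTo Lm {j}ᶜ)) = 0 := by
      refine Finset.sum_eq_zero fun i _ => Finset.sum_eq_zero fun j _ => ?_
      rw [hz _ (by omega), mul_zero]
      intro g hg
      rw [Fintype.card_option, Fintype.card_coe, Fintype.card_coe] at hg
      have h1 := hcard1 i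
      have h2 := hcard1' j
      exact ⟨g, by omega⟩
    have e2 : (∑ i, ∑ j with j ≠ i, ENNReal.ofReal (Lp i + Lp j) *
        mapVol (k + 1) (adjoinVar (Lp i + Lp j) (restrictTo Lp {i, j}ᶜ)) Lm) = 0 := by
      refine Finset.sum_eq_zero fun i _ => Finset.sum_eq_zero fun j hj => ?_
      rw [hz _ (by omega), mul_zero]
      intro g hg
      rw [Fintype.card_option, Fintype.card_coe] at hg
      have h1 := Finset.card_add_card_compl {i, j}
      rw [Finset.card_pair (Finset.mem_filter.1 hj).2.symm] at h1
      exact ⟨g, by omega⟩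
    have e3 : (∑ i, ∫⁻ x, ENNReal.ofReal x * (ENNReal.ofReal (Lp i - x) *
        mapVol (k + 1) (adjoinVar x (adjoinVar (Lp i - x) (restrictTo Lp {i}ᶜ))) Lm)) = 0 := by
      refine Finset.sum_eq_zero fun i _ => ?_
      rw [lintegral_congr (g := fun _ => 0), lintegral_zero]
      intro x
      rw [hz _ (by omega), mul_zero, mul_zero]
      intro g hg
      rw [Fintype.card_option, Fintype.card_option, Fintype.card_coe] at hg
      have h1 := hcard1 i
      -- The connected cut adds a boundary and removes a vertex, so it lowers the genus by one.
      exact ⟨g + 1, by omega⟩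
    have e4 : (∑ i, ∑ a ∈ Finset.HasAntidiagonal.antidiagonal (k + 1),
        ∑ I ∈ ({i}ᶜ : Finset P).powerset, ∑ J : Finset M,
        (ENNReal.ofReal (∑ k ∈ J, Lm k - ∑ k ∈ I, Lp k) *
          mapVol a.1 (adjoinVar (∑ k ∈ J, Lm k - ∑ k ∈ I, Lp k) (restrictTo Lp I))
            (restrictTo Lm J)) *
        (ENNReal.ofReal (∑ k ∈ Jᶜ, Lm k - ∑ k ∈ {i}ᶜ \ I, Lp k) *
          mapVol a.2 (adjoinVar (∑ k ∈ Jᶜ, Lm k - ∑ k ∈ {i}ᶜ \ I, Lp k)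
            (restrictTo Lp ({i}ᶜ \ I))) (restrictTo Lm Jᶜ))) = 0 := by
      refine Finset.sum_eq_zero fun i _ => Finset.sum_eq_zero fun a ha =>
        Finset.sum_eq_zero fun I hI => Finset.sum_eq_zero fun J _ => ?_
      have ha := Finset.HasAntidiagonal.mem_antidiagonal.1 ha
      by_contra hne
      rw [mul_eq_zero, mul_eq_zero, mul_eq_zero, not_or, not_or, not_or] at hne
      obtain ⟨g₁, h₁⟩ := ih a.1 (by omega) hne.1.2
      obtain ⟨g₂, h₂⟩ := ih a.2 (by omega) hne.2.2
      rw [Fintype.card_option, Fintype.card_coe, Fintype.card_coe] at h₁ h₂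
      have h1 := Finset.card_add_card_compl J
      have h2 := Finset.card_sdiff_add_card_eq_card (Finset.mem_powerset.1 hI)
      have h3 := hcard1 i
      exact hn ⟨g₁ + g₂, by omega⟩
    rw [e1, e2, e3, e4] at hrec
    simp only [mul_zero, add_zero] at hrec
    refine h ((mul_eq_zero.1 hrec).resolve_left (mul_ne_zero two_ne_zero ?_))
    exact_mod_cast (Nat.succ_ne_zero (k + 1))

end Euler


/-! ### Ribbon graphs with numbered half-edges -/

section Framings

open Equiv

/-- The permutation of `E × Bool` acting as `σ` on the first copy of `E` and as `τ` on the second. -/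
def boolPerm {E : Type} (σ τ : Perm E) : Perm (E × Bool) where
  toFun p := (cond p.2 σ τ p.1, p.2)
  invFun p := ((cond p.2 σ τ).symm p.1, p.2)
  left_inv p := by simp
  right_inv p := by simp

@[simp] theorem boolPerm_apply {E : Type} (σ τ : Perm E) (e : E) (t : Bool) :
    boolPerm σ τ (e, t) = (cond t σ τ e, t) := rfl

theorem sameCycle_boolPerm {E : Type} (σ τ : Perm E) (e e' : E) (t t' : Bool) :
    (boolPerm σ τ).SameCycle (e, t) (e', t') ↔ t = t' ∧ (cond t σ τ).SameCycle e e' := by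
  constructor
  · intro h
    refine sameCycle_induct (r := fun p p' : E × Bool => p.2 = p'.2 ∧
      (cond p.2 σ τ).SameCycle p.1 p'.1) ⟨fun p => ⟨rfl, Perm.SameCycle.refl _ _⟩, ?_, ?_⟩ ?_ h
    · rintro ⟨e, t⟩ ⟨e', t'⟩ ⟨rfl, h⟩
      exact ⟨rfl, h.symm⟩
    · rintro ⟨e, t⟩ ⟨e', t'⟩ ⟨e'', t''⟩ ⟨rfl, h⟩ ⟨rfl, h'⟩
      exact ⟨rfl, h.trans h'⟩
    · exact fun p => ⟨rfl, sameCycle_apply _ _⟩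
  · rintro ⟨rfl, h⟩
    exact sameCycle_induct (r := fun e e' => (boolPerm σ τ).SameCycle (e, t) (e', t))
      ((sameCycle_equivalence _).comap fun e => (e, t))
      (fun e => sameCycle_apply (boolPerm σ τ) (e, t)) h

variable {X P M E : Type}

namespace OrientedRibbonGraph

theorem s2_s0 (R : OrientedRibbonGraph X P M) (x : X) : R.s2 (R.s0 x) = R.s1 x := by simp [s2]

theorem isLabel_face (R : OrientedRibbonGraph X P M) : IsLabel R.s2 R.face := by
  constructor
  · intro β
    obtain ⟨q, rfl⟩ := R.label.surjective β
    obtain ⟨x, rfl⟩ := Quotient.exists_rep q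
    exact ⟨x, rfl⟩
  · intro x y
    rw [face, face, R.label.injective.eq_iff]
    exact Quotient.eq

theorem sign_eq_one_iff (R : OrientedRibbonGraph X P M) (x : X) :
    R.sign x = 1 ↔ (R.face x).isLeft := R.label_sign x

theorem IsIso.map_s2 {R R' : OrientedRibbonGraph X P M} {ψ : Perm X} (h : R.IsIso R' ψ) (x : X) :
    ψ (R.s2 x) = R'.s2 (ψ x) := by
  obtain ⟨y, rfl⟩ := R.s0.surjective x
  rw [s2_s0, h.map_s0, s2_s0, h.map_s1]

theorem isIso_of_map_s2 {R R' : OrientedRibbonGraph X P M} {ψ : Perm X}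
    (h1 : ∀ x, ψ (R.s1 x) = R'.s1 (ψ x)) (h2 : ∀ x, ψ (R.s2 x) = R'.s2 (ψ x))
    (h3 : ∀ x, R'.sign (ψ x) = R.sign x) (h4 : ∀ x, R'.face (ψ x) = R.face x) : R.IsIso R' ψ := by
  refine ⟨fun x => ?_, h1, h3, h4⟩
  apply R'.s2.injective
  rw [s2_s0, ← h2, s2_s0, h1]

end OrientedRibbonGraph

/-- The half-edges of `R` are numbered so that `R` is the ribbon graph defined by `s`. -/
structure IsFraming {ι : Perm E} (s : CMap ι P M) (R : OrientedRibbonGraph X P M)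
    (φ : E × Bool ≃ X) : Prop where
  map_s1 : ∀ e t, R.s1 (φ (e, t)) = φ (e, !t)
  map_s2 : ∀ p, R.s2 (φ p) = φ (boolPerm (s.τ⁻¹ * ι) s.τ p)
  sign_eq : ∀ e t, R.sign (φ (e, t)) = cond t 1 (-1)
  face_eq : ∀ e t, R.face (φ (e, t)) = cond t (Sum.inl (s.fp e)) (Sum.inr (s.fm e))

variable {ι : Perm E}

theorem IsFraming.eq {s s' : CMap ι P M} {R : OrientedRibbonGraph X P M} {φ : E × Bool ≃ X}
    (h : IsFraming s R φ) (h' : IsFraming s' R φ) : s = s' := by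
  refine CMap.ext' (Equiv.ext fun e => ?_) (funext fun e => ?_) (funext fun e => ?_)
  · have := (h.map_s2 (e, false)).symm.trans (h'.map_s2 (e, false))
    simpa using this
  · have := (h.face_eq e true).symm.trans (h'.face_eq e true)
    simpa using this
  · have := (h.face_eq e false).symm.trans (h'.face_eq e false)
    simpa using this

theorem IsFraming.trans {s : CMap ι P M} {R R' : OrientedRibbonGraph X P M} {φ : E × Bool ≃ X}
    (h : IsFraming s R φ) {ψ : Perm X} (hψ : R.IsIso R' ψ) : IsFraming s R' (φ.trans ψ) where
  map_s1 e t := by rw [trans_apply, ← hψ.map_s1, h.map_s1]; rfl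
  map_s2 p := by rw [trans_apply, ← hψ.map_s2, h.map_s2]; rfl
  sign_eq e t := by rw [trans_apply, hψ.map_sign, h.sign_eq]
  face_eq e t := by rw [trans_apply, hψ.map_face, h.face_eq]

theorem IsFraming.isIso {s : CMap ι P M} {R R' : OrientedRibbonGraph X P M} {φ φ' : E × Bool ≃ X}
    (h : IsFraming s R φ) (h' : IsFraming s R' φ') : R.IsIso R' (φ.symm.trans φ') := by
  refine OrientedRibbonGraph.isIso_of_map_s2 ?_ ?_ ?_ ?_ <;>
    (intro x; obtain ⟨⟨e, t⟩, rfl⟩ := φ.surjective x)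
  · simp [h.map_s1, h'.map_s1]
  · simp only [trans_apply, symm_apply_apply]
    rw [h.map_s2, h'.map_s2, symm_apply_apply]
  · simp [h.sign_eq, h'.sign_eq]
  · simp [h.face_eq, h'.face_eq]

/-- The framings of `R` by a given map are a torsor under the automorphisms of `R`. -/
def IsFraming.equivAut {s : CMap ι P M} {R : OrientedRibbonGraph X P M} {φ : E × Bool ≃ X}
    (h : IsFraming s R φ) : {φ' : E × Bool ≃ X // IsFraming s R φ'} ≃ R.Aut where
  toFun φ' := ⟨φ.symm.trans φ'.1, h.isIso φ'.2⟩
  invFun ψ := ⟨φ.trans ψ.1, h.trans ψ.2⟩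
  left_inv φ' := Subtype.ext (Equiv.ext fun x => by simp)
  right_inv ψ := Subtype.ext (Equiv.ext fun x => by simp)

/-! ### The ribbon graph of a map -/

/-- The period divides 4 and does not divide 2. -/
theorem nat_card_sameCycle_eq_four [Finite X] (π : Perm X) (x : X) :
    Nat.card {y // π.SameCycle x y} = 4 ↔ (π (π (π (π x))) = x ∧ π (π x) ≠ x) := by
  have h1 : Nat.card {y // π.SameCycle x y} = Function.minimalPeriod π x := by
    have h2 : {y | π.SameCycle x y} = MulAction.orbit (Subgroup.zpowers π) x := by
      ext y
      constructor
      · rintro ⟨n, rfl⟩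
        exact ⟨⟨π ^ n, n, rfl⟩, rfl⟩
      · rintro ⟨⟨_, n, rfl⟩, rfl⟩
        exact ⟨n, rfl⟩
    have : Fintype (MulAction.orbit (Subgroup.zpowers π) x) := Fintype.ofFinite _
    have h3 := MulAction.minimalPeriod_eq_card (a := π) (b := x)
    change Nat.card ({y | π.SameCycle x y} : Set X) = _
    rw [h2, Nat.card_eq_fintype_card, ← h3]
    rfl
  rw [h1]
  have hp4 : π (π (π (π x))) = x ↔ Function.minimalPeriod π x ∣ 4 :=
    (Function.isPeriodicPt_iff_minimalPeriod_dvd (f := π) (n := 4))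
  have hp2 : π (π x) = x ↔ Function.minimalPeriod π x ∣ 2 :=
    (Function.isPeriodicPt_iff_minimalPeriod_dvd (f := π) (n := 2))
  rw [hp4, Ne, hp2]
  constructor
  · intro h
    rw [h]
    norm_num
  · rintro ⟨h4, h2⟩
    have : Function.minimalPeriod π x ≤ 4 := Nat.le_of_dvd (by norm_num) h4
    interval_cases Function.minimalPeriod π x <;> simp_all

/-- The vertex permutation is forced to be `t2⁻¹ * t1`. It exchanges the signs, and its square is
`ι` on positive half-edges and a conjugate of `ι` on negative ones; so the hypotheses on `ι` are
what makes all vertices four-valent. -/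
theorem exists_isFraming [Finite X] (hι : ∀ e, ι (ι e) = e) (hι' : ∀ e, ι e ≠ e) (s : CMap ι P M)
    (φ : E × Bool ≃ X) : ∃ R : OrientedRibbonGraph X P M, IsFraming s R φ := by
  let t1 : Perm X := φ.permCongr (flipPerm E)
  let t2 : Perm X := φ.permCongr (boolPerm (s.τ⁻¹ * ι) s.τ)
  let t0 : Perm X := t2⁻¹ * t1
  have ht1 : ∀ e t, t1 (φ (e, t)) = φ (e, !t) := fun e t => by simp [t1]
  have ht2 : ∀ p, t2 (φ p) = φ (boolPerm (s.τ⁻¹ * ι) s.τ p) := fun p => by simp [t2]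
  have ht2' : t1 * t0⁻¹ = t2 := by
    simp [t0]
  have ht0t : ∀ e, t0 (φ (e, true)) = φ (s.τ⁻¹ e, false) := by
    intro e
    rw [Perm.mul_apply, ht1, Perm.inv_eq_iff_eq, ht2]
    simp
  have ht0f : ∀ e, t0 (φ (e, false)) = φ (ι (s.τ e), true) := by
    intro e
    rw [Perm.mul_apply, ht1, Perm.inv_eq_iff_eq, ht2]
    simp [hι]
  let face : X → P ⊕ M := fun x =>
    cond (φ.symm x).2 (Sum.inl (s.fp (φ.symm x).1)) (Sum.inr (s.fm (φ.symm x).1))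
  have hface : ∀ e t, face (φ (e, t)) = cond t (Sum.inl (s.fp e)) (Sum.inr (s.fm e)) :=
    fun e t => by simp [face]
  have hlabel : IsLabel t2 face := by
    constructor
    · rintro (i | j)
      · obtain ⟨e, rfl⟩ := s.isMap.1.1 i
        exact ⟨φ (e, true), hface _ _⟩
      · obtain ⟨e, rfl⟩ := s.isMap.2.1.1 j
        exact ⟨φ (e, false), hface _ _⟩
    · intro x y
      obtain ⟨⟨e, t⟩, rfl⟩ := φ.surjective x
      obtain ⟨⟨e', t'⟩, rfl⟩ := φ.surjective y
      rw [hface, hface, sameCycle_permCongr φ ht2, sameCycle_boolPerm]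
      cases t <;> cases t' <;> simp [s.isMap.1.2, s.isMap.2.1.2]
  let lab : Quotient (Perm.SameCycle.setoid (t1 * t0⁻¹)) ≃ P ⊕ M :=
    Equiv.ofBijective (Quotient.lift face fun x y hxy => by
      rw [ht2'] at hxy
      exact (hlabel.2 x y).2 hxy) (by
      constructor
      · intro p q
        induction p using Quotient.ind
        induction q using Quotient.ind
        intro h
        refine Quotient.sound ?_
        change (t1 * t0⁻¹).SameCycle _ _
        rw [ht2']
        exact (hlabel.2 _ _).1 h
      · intro β
        obtain ⟨x, rfl⟩ := hlabel.1 β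
        exact ⟨Quotient.mk _ x, rfl⟩)
  -- The closure contains `t1`, which exchanges the sides of an edge, and `t2`, which turns around
  -- boundaries; `IsLinked` provides a path alternating these moves.
  have hconn : ∀ x y, ∃ w ∈ Subgroup.closure {t0, t1}, w x = y := by
    let r : X → X → Prop := fun x y => ∃ w ∈ Subgroup.closure {t0, t1}, w x = y
    have hr : Equivalence r := by
      refine ⟨fun x => ⟨1, Subgroup.one_mem _, rfl⟩, ?_, ?_⟩
      · rintro x y ⟨w, hw, rfl⟩
        exact ⟨w⁻¹, Subgroup.inv_mem _ hw, by simp⟩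
      · rintro x y z ⟨w, hw, rfl⟩ ⟨w', hw', rfl⟩
        exact ⟨w' * w, Subgroup.mul_mem _ hw' hw, rfl⟩
    have h0 : t0 ∈ Subgroup.closure {t0, t1} := Subgroup.subset_closure (by simp)
    have h1 : t1 ∈ Subgroup.closure {t0, t1} := Subgroup.subset_closure (by simp)
    have h2 : t2 ∈ Subgroup.closure {t0, t1} := by
      rw [← ht2']
      exact Subgroup.mul_mem _ h1 (Subgroup.inv_mem _ h0)
    have hr1 : ∀ e t t', r (φ (e, t)) (φ (e, t')) := by
      intro e t t'
      by_cases h : t = t'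
      · rw [h]; exact hr.refl _
      · refine ⟨t1, h1, ?_⟩
        rw [ht1]
        cases t <;> cases t' <;> simp_all
    have hr2 : ∀ x y, t2.SameCycle x y → r x y := fun x y h =>
      sameCycle_induct hr (fun x => ⟨t2, h2, rfl⟩) h
    have hE : ∀ e e', r (φ (e, true)) (φ (e', true)) := by
      intro e e'
      induction s.isMap.2.2.2 e e' with
      | refl => exact hr.refl _
      | tail _ hbc ih =>
        refine hr.trans ih ?_
        rcases hbc with hbc | hbc
        · refine hr2 _ _ ((hlabel.2 _ _).1 ?_)
          simp [hface, hbc]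
        · refine hr.trans (hr1 _ true false) (hr.trans ?_ (hr1 _ false true))
          refine hr2 _ _ ((hlabel.2 _ _).1 ?_)
          simp [hface, hbc]
    intro x y
    obtain ⟨⟨e, t⟩, rfl⟩ := φ.surjective x
    obtain ⟨⟨e', t'⟩, rfl⟩ := φ.surjective y
    exact hr.trans (hr1 e t true) (hr.trans (hE e e') (hr1 e' true t'))
  obtain ⟨e₀⟩ := s.isMap.2.2.1
  let R : OrientedRibbonGraph X P M :=
    { s0 := t0
      s1 := t1
      s1_invol := fun x => by
        obtain ⟨⟨e, t⟩, rfl⟩ := φ.surjective x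
        simp [ht1]
      s1_ne := fun x => by
        obtain ⟨⟨e, t⟩, rfl⟩ := φ.surjective x
        simp [ht1]
      nonempty := ⟨φ (e₀, true)⟩
      connected := hconn
      fourValent := fun x => by
        rw [nat_card_sameCycle_eq_four]
        obtain ⟨⟨e, t⟩, rfl⟩ := φ.surjective x
        cases t
        · simp [ht0t, ht0f, hι, Equiv.symm_apply_eq, hι']
        · simp [ht0t, ht0f, hι, hι']
      sign := fun x => cond (φ.symm x).2 1 (-1)
      sign_s1 := fun x => by
        obtain ⟨⟨e, t⟩, rfl⟩ := φ.surjective x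
        rw [ht1]
        cases t <;> simp
      sign_s2 := fun x => by
        obtain ⟨⟨e, t⟩, rfl⟩ := φ.surjective x
        rw [ht2', ht2]
        simp
      label := lab
      label_sign := fun x => by
        obtain ⟨⟨e, t⟩, rfl⟩ := φ.surjective x
        change _ ↔ (face (φ (e, t))).isLeft
        rw [hface]
        cases t
        · simp only [symm_apply_apply, cond_false]
          exact iff_of_false (by decide) (by simp)
        · simp }
  exact ⟨R, ht1, fun p => by
    change (t1 * t0⁻¹) (φ p) = _
    rw [ht2', ht2], fun e t => by simp [R], hface⟩

end Framings


/-! ### Counting the numberings of a ribbon graph -/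

section Frames

open Equiv

variable {X P M E : Type} {ι : Perm E}

/-- The positive half-edges of `R` are numbered compatibly with `ι`. -/
structure IsFrame (ι : Perm E) (R : OrientedRibbonGraph X P M) (φ : E × Bool ≃ X) : Prop where
  map_s1 : ∀ e t, R.s1 (φ (e, t)) = φ (e, !t)
  sign_eq : ∀ e, R.sign (φ (e, true)) = 1
  map_s0 : ∀ e, R.s0 (R.s0 (φ (e, true))) = φ (ι e, true)

theorem IsFraming.isFrame (hι : ∀ e, ι (ι e) = e) {s : CMap ι P M} {R : OrientedRibbonGraph X P M}
    {φ : E × Bool ≃ X} (h : IsFraming s R φ) : IsFrame ι R φ where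
  map_s1 := h.map_s1
  sign_eq e := h.sign_eq e true
  map_s0 e := by
    have h1 : ∀ e t, R.s0 (φ (e, t)) = φ ((boolPerm (s.τ⁻¹ * ι) s.τ)⁻¹ (e, !t)) := by
      intro e t
      apply R.s2.injective
      rw [R.s2_s0, h.map_s1, h.map_s2]
      simp
    have h2 : (boolPerm (s.τ⁻¹ * ι) s.τ)⁻¹ (e, false) = (s.τ⁻¹ e, false) := by
      rw [Perm.inv_eq_iff_eq]; simp
    have h3 : (boolPerm (s.τ⁻¹ * ι) s.τ)⁻¹ (s.τ⁻¹ e, true) = (ι e, true) := by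
      rw [Perm.inv_eq_iff_eq]; simp [hι]
    rw [h1]
    change R.s0 (φ ((boolPerm (s.τ⁻¹ * ι) s.τ)⁻¹ (e, false))) = _
    rw [h2, h1]
    change φ ((boolPerm (s.τ⁻¹ * ι) s.τ)⁻¹ (s.τ⁻¹ e, true)) = _
    rw [h3]

namespace OrientedRibbonGraph

theorem sign_s0 (R : OrientedRibbonGraph X P M) (x : X) : R.sign (R.s0 x) = -R.sign x := by
  rw [← R.sign_s1, ← R.s2_s0]
  exact (R.sign_s2 _).symm

theorem s0_four [Finite X] (R : OrientedRibbonGraph X P M) (x : X) :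
    R.s0 (R.s0 (R.s0 (R.s0 x))) = x := ((nat_card_sameCycle_eq_four _ _).1 (R.fourValent x)).1

theorem s0_two_ne [Finite X] (R : OrientedRibbonGraph X P M) (x : X) :
    R.s0 (R.s0 x) ≠ x := ((nat_card_sameCycle_eq_four _ _).1 (R.fourValent x)).2

end OrientedRibbonGraph

theorem IsFrame.sign {R : OrientedRibbonGraph X P M}
    {φ : E × Bool ≃ X} (h : IsFrame ι R φ) (e : E) (t : Bool) :
    R.sign (φ (e, t)) = cond t 1 (-1) := by
  cases t
  · rw [← Bool.not_true, ← h.map_s1, R.sign_s1, h.sign_eq]; rfl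
  · exact h.sign_eq e

theorem IsFrame.snd_eq_iff {R : OrientedRibbonGraph X P M}
    {φ : E × Bool ≃ X} (h : IsFrame ι R φ) (x y : X) :
    (φ.symm x).2 = (φ.symm y).2 ↔ R.sign x = R.sign y := by
  obtain ⟨⟨e, t⟩, rfl⟩ := φ.surjective x
  obtain ⟨⟨e', t'⟩, rfl⟩ := φ.surjective y
  rw [h.sign, h.sign, symm_apply_apply, symm_apply_apply]
  cases t <;> cases t' <;> simp

/-- Each generator moves a half-edge to one whose edge is equal or linked, so the transitivity of
the group generated by `s0` and `s1` descends to the edges. -/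
theorem isLinked_of_ribbon {R : OrientedRibbonGraph X P M} {φ : E × Bool ≃ X} {σ τ : Perm E}
    {fp : E → P} {fm : E → M} (hs1 : ∀ e t, R.s1 (φ (e, t)) = φ (e, !t))
    (hs2φ : ∀ p, R.s2 (φ p) = φ (boolPerm σ τ p)) (hfp : ∀ e, R.face (φ (e, true)) = Sum.inl (fp e))
    (hfm : ∀ e, R.face (φ (e, false)) = Sum.inr (fm e)) : IsLinked fp fm := by
  let r : E → E → Prop := Relation.ReflTransGen fun a b => fp a = fp b ∨ fm a = fm b
  have hr : Equivalence r := by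
    refine ⟨fun _ => .refl, fun {x y} hxy => ?_, fun hxy hyz => hxy.trans hyz⟩
    refine Relation.reflTransGen_swap.1 (Relation.ReflTransGen.mono (fun x y hxy => ?_) _ _ hxy)
    exact hxy.imp Eq.symm Eq.symm
  have h1 : ∀ x, r (φ.symm x).1 (φ.symm (R.s1 x)).1 := by
    intro x
    obtain ⟨⟨e, t⟩, rfl⟩ := φ.surjective x
    rw [hs1, symm_apply_apply, symm_apply_apply]
  have h2 : ∀ x, r (φ.symm x).1 (φ.symm (R.s2 x)).1 := by
    intro x
    have hx : R.face (R.s2 x) = R.face x :=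
      ((R.isLabel_face.2 _ _).2 (sameCycle_apply _ _)).symm
    obtain ⟨⟨e, t⟩, rfl⟩ := φ.surjective x
    rw [hs2φ] at hx ⊢
    rw [symm_apply_apply, symm_apply_apply]
    cases t
    · refine .single (Or.inr (Sum.inr_injective (α := P) ?_))
      rw [← hfm, ← hfm]
      exact hx.symm
    · refine .single (Or.inl (Sum.inl_injective (β := M) ?_))
      rw [← hfp, ← hfp]
      exact hx.symm
  have h0 : ∀ x, r (φ.symm x).1 (φ.symm (R.s0 x)).1 := by
    intro x
    have := h2 (R.s0 x)
    rw [R.s2_s0] at this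
    exact hr.trans (h1 x) (hr.symm this)
  have hw : ∀ w ∈ Subgroup.closure {R.s0, R.s1}, ∀ x, r (φ.symm x).1 (φ.symm (w x)).1 := by
    intro w hw
    induction hw using Subgroup.closure_induction with
    | mem w hw =>
      rcases hw with rfl | rfl
      exacts [h0, h1]
    | one => exact fun x => hr.refl _
    | mul w w' _ _ h h' => exact fun x => hr.trans (h' x) (h _)
    | inv w _ h =>
      intro x
      have := h (w⁻¹ x)
      rw [← Perm.mul_apply, mul_inv_cancel, Perm.one_apply] at this
      exact hr.symm this
  obtain ⟨x₀⟩ := R.nonempty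
  refine ⟨⟨(φ.symm x₀).1⟩, fun e e' => ?_⟩
  obtain ⟨w, hwm, hwe⟩ := R.connected (φ (e, true)) (φ (e', true))
  have := hw w hwm (φ (e, true))
  rw [hwe] at this
  rwa [symm_apply_apply, symm_apply_apply] at this

/-- Signs are constant along boundaries, so `s2` consists of a permutation of the positive
half-edges and a permutation `τ` of the negative ones. -/
theorem IsFrame.exists_isFraming {R : OrientedRibbonGraph X P M} [Finite X]
    {φ : E × Bool ≃ X} (hι : ∀ e, ι (ι e) = e) (h : IsFrame ι R φ) :
    ∃ s : CMap ι P M, IsFraming s R φ := by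
  have hs2 : ∀ x, (φ.symm (R.s2 x)).2 = (φ.symm x).2 := fun x =>
    (h.snd_eq_iff _ _).2 (R.sign_s2 x)
  have hs2' : ∀ x, (φ.symm (R.s2.symm x)).2 = (φ.symm x).2 := fun x => by
    rw [← hs2, apply_symm_apply]
  have hφ : ∀ x t, (φ.symm x).2 = t → φ ((φ.symm x).1, t) = x := by
    rintro x t rfl
    exact φ.apply_symm_apply x
  let τ : Perm E :=
    { toFun := fun e => (φ.symm (R.s2 (φ (e, false)))).1
      invFun := fun e => (φ.symm (R.s2.symm (φ (e, false)))).1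
      left_inv := fun e => by
        dsimp only
        rw [hφ _ _ (by rw [hs2]; simp), symm_apply_apply, symm_apply_apply]
      right_inv := fun e => by
        dsimp only
        rw [hφ _ _ (by rw [hs2']; simp), apply_symm_apply, symm_apply_apply] }
  have hτ : ∀ e, R.s2 (φ (e, false)) = φ (τ e, false) := fun e =>
    (hφ _ _ (by rw [hs2]; simp)).symm
  have hs0 : ∀ x, R.s0 (R.s1 (R.s2 x)) = x := by
    intro x
    apply R.s2.injective
    rw [R.s2_s0, R.s1_invol]
  -- Solving `s0 ∘ s0 = ι` on positive half-edges forces the positive part of `s2` to be `τ⁻¹ * ι`.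
  have hσ : ∀ e, R.s2 (φ (e, true)) = φ ((τ⁻¹ * ι) e, true) := by
    intro e
    obtain ⟨⟨f, t⟩, hf⟩ := φ.surjective (R.s2 (φ (e, true)))
    have ht : t = true := by
      have := hs2 (φ (e, true))
      rw [← hf] at this
      simpa using this
    subst ht
    rw [← hf]
    have h1 : R.s0 (φ (f, false)) = φ (e, true) := by
      have := hs0 (φ (e, true))
      rwa [← hf, h.map_s1] at this
    have h2 : R.s0 (φ (τ f, true)) = φ (f, false) := by
      have := hs0 (φ (f, false))
      rwa [hτ, h.map_s1] at this
    have h3 := h.map_s0 (τ f)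
    rw [h2, h1] at h3
    have h4 : e = ι (τ f) := by simpa using φ.injective h3
    rw [h4, Perm.mul_apply, hι]
    simp
  have hs2φ : ∀ p, R.s2 (φ p) = φ (boolPerm (τ⁻¹ * ι) τ p) := by
    rintro ⟨e, _ | _⟩
    · exact hτ e
    · exact hσ e
  have hleft : ∀ e, (R.face (φ (e, true))).isLeft := fun e =>
    (R.sign_eq_one_iff _).1 (h.sign_eq e)
  have hright : ∀ e, (R.face (φ (e, false))).isRight := fun e => by
    rw [← Sum.not_isLeft, ← R.sign_eq_one_iff, h.sign]
    decide
  let fp : E → P := fun e => (R.face (φ (e, true))).getLeft (hleft e)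
  let fm : E → M := fun e => (R.face (φ (e, false))).getRight (hright e)
  have hfp : ∀ e, R.face (φ (e, true)) = Sum.inl (fp e) := fun e => (Sum.inl_getLeft _ _).symm
  have hfm : ∀ e, R.face (φ (e, false)) = Sum.inr (fm e) := fun e => (Sum.inr_getRight _ _).symm
  have hlp : IsLabel (τ⁻¹ * ι) fp := by
    constructor
    · intro i
      obtain ⟨x, hx⟩ := R.isLabel_face.1 (Sum.inl i)
      obtain ⟨⟨e, _ | _⟩, rfl⟩ := φ.surjective x
      · rw [hfm] at hx; simp at hx
      · rw [hfp] at hx; exact ⟨e, Sum.inl_injective hx⟩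
    · intro e e'
      rw [← Sum.inl_injective.eq_iff, ← hfp, ← hfp, R.isLabel_face.2, sameCycle_permCongr φ hs2φ,
        sameCycle_boolPerm]
      simp
  have hlm : IsLabel τ fm := by
    constructor
    · intro i
      obtain ⟨x, hx⟩ := R.isLabel_face.1 (Sum.inr i)
      obtain ⟨⟨e, _ | _⟩, rfl⟩ := φ.surjective x
      · rw [hfm] at hx; exact ⟨e, Sum.inr_injective hx⟩
      · rw [hfp] at hx; simp at hx
    · intro e e'
      rw [← Sum.inr_injective.eq_iff, ← hfm, ← hfm, R.isLabel_face.2, sameCycle_permCongr φ hs2φ,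
        sameCycle_boolPerm]
      simp
  have hlink : IsLinked fp fm := isLinked_of_ribbon h.map_s1 hs2φ hfp hfm
  refine ⟨⟨τ, fp, fm, hlp, hlm, hlink⟩, h.map_s1, hs2φ, h.sign, ?_⟩
  rintro e (_ | _)
  · exact hfm e
  · exact hfp e

theorem cycleType_of_involution {F : Type} [Fintype F] [DecidableEq F] {π : Perm F}
    (h : ∀ x, π (π x) = x) (h' : ∀ x, π x ≠ x) :
    π.cycleType = Multiset.replicate (Fintype.card F / 2) 2 := by
  have h2 : π ^ 2 = 1 := Equiv.ext fun x => by rw [pow_two]; exact h x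
  have h3 := Perm.cycleType_of_pow_prime_eq_one (p := 2) h2
  have h4 := Perm.sum_cycleType π
  have h5 : π.support = Finset.univ := Finset.eq_univ_of_forall fun x => by simp [h']
  rw [h5, Finset.card_univ, h3, Multiset.sum_replicate, smul_eq_mul] at h4
  rw [← h4, Nat.mul_div_cancel _ two_pos]
  exact h3

/-- Two fixed point free involutions are conjugate. -/
theorem exists_equiv_of_involutions {E F : Type} [Finite E] [Finite F]
    (hc : Nat.card E = Nat.card F) {ι : Perm E} {ι' : Perm F} (hι : ∀ e, ι (ι e) = e)
    (hι' : ∀ e, ι e ≠ e) (hκ : ∀ e, ι' (ι' e) = e) (hκ' : ∀ e, ι' e ≠ e) :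
    ∃ f : E ≃ F, ∀ e, f (ι e) = ι' (f e) := by
  classical
  have := Fintype.ofFinite F
  obtain ⟨f₀⟩ := Finite.card_eq.1 hc
  have h : IsConj (f₀.permCongr ι) ι' := by
    rw [Perm.isConj_iff_cycleType_eq, cycleType_of_involution hκ hκ', cycleType_of_involution]
    · intro x; simp [hι]
    · intro x h
      rw [permCongr_apply, ← f₀.eq_symm_apply] at h
      exact hι' _ h
  obtain ⟨c, hc⟩ := isConj_iff.1 h
  refine ⟨f₀.trans c, fun e => ?_⟩
  rw [← hc]
  simp

/-- The centralizer of a fixed point free involution. -/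
theorem nat_card_commute_flipPerm (V : Type) [Fintype V] :
    Nat.card {c : Perm (V × Bool) // ∀ e, c (flipPerm V e) = flipPerm V (c e)} =
      2 ^ Fintype.card V * (Fintype.card V).factorial := by
  classical
  have h1 : Nat.card (Subgroup.centralizer {flipPerm V}) =
      Nat.card {c : Perm (V × Bool) // ∀ e, c (flipPerm V e) = flipPerm V (c e)} := by
    refine Nat.card_congr (Equiv.subtypeEquivRight fun c => ?_)
    rw [Subgroup.mem_centralizer_singleton_iff]
    exact Equiv.ext_iff
  have h2 : (flipPerm V).cycleType = Multiset.replicate (Fintype.card V) 2 := by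
    rw [cycleType_of_involution (fun x => Prod.ext rfl (Bool.not_not _)) (fun x => by
      rcases x with ⟨v, _ | _⟩ <;> simp), Fintype.card_prod, Fintype.card_bool,
      Nat.mul_div_cancel _ two_pos]
  rw [← h1, Perm.nat_card_centralizer, h2]
  simp only [Multiset.sum_replicate, Multiset.prod_replicate, Fintype.card_prod, Fintype.card_bool,
    smul_eq_mul, tsub_self, Nat.factorial_zero, one_mul]
  congr 1
  by_cases h : Fintype.card V = 0
  · simp [h]
  · rw [Multiset.toFinset_replicate, if_neg h]
    simp

/-- Signs alternate around a vertex, so `s0 ∘ s0` is a fixed point free involution of the positive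
half-edges. There are as many of them as edges, and two such involutions on sets of equal size are
conjugate. -/
theorem OrientedRibbonGraph.exists_isFrame [Finite X] [Finite E] (R : OrientedRibbonGraph X P M)
    (hX : Nat.card X = 2 * Nat.card E) (hι : ∀ e, ι (ι e) = e) (hι' : ∀ e, ι e ≠ e) :
    ∃ φ : E × Bool ≃ X, IsFrame ι R φ := by
  let F := {x // R.sign x = 1}
  have hs1 : ∀ x : F, R.sign (R.s1 x) = -1 := fun x => by rw [R.sign_s1, x.2]
  have hneg : ∀ x, R.sign x ≠ 1 → R.sign (R.s1 x) = 1 := fun x hx => by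
    rw [R.sign_s1, (Int.units_eq_one_or (R.sign x)).resolve_left hx, neg_neg]
  let d : F × Bool → X := fun p => cond p.2 p.1.1 (R.s1 p.1)
  have hd : Function.Bijective d := by
    constructor
    · rintro ⟨x, _ | _⟩ ⟨y, _ | _⟩ h
      · exact Prod.ext (Subtype.ext (R.s1.injective h)) rfl
      · have := hs1 x
        rw [show R.s1 x = y.1 from h, y.2] at this
        exact absurd this (by decide)
      · have := hs1 y
        rw [← show x.1 = R.s1 y from h, x.2] at this
        exact absurd this (by decide)
      · exact Prod.ext (Subtype.ext h) rfl
    · intro x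
      by_cases hx : R.sign x = 1
      · exact ⟨(⟨x, hx⟩, true), rfl⟩
      · exact ⟨(⟨R.s1 x, hneg x hx⟩, false), R.s1_invol x⟩
  have hcard : Nat.card E = Nat.card F := by
    have := Nat.card_congr (Equiv.ofBijective d hd)
    rw [Nat.card_prod, hX, Nat.card_eq_fintype_card (α := Bool), Fintype.card_bool] at this
    omega
  let κ : Perm F := (R.s0 * R.s0).subtypePerm fun x => by
    rw [Perm.mul_apply, R.sign_s0, R.sign_s0, neg_neg]
  obtain ⟨f, hf⟩ := exists_equiv_of_involutions hcard hι hι' (ι' := κ)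
    (fun x => Subtype.ext (R.s0_four x)) (fun x h => R.s0_two_ne x (congrArg Subtype.val h))
  refine ⟨(prodCongr f (Equiv.refl Bool)).trans (Equiv.ofBijective d hd), ?_, ?_, ?_⟩
  · rintro e (_ | _)
    · exact R.s1_invol _
    · rfl
  · exact fun e => (f e).2
  · intro e
    exact (congrArg Subtype.val (hf e)).symm

/-- The frames form a torsor under the centralizer of the involution. -/
noncomputable def IsFrame.equivCommute {R : OrientedRibbonGraph X P M} {φ : E × Bool ≃ X} (h : IsFrame ι R φ) :
    {c : Perm E // ∀ e, c (ι e) = ι (c e)} ≃ {φ' : E × Bool ≃ X // IsFrame ι R φ'} :=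
  Equiv.ofBijective (fun c => ⟨(prodCongr c.1 (Equiv.refl Bool)).trans φ,
    { map_s1 := fun e t => h.map_s1 (c.1 e) t
      sign_eq := fun e => h.sign_eq (c.1 e)
      map_s0 := fun e => by
        refine (h.map_s0 (c.1 e)).trans ?_
        rw [← c.2]
        rfl }⟩) (by
    constructor
    · intro c c' hc
      refine Subtype.ext (Equiv.ext fun e => ?_)
      have := congrArg (fun φ' : {φ' : E × Bool ≃ X // IsFrame ι R φ'} => φ'.1 (e, true)) hc
      exact congrArg Prod.fst (φ.injective this)
    · rintro ⟨φ', h'⟩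
      have hsnd : ∀ e, (φ.symm (φ' (e, true))).2 = true := by
        intro e
        have := (h.snd_eq_iff (φ' (e, true)) (φ (e, true))).2 (by rw [h'.sign_eq, h.sign_eq])
        simpa using this
      have hsnd' : ∀ e, (φ'.symm (φ (e, true))).2 = true := by
        intro e
        have := (h'.snd_eq_iff (φ (e, true)) (φ' (e, true))).2 (by rw [h'.sign_eq, h.sign_eq])
        simpa using this
      have h1 : ∀ e, φ ((φ.symm (φ' (e, true))).1, true) = φ' (e, true) := by
        intro e
        nth_rewrite 2 [← hsnd e]
        simp
      have h2 : ∀ e, φ' ((φ'.symm (φ (e, true))).1, true) = φ (e, true) := by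
        intro e
        nth_rewrite 2 [← hsnd' e]
        simp
      let c : Perm E :=
        { toFun := fun e => (φ.symm (φ' (e, true))).1
          invFun := fun e => (φ'.symm (φ (e, true))).1
          left_inv := fun e => by
            dsimp only
            rw [h1, symm_apply_apply]
          right_inv := fun e => by
            dsimp only
            rw [h2, symm_apply_apply] }
      have hc : ∀ e, φ (c e, true) = φ' (e, true) := h1
      refine ⟨⟨c, fun e => ?_⟩, Subtype.ext (Equiv.ext ?_)⟩
      · have := h.map_s0 (c e)
        rw [hc, h'.map_s0, ← hc] at this
        exact congrArg Prod.fst (φ.injective this)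
      · rintro ⟨e, _ | _⟩
        · change φ (c e, false) = φ' (e, false)
          rw [← Bool.not_true, ← h.map_s1, ← h'.map_s1, hc]
        · exact hc e)

end Frames


/-! ### From isomorphism classes of ribbon graphs to maps -/

section Bridge

open Equiv

variable {X P M E : Type} {ι : Perm E}

/-! ### The volume of the space of metrics on a ribbon graph -/

/-- The edges of a framed ribbon graph. -/
noncomputable def IsFraming.edgeEquiv {s : CMap ι P M} {R : OrientedRibbonGraph X P M}
    {φ : E × Bool ≃ X} (h : IsFraming s R φ) : E ≃ R.Edge :=
  Equiv.ofBijective (fun e => R.edge (φ (e, true))) (by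
    constructor
    · intro e e' hee'
      have h1 : R.s1.SameCycle (φ (e, true)) (φ (e', true)) := Quotient.exact hee'
      have := sameCycle_induct (r := fun x y => (φ.symm x).1 = (φ.symm y).1)
        ⟨fun _ => rfl, fun h => h.symm, fun h h' => h.trans h'⟩ (fun x => by
          obtain ⟨⟨e, t⟩, rfl⟩ := φ.surjective x
          rw [h.map_s1, symm_apply_apply, symm_apply_apply]) h1
      simpa using this
    · intro q
      obtain ⟨x, rfl⟩ := Quotient.exists_rep q
      obtain ⟨⟨e, _ | _⟩, rfl⟩ := φ.surjective x
      · refine ⟨e, Quotient.sound ?_⟩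
        change R.s1.SameCycle _ _
        have := sameCycle_apply R.s1 (φ (e, true))
        rwa [h.map_s1] at this
      · exact ⟨e, rfl⟩)

theorem IsFraming.edge_eq {s : CMap ι P M} {R : OrientedRibbonGraph X P M}
    {φ : E × Bool ≃ X} (h : IsFraming s R φ) (e : E) (t : Bool) :
    R.edge (φ (e, t)) = h.edgeEquiv e := by
  cases t
  · refine (Quotient.sound ?_ : R.edge (φ (e, false)) = R.edge (φ (e, true)))
    change R.s1.SameCycle _ _
    have := sameCycle_apply R.s1 (φ (e, false))
    rwa [h.map_s1] at this
  · rfl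

variable [Fintype X] [Fintype E]

theorem IsFraming.boundaryLength_eq {s : CMap ι P M} {R : OrientedRibbonGraph X P M}
    {φ : E × Bool ≃ X} (h : IsFraming s R φ) {A : Type} [CommRing A] (m : R.Edge → A) :
    R.boundaryLength A m = Sum.elim (fibreSum s.fp fun e => m (h.edgeEquiv e))
      (fibreSum s.fm fun e => m (h.edgeEquiv e)) := by
  classical
  funext β
  have h1 : R.boundaryLength A m β = ∑ x, if R.face x = β then m (R.edge x) else 0 := by
    rw [← Finset.sum_filter]
    simp only [OrientedRibbonGraph.boundaryLength, LinearMap.coe_mk, AddHom.coe_mk]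
  rw [h1, ← φ.sum_comp, Fintype.sum_prod_type]
  simp only [Fintype.sum_bool, h.edge_eq, h.face_eq, cond_true, cond_false]
  rcases β with i | j
  · simp only [Sum.elim_inl, Sum.inl.injEq, reduceCtorEq, if_false, add_zero, fibreSum]
  · simp only [Sum.elim_inr, Sum.inr.injEq, reduceCtorEq, if_false, zero_add, fibreSum]

theorem IsFraming.boundaryLength_eq_iff {s : CMap ι P M} {R : OrientedRibbonGraph X P M}
    {φ : E × Bool ≃ X} (h : IsFraming s R φ) {A : Type} [CommRing A] (m : R.Edge → A) (Lp : P → A)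
    (Lm : M → A) : R.boundaryLength A m = Sum.elim Lp Lm ↔
      IsLevel s.fp s.fm Lp Lm fun e => m (h.edgeEquiv e) := by
  rw [h.boundaryLength_eq, IsLevel, funext_iff, Sum.forall]
  rfl

/-- The lattice of integral weights of a framed ribbon graph. -/
noncomputable def IsFraming.kernelEquiv {s : CMap ι P M} {R : OrientedRibbonGraph X P M}
    {φ : E × Bool ≃ X} (h : IsFraming s R φ) : R.integralKernel ≃ₗ[ℤ] kerLat s.fp s.fm where
  toFun z := ⟨fun e => z.1 (h.edgeEquiv e), (h.boundaryLength_eq_iff z.1 0 0).1 (by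
    rw [LinearMap.mem_ker.1 z.2]
    funext β; cases β <;> rfl)⟩
  map_add' _ _ := rfl
  map_smul' _ _ := rfl
  invFun z := ⟨fun q => z.1 (h.edgeEquiv.symm q), LinearMap.mem_ker.2 (by
    refine ((h.boundaryLength_eq_iff _ 0 0).2 ?_).trans (by funext β; cases β <;> rfl)
    simp only [Equiv.symm_apply_apply]
    exact z.2)⟩
  left_inv z := Subtype.ext (funext fun q => by simp)
  right_inv z := Subtype.ext (funext fun q => by simp)

/-- The framing carries a basis of the integral kernel to a basis of `kerLat`, and the measure does
not depend on the basis. Along the parametrisation the length equations hold automatically, so only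
positivity remains. -/
theorem IsFraming.levelMeasure_metrics {s : CMap ι P M} {R : OrientedRibbonGraph X P M}
    {φ : E × Bool ≃ X} (h : IsFraming s R φ) (Lp : P → ℝ) (Lm : M → ℝ) :
    R.levelMeasure (Sum.elim Lp Lm) (R.metrics (Sum.elim Lp Lm)) = levelVol s.fp s.fm Lp Lm := by
  classical
  have hfin : Finite R.Edge := Finite.of_equiv _ h.edgeEquiv
  have hcount : Countable R.Edge := inferInstance
  by_cases hm : ∃ m, R.boundaryLength ℝ m = Sum.elim Lp Lm
  swap
  · rw [OrientedRibbonGraph.levelMeasure, dif_neg hm, levelVol_eq_zero]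
    · rfl
    · intro m hlev
      refine absurd ⟨fun q => m (h.edgeEquiv.symm q), ?_⟩ hm
      rw [h.boundaryLength_eq_iff]
      simpa using hlev
  have hc := (h.boundaryLength_eq_iff _ _ _).1 hm.choose_spec
  let b := R.kernelBasis.map h.kernelEquiv
  have hb : ∀ k e, (b k : E → ℤ) e = (R.kernelBasis k : R.Edge → ℤ) (h.edgeEquiv e) := by
    intro k e
    simp only [b, Module.Basis.map_apply]
    rfl
  let a : (Module.Free.ChooseBasisIndex ℤ R.integralKernel → ℝ) → R.Edge → ℝ := fun t e =>
      hm.choose e + ∑ k, t k * ((R.kernelBasis k : R.Edge → ℤ) e : ℝ)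
  have ha : Measurable a := by
    refine measurable_pi_lambda _ fun e => ?_
    fun_prop
  have hlev : ∀ t, IsLevel s.fp s.fm Lp Lm fun e => a t (h.edgeEquiv e) := by
    intro t
    have := hc.comb (fun k => b k) t
    simpa only [hb] using this
  have hmet : MeasurableSet {m : R.Edge → ℝ | ∀ e, 0 < m e} := by
    rw [Set.ofPred_forall]
    exact MeasurableSet.iInter fun e => measurableSet_lt measurable_const (measurable_pi_apply e)
  have hmeas : MeasurableSet (R.metrics (Sum.elim Lp Lm)) := by
    have : R.metrics (Sum.elim Lp Lm) = {m | ∀ e, 0 < m e} ∩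
        ((⋂ i, {m | fibreSum s.fp (fun e => m (h.edgeEquiv e)) i = Lp i}) ∩
        ⋂ j, {m | fibreSum s.fm (fun e => m (h.edgeEquiv e)) j = Lm j}) := by
      ext m
      change (_ ∧ _) ↔ _
      rw [h.boundaryLength_eq_iff]
      simp [IsLevel]
    rw [this]
    have hP : Finite P := Finite.of_surjective _ s.isMap.1.1
    have hM : Finite M := Finite.of_surjective _ s.isMap.2.1.1
    refine hmet.inter (MeasurableSet.inter (MeasurableSet.iInter fun i => ?_)
      (MeasurableSet.iInter fun j => ?_))
    all_goals
      refine measurableSet_eq_fun ?_ measurable_const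
      refine Finset.measurable_sum _ fun e _ => ?_
      split_ifs
      · exact measurable_pi_apply _
      · exact measurable_const
  rw [OrientedRibbonGraph.levelMeasure, dif_pos hm, Measure.map_apply ha hmeas, levelVol,
    levelInt_eq hc measurable_posInd, latInt_eq_of_basis b _ measurable_posInd]
  rw [← lintegral_indicator_one (ha hmeas)]
  refine lintegral_congr fun t => ?_
  have hmem : t ∈ a ⁻¹' R.metrics (Sum.elim Lp Lm) ↔ ∀ e, 0 < a t (h.edgeEquiv e) := by
    change ((∀ q, 0 < a t q) ∧ _) ↔ _
    rw [h.boundaryLength_eq_iff, and_iff_left (hlev t)]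
    exact h.edgeEquiv.forall_congr_right.symm
  simp only [hb]
  change (a ⁻¹' R.metrics (Sum.elim Lp Lm)).indicator 1 t = posInd fun e => a t (h.edgeEquiv e)
  rw [posInd, Set.indicator_apply]
  simp only [hmem, Pi.one_apply]

/-! ### The genus -/

theorem nat_card_quotient_sameCycle {X : Type} [Finite X] {π : Perm X} {c : ℕ}
    (h : ∀ x, Nat.card {y // π.SameCycle x y} = c) :
    Nat.card X = Nat.card (Quotient (Perm.SameCycle.setoid π)) * c := by
  have := Fintype.ofFinite (Quotient (Perm.SameCycle.setoid π))
  rw [← Nat.card_congr (Equiv.sigmaFiberEquiv (Quotient.mk (Perm.SameCycle.setoid π))),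
    Nat.card_sigma, Finset.sum_congr rfl (g := fun _ => c), Finset.sum_const, Finset.card_univ,
    smul_eq_mul, Nat.card_eq_fintype_card]
  intro q _
  obtain ⟨x, rfl⟩ := Quotient.exists_rep q
  rw [← h x]
  refine Nat.card_congr (Equiv.subtypeEquivRight fun y => ?_)
  rw [Quotient.eq]
  exact Perm.sameCycle_comm

/-- There are `4 * k` half-edges, hence `k` vertices and `2 * k` edges, and the Euler characteristic
is the number of boundaries minus `k`. -/
theorem IsFraming.hasGenus {s : CMap ι P M} {R : OrientedRibbonGraph X P M}
    {φ : E × Bool ≃ X} (h : IsFraming s R φ) {k g : ℕ} (hE : Nat.card E = 2 * k)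
    (hk : k + 2 = 2 * g + Nat.card P + Nat.card M) : R.HasGenus g := by
  have hP : Finite P := Finite.of_surjective _ s.isMap.1.1
  have hM : Finite M := Finite.of_surjective _ s.isMap.2.1.1
  have h1 := nat_card_quotient_sameCycle R.fourValent
  have h2 : Nat.card R.Edge = 2 * k := by rw [← Nat.card_congr h.edgeEquiv, hE]
  have h3 : Nat.card R.Face = Nat.card P + Nat.card M := by
    rw [Nat.card_congr R.label, Nat.card_sum]
  have h4 : Nat.card X = 4 * k := by
    rw [← Nat.card_congr φ, Nat.card_prod, hE, Nat.card_eq_fintype_card (α := Bool),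
      Fintype.card_bool]
    ring
  have h5 : Nat.card R.Vertex = k := by
    change Nat.card X = Nat.card R.Vertex * 4 at h1
    omega
  rw [OrientedRibbonGraph.HasGenus, h2, h3, h5]
  push_cast
  have : (k : ℤ) + 2 = 2 * g + Nat.card P + Nat.card M := by exact_mod_cast hk
  linarith

/-! ### The sum over the isomorphism classes -/

-- The frames of `R` form a torsor under the centralizer of the involution, of order `2 ^ k * k!`.
-- Each frame comes from a single map, and the frames that give the same map form a torsor under
-- `Aut R`.
open scoped Classical in
theorem OrientedRibbonGraph.card_isFraming {k : ℕ} {X : Type} [Finite X] [Finite P] [Finite M]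
    (R : OrientedRibbonGraph X P M) (hX : Nat.card X = 4 * k) :
    (Finset.univ.filter fun s : CMap (flipPerm (Fin k)) P M => ∃ φ, IsFraming s R φ).card *
      Nat.card R.Aut = 2 ^ k * k.factorial := by
  have hι : ∀ e, flipPerm (Fin k) (flipPerm (Fin k) e) = e := fun x => Prod.ext rfl (Bool.not_not _)
  have hι' : ∀ e, flipPerm (Fin k) e ≠ e := by rintro ⟨v, _ | _⟩ <;> simp
  obtain ⟨φ₀, h₀⟩ := R.exists_isFrame (E := Fin k × Bool) (by simp [hX]; ring) hι hι'
  have h1 : Nat.card {φ : (Fin k × Bool) × Bool ≃ X // IsFrame (flipPerm (Fin k)) R φ} =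
      2 ^ k * k.factorial := by
    rw [← Nat.card_congr h₀.equivCommute, nat_card_commute_flipPerm, Fintype.card_fin]
  let f : (Σ s : CMap (flipPerm (Fin k)) P M, {φ : (Fin k × Bool) × Bool ≃ X // IsFraming s R φ}) →
      {φ : (Fin k × Bool) × Bool ≃ X // IsFrame (flipPerm (Fin k)) R φ} :=
    fun p => ⟨p.2.1, p.2.2.isFrame hι⟩
  have hf : Function.Bijective f := by
    constructor
    · rintro ⟨s, φ, h⟩ ⟨s', φ', h'⟩ hh
      have hφ : φ = φ' := congrArg Subtype.val hh
      subst hφ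
      obtain rfl := h.eq h'
      rfl
    · rintro ⟨φ, h⟩
      obtain ⟨s, hs⟩ := h.exists_isFraming hι
      exact ⟨⟨s, φ, hs⟩, rfl⟩
  rw [← h1, ← Nat.card_congr (Equiv.ofBijective f hf), Nat.card_sigma, Finset.card_filter,
    Finset.sum_mul]
  refine Finset.sum_congr rfl fun s _ => ?_
  by_cases h : ∃ φ, IsFraming s R φ
  · rw [if_pos h, one_mul]
    obtain ⟨φ, h⟩ := h
    exact (Nat.card_congr h.equivAut).symm
  · rw [if_neg h, zero_mul]
    push Not at h
    have : IsEmpty {φ : (Fin k × Bool) × Bool ≃ X // IsFraming s R φ} := ⟨fun φ => h φ.1 φ.2⟩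
    exact Nat.card_of_isEmpty.symm

/-- The sum over the isomorphism classes of ribbon graphs is a sum over maps. -/
theorem moduliVolume_eq_mapVol (g : ℕ) {P M : Type} [Finite P] [Finite M] (Lp : P → ℝ)
    (Lm : M → ℝ) :
    moduliVolume g Lp Lm = mapVol (2 * g + Nat.card P + Nat.card M - 2) Lp Lm := by
  classical
  set k := 2 * g + Nat.card P + Nat.card M - 2 with hk
  have hι : ∀ e, flipPerm (Fin k) (flipPerm (Fin k) e) = e := fun x => Prod.ext rfl (Bool.not_not _)
  have hι' : ∀ e, flipPerm (Fin k) e ≠ e := by rintro ⟨v, _ | _⟩ <;> simp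
  let D : ℝ≥0∞ := (2 ^ k * k.factorial : ℕ)
  have hD0 : D ≠ 0 := Nat.cast_ne_zero.2 (by positivity)
  have hD1 : D ≠ ∞ := ENNReal.natCast_ne_top _
  have hX : Nat.card (Fin (4 * k)) = 4 * k := by simp
  -- The weight `1 / #Aut R` is spread as `1 / D` over each of the maps obtained by numbering `R`.
  have hclass : ∀ c : Quotient (GenericRibbonGraph.setoid g P M),
      c.out.1.levelMeasure (Sum.elim Lp Lm) (c.out.1.metrics (Sum.elim Lp Lm)) /
      (Nat.card c.out.1.Aut : ℝ≥0∞) =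
      ∑ s : CMap (flipPerm (Fin k)) P M,
        if ∃ φ, IsFraming s c.out.1 φ then levelVol s.fp s.fm Lp Lm / D else 0 := by
    intro c
    set R := c.out.1
    have hcard := R.card_isFraming hX
    have hA : (Nat.card R.Aut : ℝ≥0∞) ≠ 0 := by
      intro h0
      have h0 : Nat.card R.Aut = 0 := by exact_mod_cast h0
      rw [h0, mul_zero] at hcard
      have : 0 < 2 ^ k * k.factorial := by positivity
      omega
    have hcard' : ((Finset.univ.filter fun s : CMap (flipPerm (Fin k)) P M =>
        ∃ φ, IsFraming s R φ).card : ℝ≥0∞) * Nat.card R.Aut = D := by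
      rw [← Nat.cast_mul]
      exact congrArg Nat.cast (Eq.trans (by congr) hcard)
    rw [← Finset.sum_filter]
    rw [Finset.sum_congr rfl (g := fun _ =>
      R.levelMeasure (Sum.elim Lp Lm) (R.metrics (Sum.elim Lp Lm)) / D)]
    · rw [Finset.sum_const, nsmul_eq_mul, ← mul_div_assoc, ENNReal.div_eq_div_iff hD0 hD1 hA
        (ENNReal.natCast_ne_top _), ← hcard']
      ring
    · intro s hs
      obtain ⟨φ, h⟩ := (Finset.mem_filter.1 hs).2
      rw [h.levelMeasure_metrics]
  rw [moduliVolume, tsum_congr hclass]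
  simp_rw [← tsum_fintype (L := .unconditional _)]
  rw [ENNReal.tsum_comm, tsum_fintype, mapVol, flipVol, volSum, ENNReal.div_eq_inv_mul,
    Finset.mul_sum]
  refine Finset.sum_congr rfl fun s _ => ?_
  -- A map has boundaries of both signs, so the truncated subtraction that defines `k` is exact
  -- here.
  have hP : Nonempty P := ⟨s.fp s.isMap.2.2.1.some⟩
  have hM : Nonempty M := ⟨s.fm s.isMap.2.2.1.some⟩
  have hP' : 0 < Nat.card P := Nat.card_pos
  have hM' : 0 < Nat.card M := Nat.card_pos
  obtain ⟨φ⟩ : Nonempty ((Fin k × Bool) × Bool ≃ Fin (4 * k)) := Finite.card_eq.1 (by simp; ring)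
  obtain ⟨R, hR⟩ := exists_isFraming hι hι' s φ
  have hg : R.HasGenus g := hR.hasGenus (k := k) (by simp; ring) (by omega)
  let R' : GenericRibbonGraph g P M := ⟨R, hg⟩
  -- Each map is counted in one class only, that of the ribbon graph it defines.
  have hex : ∀ c : Quotient (GenericRibbonGraph.setoid g P M), (∃ φ, IsFraming s c.out.1 φ) ↔
      c = Quotient.mk _ R' := by
    intro c
    constructor
    · rintro ⟨φ', h'⟩
      rw [← Quotient.out_eq c]
      exact Quotient.sound ⟨_, h'.isIso hR⟩
    · rintro rfl
      have : (GenericRibbonGraph.setoid g P M).r R' (Quotient.mk _ R').out :=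
        Quotient.exact (Quotient.out_eq _).symm
      obtain ⟨ψ, hψ⟩ := this
      exact ⟨_, hR.trans hψ⟩
  rw [tsum_eq_single (Quotient.mk _ R'), if_pos ((hex _).2 rfl), ENNReal.div_eq_inv_mul]
  intro c hc
  rw [if_neg fun h => hc ((hex c).1 h)]

end Bridge


/-! ### Passage to real numbers and to the genus as index -/

section RealRecursion

theorem volumeZ_eq {g k : ℕ} {P M : Type} [Finite P] [Finite M] (Lp : P → ℝ) (Lm : M → ℝ)
    (hk : 2 * g + Nat.card P + Nat.card M - 2 = k) :
    volumeZ g Lp Lm = (mapVol k Lp Lm).toReal := by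
  rw [volumeZ, moduliVolume_eq_mapVol, hk]

theorem mapVol_zero {P M : Type} [Finite P] [Finite M] (Lp : P → ℝ) (Lm : M → ℝ) :
    mapVol 0 Lp Lm = 0 := by
  rw [mapVol, flipVol_zero, ENNReal.zero_div]

theorem mapVol_eq_zero_of_nonpos {P M : Type} [Finite P] [Finite M] (k : ℕ) {Lp : P → ℝ}
    (Lm : M → ℝ) {i : P} (hi : Lp i ≤ 0) : mapVol k Lp Lm = 0 := by
  rw [mapVol, flipVol, volSum_eq_zero_of_nonpos_left hi, ENNReal.zero_div]

/-- For `x ≤ 0` the volume vanishes, which is why the splitting term can be written without positive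
parts. -/
theorem toReal_ofReal_mul_mapVol {P M : Type} [Finite P] [Finite M] (k : ℕ) (x : ℝ) (Lp : P → ℝ)
    (Lm : M → ℝ) : (ENNReal.ofReal x * mapVol k (adjoinVar x Lp) Lm).toReal =
      x * (mapVol k (adjoinVar x Lp) Lm).toReal := by
  rcases le_total x 0 with hx | hx
  · rw [mapVol_eq_zero_of_nonpos k Lm (i := none) hx]
    simp
  · rw [ENNReal.toReal_mul, ENNReal.toReal_ofReal hx]

/-- A sum over the numbers of vertices of two graphs is a sum over their genera. -/
theorem sum_antidiagonal_genus {F G : ℕ → ℝ} {p q g k : ℕ} (hk : k + 4 = 2 * g + p + q)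
    (hF : ∀ a, F a ≠ 0 → ∃ h, a + 2 = 2 * h + p) (hG : ∀ a, G a ≠ 0 → ∃ h, a + 2 = 2 * h + q)
    (hF0 : F 0 = 0) (hG0 : G 0 = 0) :
    ∑ a ∈ Finset.HasAntidiagonal.antidiagonal k, F a.1 * G a.2 =
      ∑ h ∈ Finset.HasAntidiagonal.antidiagonal g,
        F (2 * h.1 + p - 2) * G (2 * h.2 + q - 2) := by
  have hpos : ∀ h : ℕ × ℕ, F (2 * h.1 + p - 2) * G (2 * h.2 + q - 2) ≠ 0 →
      2 < 2 * h.1 + p ∧ 2 < 2 * h.2 + q := by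
    intro h hne
    have h1 := left_ne_zero_of_mul hne
    have h2 := right_ne_zero_of_mul hne
    constructor
    · by_contra hle
      rw [Nat.sub_eq_zero_of_le (not_lt.1 hle)] at h1
      exact h1 hF0
    · by_contra hle
      rw [Nat.sub_eq_zero_of_le (not_lt.1 hle)] at h2
      exact h2 hG0
  symm
  -- Only nonzero terms correspond. Where the subtraction is truncated the number of vertices is 0
  -- and the term vanishes; conversely `hF` and `hG` supply the genera.
  refine Finset.sum_bij_ne_zero (fun h _ _ => (2 * h.1 + p - 2, 2 * h.2 + q - 2)) ?_ ?_ ?_ ?_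
  · intro h hh hne
    have := hpos h hne
    rw [Finset.HasAntidiagonal.mem_antidiagonal] at hh ⊢
    dsimp only
    omega
  · intro h hh hne h' hh' hne' heq
    have := hpos h hne
    have := hpos h' hne'
    rw [Prod.mk.injEq] at heq
    exact Prod.ext (by omega) (by omega)
  · intro a ha hne
    obtain ⟨h₁, e₁⟩ := hF _ (left_ne_zero_of_mul hne)
    obtain ⟨h₂, e₂⟩ := hG _ (right_ne_zero_of_mul hne)
    rw [Finset.HasAntidiagonal.mem_antidiagonal] at ha
    have i₁ : 2 * h₁ + p - 2 = a.1 := by omega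
    have i₂ : 2 * h₂ + q - 2 = a.2 := by omega
    refine ⟨(h₁, h₂), ?_, ?_, ?_⟩
    · rw [Finset.HasAntidiagonal.mem_antidiagonal]
      dsimp only
      omega
    · dsimp only
      rw [i₁, i₂]
      exact hne
    · exact Prod.ext i₁ i₂
  · exact fun _ _ _ => rfl

variable {P M : Type} [Fintype P] [Fintype M] [DecidableEq P] [DecidableEq M]

theorem card_compl_singleton_add_one {Q : Type} [Fintype Q] [DecidableEq Q] (i : Q) :
    ({i}ᶜ : Finset Q).card + 1 = Fintype.card Q := by
  have := Finset.card_add_card_compl {i}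
  rw [Finset.card_singleton] at this
  omega

theorem toReal_sum_parts {g k : ℕ} (hk : k + 3 = 2 * g + Fintype.card P + Fintype.card M)
    (Lp : P → ℝ) (Lm : M → ℝ) (i : P) {I : Finset P} (hI : I ⊆ {i}ᶜ) (J : Finset M) :
    (∑ a ∈ Finset.HasAntidiagonal.antidiagonal k,
        ((ENNReal.ofReal (∑ k ∈ J, Lm k - ∑ k ∈ I, Lp k) *
          mapVol a.1 (adjoinVar (∑ k ∈ J, Lm k - ∑ k ∈ I, Lp k) (restrictTo Lp I))
            (restrictTo Lm J)) *
        (ENNReal.ofReal (∑ k ∈ Jᶜ, Lm k - ∑ k ∈ {i}ᶜ \ I, Lp k) *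
          mapVol a.2 (adjoinVar (∑ k ∈ Jᶜ, Lm k - ∑ k ∈ {i}ᶜ \ I, Lp k)
            (restrictTo Lp ({i}ᶜ \ I))) (restrictTo Lm Jᶜ))).toReal) =
      ∑ h ∈ Finset.HasAntidiagonal.antidiagonal g,
        (∑ k ∈ J, Lm k - ∑ k ∈ I, Lp k) *
              (∑ k ∈ Jᶜ, Lm k - ∑ k ∈ {i}ᶜ \ I, Lp k) *
              volumeZ h.1 (adjoinVar (∑ k ∈ J, Lm k - ∑ k ∈ I, Lp k) (restrictTo Lp I))
                (restrictTo Lm J) *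
              volumeZ h.2
                (adjoinVar (∑ k ∈ Jᶜ, Lm k - ∑ k ∈ {i}ᶜ \ I, Lp k)
                  (restrictTo Lp ({i}ᶜ \ I)))
                (restrictTo Lm Jᶜ) := by
  set x₁ := ∑ k ∈ J, Lm k - ∑ k ∈ I, Lp k
  set x₂ := ∑ k ∈ Jᶜ, Lm k - ∑ k ∈ {i}ᶜ \ I, Lp k
  have h1 := Finset.card_add_card_compl J
  have h2 := Finset.card_sdiff_add_card_eq_card hI
  have h3 := card_compl_singleton_add_one i
  have hc : ∀ {Q N : Type} [Fintype Q] [Fintype N] (L : Q → ℝ) (L' : N → ℝ) (a : ℕ),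
      (mapVol a L L').toReal ≠ 0 → ∃ h, a + 2 = 2 * h + (Fintype.card Q + Fintype.card N) := by
    intro Q N _ _ L L' a ha
    obtain ⟨h, hh⟩ := exists_genus a (fun h0 => ha (by rw [h0, ENNReal.toReal_zero]))
    exact ⟨h, by omega⟩
  have key := sum_antidiagonal_genus (g := g) (k := k)
    (F := fun a => (mapVol a (adjoinVar x₁ (restrictTo Lp I)) (restrictTo Lm J)).toReal)
    (G := fun a => (mapVol a (adjoinVar x₂ (restrictTo Lp ({i}ᶜ \ I))) (restrictTo Lm Jᶜ)).toReal)
    (p := Fintype.card (Option I) + Fintype.card J)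
    (q := Fintype.card (Option ↥({i}ᶜ \ I)) + Fintype.card ↥Jᶜ)
    (by
      simp only [Fintype.card_option, Fintype.card_coe]
      omega)
    (hc _ _) (hc _ _) (by rw [mapVol_zero, ENNReal.toReal_zero])
    (by rw [mapVol_zero, ENNReal.toReal_zero])
  have hl : ∀ a : ℕ × ℕ, ((ENNReal.ofReal x₁ *
          mapVol a.1 (adjoinVar x₁ (restrictTo Lp I)) (restrictTo Lm J)) *
        (ENNReal.ofReal x₂ *
          mapVol a.2 (adjoinVar x₂ (restrictTo Lp ({i}ᶜ \ I))) (restrictTo Lm Jᶜ))).toReal =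
      x₁ * x₂ * ((mapVol a.1 (adjoinVar x₁ (restrictTo Lp I)) (restrictTo Lm J)).toReal *
        (mapVol a.2 (adjoinVar x₂ (restrictTo Lp ({i}ᶜ \ I))) (restrictTo Lm Jᶜ)).toReal) := by
    intro a
    rw [ENNReal.toReal_mul, toReal_ofReal_mul_mapVol, toReal_ofReal_mul_mapVol]
    ring
  simp only [hl]
  rw [← Finset.mul_sum, key, Finset.mul_sum]
  refine Finset.sum_congr rfl fun h _ => ?_
  rw [volumeZ_eq (k := 2 * h.1 + (Fintype.card (Option I) + Fintype.card J) - 2) _ _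
      (by rw [Nat.card_eq_fintype_card, Nat.card_eq_fintype_card, add_assoc]),
    volumeZ_eq (k := 2 * h.2 + (Fintype.card (Option ↥({i}ᶜ \ I)) + Fintype.card ↥Jᶜ) - 2) _ _
      (by rw [Nat.card_eq_fintype_card, Nat.card_eq_fintype_card, add_assoc])]
  ring

/-- The integrand of the term of the recursion in which a boundary is cut. -/
theorem integral_cut {P M : Type} [Fintype P] [Finite M] [DecidableEq P] {k : ℕ} (Lp : P → ℝ) (Lm : M → ℝ) {i : P} (hi : 0 < Lp i)
    (hfin : (∫⁻ x, ENNReal.ofReal x * (ENNReal.ofReal (Lp i - x) *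
        mapVol k (adjoinVar x (adjoinVar (Lp i - x) (restrictTo Lp {i}ᶜ))) Lm)) ≠ ∞) :
    IntervalIntegrable (fun x => (mapVol k (adjoinVar x (adjoinVar (Lp i - x)
      (restrictTo Lp {i}ᶜ))) Lm).toReal * (x * (Lp i - x))) volume 0 (Lp i) ∧
    ∫ x in (0 : ℝ)..Lp i, (mapVol k (adjoinVar x (adjoinVar (Lp i - x)
      (restrictTo Lp {i}ᶜ))) Lm).toReal * (x * (Lp i - x)) =
    (∫⁻ x, ENNReal.ofReal x * (ENNReal.ofReal (Lp i - x) *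
        mapVol k (adjoinVar x (adjoinVar (Lp i - x) (restrictTo Lp {i}ᶜ))) Lm)).toReal := by
  let f : ℝ → ℝ≥0∞ := fun x => ENNReal.ofReal x * (ENNReal.ofReal (Lp i - x) *
        mapVol k (adjoinVar x (adjoinVar (Lp i - x) (restrictTo Lp {i}ᶜ))) Lm)
  have hf : Measurable f := ENNReal.measurable_ofReal.mul
    ((ENNReal.measurable_ofReal.comp (measurable_const.sub measurable_id)).mul
      (measurable_mapVol_cut k Lp Lm i))
  have hftop : ∀ x, f x < ∞ := fun x => ENNReal.mul_lt_top ENNReal.ofReal_lt_top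
    (ENNReal.mul_lt_top ENNReal.ofReal_lt_top (mapVol_ne_top _ _ _).lt_top)
  -- Outside the interval one of the two `ENNReal.ofReal` factors is zero.
  have hsupp : ∫⁻ x, f x = ∫⁻ x in Set.Ioc 0 (Lp i), f x := by
    rw [← lintegral_indicator measurableSet_Ioc]
    refine lintegral_congr fun x => ?_
    by_cases hx : x ∈ Set.Ioc 0 (Lp i)
    · rw [Set.indicator_of_mem hx]
    · rw [Set.indicator_of_notMem hx]
      rw [Set.mem_Ioc, not_and_or, not_lt, not_le] at hx
      rcases hx with hx | hx
      · simp only [f, ENNReal.ofReal_of_nonpos hx, zero_mul]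
      · simp only [f, ENNReal.ofReal_of_nonpos (sub_neg.2 hx).le, zero_mul, mul_zero]
  have heq : ∀ x ∈ Set.Ioc 0 (Lp i), (f x).toReal = (mapVol k (adjoinVar x (adjoinVar (Lp i - x)
      (restrictTo Lp {i}ᶜ))) Lm).toReal * (x * (Lp i - x)) := by
    intro x hx
    simp only [f]
    rw [ENNReal.toReal_mul, ENNReal.toReal_mul, ENNReal.toReal_ofReal hx.1.le,
      ENNReal.toReal_ofReal (sub_nonneg.2 hx.2)]
    ring
  change ∫⁻ x, f x ≠ ∞ at hfin
  rw [hsupp] at hfin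
  constructor
  · rw [intervalIntegrable_iff_integrableOn_Ioc_of_le hi.le]
    exact (integrableOn_congr_fun heq measurableSet_Ioc).1
      (integrable_toReal_of_lintegral_ne_top hf.aemeasurable hfin)
  · change _ = (∫⁻ x, f x).toReal
    rw [hsupp, intervalIntegral.integral_of_le hi.le,
      ← integral_toReal hf.aemeasurable (Filter.Eventually.of_forall hftop)]
    exact (setIntegral_congr_fun measurableSet_Ioc heq).symm

end RealRecursion

theorem theorem3 (g np nm : ℕ) (hnp : 1 ≤ np) (hnm : 1 ≤ nm) (hstable : 3 ≤ 2 * g + np + nm)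
    (Lp : Fin np → ℝ) (Lm : Fin nm → ℝ) (hLp : ∀ i, 0 < Lp i) (hLm : ∀ j, 0 < Lm j)
    (hsum : ∑ i, Lp i = ∑ j, Lm j) :
    moduliVolume g Lp Lm ≠ ∞ ∧
    (4 ≤ 2 * g + np + nm →
      (1 ≤ g → ∀ i, IntervalIntegrable
        (fun x => volumeZ (g - 1) (adjoinVar x (adjoinVar (Lp i - x) (restrictTo Lp {i}ᶜ))) Lm *
          (x * (Lp i - x))) volume 0 (Lp i)) ∧
      (2 * (g : ℝ) - 2 + np + nm) * volumeZ g Lp Lm =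
        ∑ i, ∑ j, max (Lp i - Lm j) 0 *
            volumeZ g (adjoinVar (max (Lp i - Lm j) 0) (restrictTo Lp {i}ᶜ))
              (restrictTo Lm {j}ᶜ)
        + 1 / 2 * ∑ i, ∑ j with j ≠ i, (Lp i + Lp j) *
            volumeZ g (adjoinVar (Lp i + Lp j) (restrictTo Lp {i, j}ᶜ)) Lm
        + (if 1 ≤ g then
            1 / 2 * ∑ i, ∫ x in (0 : ℝ)..Lp i,
              volumeZ (g - 1) (adjoinVar x (adjoinVar (Lp i - x) (restrictTo Lp {i}ᶜ))) Lm *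
                (x * (Lp i - x))
          else 0)
        + 1 / 2 * ∑ i, ∑ h ∈ Finset.HasAntidiagonal.antidiagonal g,
            ∑ I ∈ ({i}ᶜ : Finset (Fin np)).powerset, ∑ J : Finset (Fin nm),
              (∑ k ∈ J, Lm k - ∑ k ∈ I, Lp k) *
              (∑ k ∈ Jᶜ, Lm k - ∑ k ∈ {i}ᶜ \ I, Lp k) *
              volumeZ h.1 (adjoinVar (∑ k ∈ J, Lm k - ∑ k ∈ I, Lp k) (restrictTo Lp I))
                (restrictTo Lm J) *
              volumeZ h.2
                (adjoinVar (∑ k ∈ Jᶜ, Lm k - ∑ k ∈ {i}ᶜ \ I, Lp k)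
                  (restrictTo Lp ({i}ᶜ \ I)))
                (restrictTo Lm Jᶜ)) := by

  refine ⟨by rw [moduliVolume_eq_mapVol]; exact mapVol_ne_top _ _ _, fun h4 => ?_⟩
  -- The graphs on the left have `k + 1` vertices; those in the first three terms have `k`.
  obtain ⟨k, hk⟩ : ∃ k, k + 3 = 2 * g + np + nm := ⟨2 * g + np + nm - 3, by omega⟩
  have hk0 : k ≠ 0 := by omega
  have hkc : k + 3 = 2 * g + Fintype.card (Fin np) + Fintype.card (Fin nm) := by
    rw [Fintype.card_fin, Fintype.card_fin, hk]
  have hrec := mapVol_succ hk0 hLp hLm hsum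
  have hcP : ∀ i : Fin np, ({i}ᶜ : Finset (Fin np)).card + 1 = np := fun i => by
    have := card_compl_singleton_add_one i
    rwa [Fintype.card_fin] at this
  have hcM : ∀ j : Fin nm, ({j}ᶜ : Finset (Fin nm)).card + 1 = nm := fun j => by
    have := card_compl_singleton_add_one j
    rwa [Fintype.card_fin] at this
  have hlhs : 2 * ((k : ℝ≥0∞) + 1) * mapVol (k + 1) Lp Lm ≠ ∞ :=
    ENNReal.mul_ne_top (ENNReal.mul_ne_top (by simp) (by simp)) (mapVol_ne_top _ _ _)
  -- The integrals are summands of a sum equal to the left side, which is finite.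
  have hint : ∀ i, (∫⁻ x, ENNReal.ofReal x * (ENNReal.ofReal (Lp i - x) *
        mapVol k (adjoinVar x (adjoinVar (Lp i - x) (restrictTo Lp {i}ᶜ))) Lm)) ≠ ∞ := by
    rw [hrec, ENNReal.add_ne_top, ENNReal.add_ne_top] at hlhs
    exact fun i => ENNReal.sum_ne_top.1 hlhs.1.2 i (Finset.mem_univ i)
  have hcutZ : 1 ≤ g → ∀ i x, volumeZ (g - 1) (adjoinVar x (adjoinVar (Lp i - x)
      (restrictTo Lp {i}ᶜ))) Lm =
      (mapVol k (adjoinVar x (adjoinVar (Lp i - x) (restrictTo Lp {i}ᶜ))) Lm).toReal := by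
    intro hg i x
    refine volumeZ_eq _ _ ?_
    have := hcP i
    rw [Nat.card_eq_fintype_card, Nat.card_eq_fintype_card, Fintype.card_option,
      Fintype.card_option, Fintype.card_coe, Fintype.card_fin]
    omega
  refine ⟨fun hg i => ?_, ?_⟩
  · simp only [hcutZ hg i]
    exact (integral_cut Lp Lm (hLp i) (hint i)).1
  have hZ : volumeZ g Lp Lm = (mapVol (k + 1) Lp Lm).toReal := by
    refine volumeZ_eq _ _ ?_
    rw [Nat.card_eq_fintype_card, Nat.card_eq_fintype_card, Fintype.card_fin, Fintype.card_fin]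
    omega
  have hkR : 2 * (g : ℝ) - 2 + np + nm = k + 1 := by
    have : (k : ℝ) + 3 = 2 * g + np + nm := by exact_mod_cast hk
    linarith
  have t1 : ∀ i j, max (Lp i - Lm j) 0 * volumeZ g (adjoinVar (max (Lp i - Lm j) 0)
      (restrictTo Lp {i}ᶜ)) (restrictTo Lm {j}ᶜ) = (ENNReal.ofReal (Lp i - Lm j) *
        mapVol k (adjoinVar (Lp i - Lm j) (restrictTo Lp {i}ᶜ)) (restrictTo Lm {j}ᶜ)).toReal := by
    intro i j
    rcases le_total (Lp i - Lm j) 0 with h | h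
    · rw [max_eq_right h, ENNReal.ofReal_of_nonpos h]
      simp
    · rw [max_eq_left h, toReal_ofReal_mul_mapVol, volumeZ_eq (k := k)]
      have h1 := hcP i
      have h2 := hcM j
      rw [Nat.card_eq_fintype_card, Nat.card_eq_fintype_card, Fintype.card_option,
        Fintype.card_coe, Fintype.card_coe]
      omega
  have t2 : ∀ i, ∀ j ∈ Finset.univ.filter (fun j => j ≠ i), (Lp i + Lp j) * volumeZ g
      (adjoinVar (Lp i + Lp j) (restrictTo Lp {i, j}ᶜ)) Lm = (ENNReal.ofReal (Lp i + Lp j) *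
        mapVol k (adjoinVar (Lp i + Lp j) (restrictTo Lp {i, j}ᶜ)) Lm).toReal := by
    intro i j hj
    rw [toReal_ofReal_mul_mapVol, volumeZ_eq (k := k)]
    have h1 := Finset.card_add_card_compl {i, j}
    rw [Finset.card_pair (Finset.mem_filter.1 hj).2.symm, Fintype.card_fin] at h1
    rw [Nat.card_eq_fintype_card, Nat.card_eq_fintype_card, Fintype.card_option,
      Fintype.card_coe, Fintype.card_fin]
    omega
  have t3 : (if 1 ≤ g then
            1 / 2 * ∑ i, ∫ x in (0 : ℝ)..Lp i,
              volumeZ (g - 1) (adjoinVar x (adjoinVar (Lp i - x) (restrictTo Lp {i}ᶜ))) Lm *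
                (x * (Lp i - x))
          else 0) = 1 / 2 * ∑ i, (∫⁻ x, ENNReal.ofReal x * (ENNReal.ofReal (Lp i - x) *
        mapVol k (adjoinVar x (adjoinVar (Lp i - x) (restrictTo Lp {i}ᶜ))) Lm)).toReal := by
    split_ifs with hg
    · congr 1
      refine Finset.sum_congr rfl fun i _ => ?_
      simp only [hcutZ hg i]
      exact (integral_cut Lp Lm (hLp i) (hint i)).2
    · rw [Finset.sum_eq_zero, mul_zero]
      intro i _
      rw [lintegral_congr (g := fun _ => 0), lintegral_zero, ENNReal.toReal_zero]
      intro x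
      -- In genus 0 the cut graph would have one boundary too many for `k` vertices, so its volume
      -- vanishes.
      have : mapVol k (adjoinVar x (adjoinVar (Lp i - x) (restrictTo Lp {i}ᶜ))) Lm = 0 := by
        by_contra hne
        obtain ⟨h, hh⟩ := exists_genus k hne
        have := hcP i
        rw [Fintype.card_option, Fintype.card_option, Fintype.card_coe, Fintype.card_fin] at hh
        omega
      rw [this, mul_zero, mul_zero]
  have t4 : ∀ i, (∑ h ∈ Finset.HasAntidiagonal.antidiagonal g,
            ∑ I ∈ ({i}ᶜ : Finset (Fin np)).powerset, ∑ J : Finset (Fin nm),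
              (∑ k ∈ J, Lm k - ∑ k ∈ I, Lp k) *
              (∑ k ∈ Jᶜ, Lm k - ∑ k ∈ {i}ᶜ \ I, Lp k) *
              volumeZ h.1 (adjoinVar (∑ k ∈ J, Lm k - ∑ k ∈ I, Lp k) (restrictTo Lp I))
                (restrictTo Lm J) *
              volumeZ h.2
                (adjoinVar (∑ k ∈ Jᶜ, Lm k - ∑ k ∈ {i}ᶜ \ I, Lp k)
                  (restrictTo Lp ({i}ᶜ \ I)))
                (restrictTo Lm Jᶜ)) =
      ∑ a ∈ Finset.HasAntidiagonal.antidiagonal k,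
        ∑ I ∈ ({i}ᶜ : Finset (Fin np)).powerset, ∑ J : Finset (Fin nm),
        ((ENNReal.ofReal (∑ k ∈ J, Lm k - ∑ k ∈ I, Lp k) *
          mapVol a.1 (adjoinVar (∑ k ∈ J, Lm k - ∑ k ∈ I, Lp k) (restrictTo Lp I))
            (restrictTo Lm J)) *
        (ENNReal.ofReal (∑ k ∈ Jᶜ, Lm k - ∑ k ∈ {i}ᶜ \ I, Lp k) *
          mapVol a.2 (adjoinVar (∑ k ∈ Jᶜ, Lm k - ∑ k ∈ {i}ᶜ \ I, Lp k)
            (restrictTo Lp ({i}ᶜ \ I))) (restrictTo Lm Jᶜ))).toReal := by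
    intro i
    rw [Finset.sum_comm, Finset.sum_comm (s := Finset.HasAntidiagonal.antidiagonal k)]
    refine Finset.sum_congr rfl fun I hI => ?_
    rw [Finset.sum_comm, Finset.sum_comm (s := Finset.HasAntidiagonal.antidiagonal k)]
    exact Finset.sum_congr rfl fun J _ =>
      (toReal_sum_parts hkc Lp Lm i (Finset.mem_powerset.1 hI) J).symm
  have hm : ∀ {P M : Type} [Finite P] [Finite M] (x : ℝ) (a : ℕ) (L : P → ℝ) (L' : M → ℝ),
      ENNReal.ofReal x * mapVol a L L' ≠ ∞ := fun x a L L' =>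
    ENNReal.mul_ne_top ENNReal.ofReal_ne_top (mapVol_ne_top _ _ _)
  have n1 : ∀ i ∈ Finset.univ, (∑ j, ENNReal.ofReal (Lp i - Lm j) *
        mapVol k (adjoinVar (Lp i - Lm j) (restrictTo Lp {i}ᶜ)) (restrictTo Lm {j}ᶜ)) ≠ ∞ :=
    fun i _ => ENNReal.sum_ne_top.2 fun j _ => hm _ _ _ _
  have n2 : ∀ i ∈ Finset.univ, (∑ j with j ≠ i, ENNReal.ofReal (Lp i + Lp j) *
        mapVol k (adjoinVar (Lp i + Lp j) (restrictTo Lp {i, j}ᶜ)) Lm) ≠ ∞ :=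
    fun i _ => ENNReal.sum_ne_top.2 fun j _ => hm _ _ _ _
  have h := congrArg ENNReal.toReal hrec
  rw [hrec] at hlhs
  have hl1 := ENNReal.add_ne_top.1 hlhs
  have hl2 := ENNReal.add_ne_top.1 hl1.1
  have hl3 := ENNReal.add_ne_top.1 hl2.1
  rw [ENNReal.toReal_add hl1.1 hl1.2, ENNReal.toReal_add hl2.1 hl2.2,
    ENNReal.toReal_add hl3.1 hl3.2, ENNReal.toReal_mul, ENNReal.toReal_mul, ENNReal.toReal_mul,
    ENNReal.toReal_sum n1, ENNReal.toReal_sum n2, ENNReal.toReal_sum fun i _ => hint i,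
    ENNReal.toReal_sum fun i hi => ENNReal.sum_ne_top.1 hl1.2 i hi] at h
  rw [hkR, hZ, t3, Finset.sum_congr rfl fun i _ => Finset.sum_congr rfl fun j _ => t1 i j,
    Finset.sum_congr rfl fun i _ => Finset.sum_congr rfl fun j hj => t2 i j hj,
    Finset.sum_congr rfl fun i _ => t4 i]
  rw [Finset.sum_congr rfl fun i hi => ENNReal.toReal_sum fun j _ => hm _ _ _ _,
    Finset.sum_congr rfl fun i hi => ENNReal.toReal_sum (s := Finset.univ.filter fun j => j ≠ i)
      fun j _ => hm _ _ _ _] at h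
  have h2 : (2 : ℝ≥0∞).toReal = 2 := by simp
  have hk1 : ((k : ℝ≥0∞) + 1).toReal = k + 1 := by
    rw [ENNReal.toReal_add (by simp) (by simp)]
    simp
  have h4' : ∀ i, (∑ a ∈ Finset.HasAntidiagonal.antidiagonal k,
        ∑ I ∈ ({i}ᶜ : Finset (Fin np)).powerset, ∑ J : Finset (Fin nm),
        (ENNReal.ofReal (∑ k ∈ J, Lm k - ∑ k ∈ I, Lp k) *
          mapVol a.1 (adjoinVar (∑ k ∈ J, Lm k - ∑ k ∈ I, Lp k) (restrictTo Lp I))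
            (restrictTo Lm J)) *
        (ENNReal.ofReal (∑ k ∈ Jᶜ, Lm k - ∑ k ∈ {i}ᶜ \ I, Lp k) *
          mapVol a.2 (adjoinVar (∑ k ∈ Jᶜ, Lm k - ∑ k ∈ {i}ᶜ \ I, Lp k)
            (restrictTo Lp ({i}ᶜ \ I))) (restrictTo Lm Jᶜ))).toReal =
      ∑ a ∈ Finset.HasAntidiagonal.antidiagonal k,
        ∑ I ∈ ({i}ᶜ : Finset (Fin np)).powerset, ∑ J : Finset (Fin nm),
        ((ENNReal.ofReal (∑ k ∈ J, Lm k - ∑ k ∈ I, Lp k) *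
          mapVol a.1 (adjoinVar (∑ k ∈ J, Lm k - ∑ k ∈ I, Lp k) (restrictTo Lp I))
            (restrictTo Lm J)) *
        (ENNReal.ofReal (∑ k ∈ Jᶜ, Lm k - ∑ k ∈ {i}ᶜ \ I, Lp k) *
          mapVol a.2 (adjoinVar (∑ k ∈ Jᶜ, Lm k - ∑ k ∈ {i}ᶜ \ I, Lp k)
            (restrictTo Lp ({i}ᶜ \ I))) (restrictTo Lm Jᶜ))).toReal := by
    intro i
    have hmm := fun (a : ℕ × ℕ) (I : Finset (Fin np)) (J : Finset (Fin nm)) =>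
      ENNReal.mul_ne_top (hm (∑ k ∈ J, Lm k - ∑ k ∈ I, Lp k) a.1
        (adjoinVar (∑ k ∈ J, Lm k - ∑ k ∈ I, Lp k) (restrictTo Lp I)) (restrictTo Lm J))
        (hm (∑ k ∈ Jᶜ, Lm k - ∑ k ∈ {i}ᶜ \ I, Lp k) a.2
          (adjoinVar (∑ k ∈ Jᶜ, Lm k - ∑ k ∈ {i}ᶜ \ I, Lp k)
            (restrictTo Lp ({i}ᶜ \ I))) (restrictTo Lm Jᶜ))
    rw [ENNReal.toReal_sum fun a _ => ENNReal.sum_ne_top.2 fun I _ =>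
      ENNReal.sum_ne_top.2 fun J _ => hmm a I J]
    refine Finset.sum_congr rfl fun a _ => ?_
    rw [ENNReal.toReal_sum fun I _ => ENNReal.sum_ne_top.2 fun J _ => hmm a I J]
    exact Finset.sum_congr rfl fun I _ => ENNReal.toReal_sum fun J _ => hmm a I J
  rw [Finset.sum_congr rfl fun i _ => h4' i, h2, hk1] at h
  -- Dividing by 2 leaves `k + 1` on the left and the factors 1/2 on the last three terms.
  linarith
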